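/- **The logic $FO\lambda^{\Delta\mathbb N}$.** Terms are simply typed $\lambda$-terms, identified up to $\alpha\beta\eta$-conversion, over base types $i$ (PCF terms and PCF types), $nt$ (natural numbers), $atm$ and $prp$ (atoms and goal formulas of the object logic) and $lst$ (lists of atoms). The constants are $z:nt$, $s:nt\to nt$; $nil:lst$, $(::):atm\to lst\to lst$; $\langle\cdot\rangle:atm\to prp$, $tt:prp$, $\&:prp\to prp\to prp$, $\Rightarrow\,:atm\to prp\to prp$, $\bigwedge:(i\to prp)\to prp$; the PCF types $num,bool:i$, $arr:i\to i\to i$; the PCF terms $zero,true,false:i$, $succ,pred,is\_zero:i\to i$, $if:i\to i\to i\to i$, $abs,rec:i\to(i\to i)\to i$, $app:i\to i\to i$; and $typeof,\Downarrow,\leadsto,\leadsto^*:i\to i\to atm$, $value:i\to atm$. We write $\bigwedge n\,B$ for $\bigwedge(\lambda n.B)$. Formulas are built from atomic formulas by $\bot,\top,\wedge,\vee,\supset,\forall_\tau,\exists_\tau$, with $\tau$ any simple type over these base types. Sequents $\Gamma\longrightarrow C$ (with $\Gamma$ a finite multiset of formulas) are derived by the usual left and right rules of intuitionistic first-order sequent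 calculus, initial sequents $A,\Gamma\longrightarrow A$ for atomic $A$, contraction and cut, together with the following rules. * Natural numbers: $\Gamma\longrightarrow nat\,z$; from $\Gamma\longrightarrow nat\,I$ infer $\Gamma\longrightarrow nat\,(s\,I)$; from $\longrightarrow B\,z$, $\;B\,j\longrightarrow B\,(s\,j)$ ($j$ a new variable) and $B\,I,\Gamma\longrightarrow C$ infer $nat\,I,\Gamma\longrightarrow C$. * Definitions, relative to a fixed set of clauses $\forall\bar x[H\triangleq B]$ with atomic head $H$ (bodies $\top$ omitted below). Right: from $\Gamma\longrightarrow B\theta$ infer $\Gamma\longrightarrow H\theta$. Left, for an atom $A$ other than $nat\,I$: infer $A,\Gamma\longrightarrow C$ from the premises $B\theta,\Gamma\theta\longrightarrow C\theta$, one for each clause (with $\bar x$ renamed apart) and each $\theta$ in a complete set of unifiers of $A$ and the head $H$ of that clause. **The definition.** It consists of the following clauses, in which the capital letters are universally quantified. *Numbers:* $I=I$; $\;sum\,z\,J\,J\triangleq nat\,J$; $\;sum\,(s\,I)\,J\,(s\,K)\triangleq sum\,I\,J\,K$; $\;z<s\,J\triangleq nat\,J$; $\;s\,I<s\,J\triangleq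 I<J$; $\;I\le I$; $\;I\le J\triangleq I<J$. *Lists:* $length\,nil\,z$; $\;length\,(X::L)\,(s\,I)\triangleq length\,L\,I$; $\;list\,L\triangleq\exists i(nat\,i\wedge length\,L\,i)$; $\;element\,X\,(X::L)$; $\;element\,X\,(Y::L)\triangleq element\,X\,L$; $\;split\,nil\,nil\,nil$; $\;split\,(X::L_1)\,(X::L_2)\,L_3\triangleq split\,L_1\,L_2\,L_3$; $\;split\,(X::L_1)\,L_2\,(X::L_3)\triangleq split\,L_1\,L_2\,L_3$; $\;permute\,nil\,nil$; $\;permute\,(X::L_1)\,L_2\triangleq\exists l(split\,L_2\,(X::nil)\,l\wedge permute\,L_1\,l)$. *Object logic (intuitionistic sequents of height at most $I$):* $seq\,I\,(A'::L)\,\langle A\rangle\triangleq element\,A\,(A'::L)$; $\;seq\,I\,L\,tt$; $\;seq\,(s\,I)\,L\,(B\,\&\,C)\triangleq seq\,I\,L\,B\wedge seq\,I\,L\,C$; $\;seq\,(s\,I)\,L\,(A\Rightarrow B)\triangleq seq\,I\,(A::L)\,B$; $\;seq\,(s\,I)\,L\,(\bigwedge B)\triangleq\forall x\,seq\,I\,L\,(B\,x)$;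 $\;seq\,(s\,I)\,L\,\langle A\rangle\triangleq\exists b(prog\,A\,b\wedge seq\,I\,L\,b)$. *PCF:* the clauses $prog\,A\,G\triangleq\top$ for the following pairs, written $A\Leftarrow G$, or $A$ alone if $G$ is $tt$ (the brackets $\langle\cdot\rangle$ in $G$ are omitted, and $M:T$ abbreviates $typeof\,M\,T$). Typing: $zero:num$; $\;true:bool$; $\;false:bool$; $\;succ\,M:num\Leftarrow M:num$; $\;pred\,M:num\Leftarrow M:num$; $\;is\_zero\,M:bool\Leftarrow M:num$; $\;if\,M\,N_1\,N_2:T\Leftarrow M:bool\;\&\;N_1:T\;\&\;N_2:T$; $\;abs\,T\,R:arr\,T\,U\Leftarrow\bigwedge n(n:T\Rightarrow R\,n:U)$; $\;app\,M\,N:T\Leftarrow M:arr\,U\,T\;\&\;N:U$; $\;rec\,T\,R:T\Leftarrow\bigwedge n(n:T\Rightarrow R\,n:T)$. Natural semantics: $zero\Downarrow zero$; $\;true\Downarrow true$; $\;false\Downarrow false$; $\;succ\,M\Downarrow succ\,V\Leftarrow M\Downarrow V$; $\;pred\,M\Downarrow zero\Leftarrow M\Downarrow zero$; $\;pred\,M\Downarrow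 V\Leftarrow M\Downarrow succ\,V$; $\;is\_zero\,M\Downarrow true\Leftarrow M\Downarrow zero$; $\;is\_zero\,M\Downarrow false\Leftarrow M\Downarrow succ\,V$; $\;if\,M\,N_1\,N_2\Downarrow V\Leftarrow M\Downarrow true\;\&\;N_1\Downarrow V$; $\;if\,M\,N_1\,N_2\Downarrow V\Leftarrow M\Downarrow false\;\&\;N_2\Downarrow V$; $\;abs\,T\,R\Downarrow abs\,T\,R$; $\;app\,M\,N\Downarrow V\Leftarrow M\Downarrow abs\,T\,R\;\&\;R\,N\Downarrow V$; $\;rec\,T\,R\Downarrow V\Leftarrow R\,(rec\,T\,R)\Downarrow V$. Transition semantics: $succ\,M\leadsto succ\,M'\Leftarrow M\leadsto M'$; $\;pred\,zero\leadsto zero$; $\;pred\,(succ\,V)\leadsto V\Leftarrow value\,V$; $\;pred\,M\leadsto pred\,M'\Leftarrow M\leadsto M'$; $\;is\_zero\,zero\leadsto true$; $\;is\_zero\,(succ\,V)\leadsto false\Leftarrow value\,V$; $\;is\_zero\,M\leadsto is\_zero\,M'\Leftarrow M\leadsto M'$; $\;if\,true\,M\,N\leadsto M$; $\;if\,false\,M\,N\leadsto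 N$; $\;if\,M\,N_1\,N_2\leadsto if\,M'\,N_1\,N_2\Leftarrow M\leadsto M'$; $\;app\,(abs\,T\,R)\,N\leadsto R\,N$; $\;app\,M\,N\leadsto app\,M'\,N\Leftarrow M\leadsto M'$; $\;rec\,T\,R\leadsto R\,(rec\,T\,R)$; $\;M\leadsto^*M$; $\;M\leadsto^*N\Leftarrow M\leadsto M'\;\&\;M'\leadsto^*N$. Values: $value\,zero$; $\;value\,true$; $\;value\,false$; $\;value\,(succ\,V)\Leftarrow value\,V$; $\;value\,(abs\,T\,R)$. *Equality at type $i$:* $X\equiv X$. For an atom $A$ of the object logic, let $\rhd A$ abbreviate the formula $\exists j(nat\,j\wedge seq\,j\,nil\,\langle A\rangle)$. **Theorem.** For each of the following nine formulas $F$ (all quantifiers over type $i$), the sequent $\longrightarrow F$ is derivable in $FO\lambda^{\Delta\mathbb N}$ from this definition. Determinacy of semantics: 1. $\forall m\forall m_1\forall m_2(\rhd(m\Downarrow m_1)\supset\rhd(m\Downarrow m_2)\supset m_1\equiv m_2)$ 2. $\forall m\forall m_1\forall m_2(\rhd(m\leadsto m_1)\supset\rhd(m\leadsto m_2)\supset m_1\equiv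 m_2)$ 3. $\forall m\forall v_1\forall v_2(\rhd(value\,v_1)\supset\rhd(m\leadsto^*v_1)\supset\rhd(value\,v_2)\supset\rhd(m\leadsto^*v_2)\supset v_1\equiv v_2)$ Equivalence of semantics: 4. $\forall m\forall v(\rhd(m\Downarrow v)\supset(\rhd(value\,v)\wedge\rhd(m\leadsto^*v)))$ 5. $\forall m\forall v((\rhd(value\,v)\wedge\rhd(m\leadsto^*v))\supset\rhd(m\Downarrow v))$ Subject reduction: 6. $\forall m\forall n(\rhd(m\Downarrow n)\supset\forall t(\rhd(typeof\,m\,t)\supset\rhd(typeof\,n\,t)))$ 7. $\forall m\forall n(\rhd(m\leadsto n)\supset\forall t(\rhd(typeof\,m\,t)\supset\rhd(typeof\,n\,t)))$ 8. $\forall m\forall n(\rhd(m\leadsto^*n)\supset\forall t(\rhd(typeof\,m\,t)\supset\rhd(typeof\,n\,t)))$ Unicity of typing: 9. $\forall m\forall t_1\forall t_2(\rhd(typeof\,m\,t_1)\supset\rhd(typeof\,m\,t_2)\supset t_1\equiv t_2)$ -/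

import Mathlib

namespace FOLDN

/-! ### Simply typed lambda-terms over the signature of the PCF encoding -/

/-- Types without the formula type: `i` (object-level terms and object-level types), `nt` (natural
numbers), `atm` and `prp` (object-logic atoms and goal formulas), `lst` (lists of object-logic
atoms), and function types. -/
inductive Ty : Type
  | i | nt | atm | prp | lst
  | arr (a b : Ty)

/-- A list of typed variables; the variable of index `0` is the head of the list. -/
abbrev Ctx : Type := List Ty

/-- Typed de Bruijn indices. -/
inductive Var : Ctx → Ty → Type
  | zero {Γ : Ctx} {a : Ty} : Var (a :: Γ) a
  | succ {Γ : Ctx} {a b : Ty} (x : Var Γ a) : Var (b :: Γ) a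

/-- The constants. -/
inductive Const : Ty → Type
  -- natural numbers
  | z : Const .nt
  | s : Const (.arr .nt .nt)
  -- lists of atoms
  | nil : Const .lst
  | cons : Const (.arr .atm (.arr .lst .lst))
  -- goal formulas of the intuitionistic object logic
  | atom : Const (.arr .atm .prp)
  | tt : Const .prp
  | amp : Const (.arr .prp (.arr .prp .prp))
  | imp : Const (.arr .atm (.arr .prp .prp))
  | forallI : Const (.arr (.arr .i .prp) .prp)
  -- PCF types
  | num : Const .i
  | bool : Const .i
  | arrow : Const (.arr .i (.arr .i .i))
  -- PCF terms
  | zero : Const .i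
  | tru : Const .i
  | fls : Const .i
  | succ : Const (.arr .i .i)
  | pred : Const (.arr .i .i)
  | isZero : Const (.arr .i .i)
  | cond : Const (.arr .i (.arr .i (.arr .i .i)))
  | abs : Const (.arr .i (.arr (.arr .i .i) .i))
  | app : Const (.arr .i (.arr .i .i))
  | fix : Const (.arr .i (.arr (.arr .i .i) .i))
  -- judgements about PCF
  | typeof : Const (.arr .i (.arr .i .atm))
  | natsem : Const (.arr .i (.arr .i .atm))
  | transone : Const (.arr .i (.arr .i .atm))
  | transsem : Const (.arr .i (.arr .i .atm))
  | value : Const (.arr .i .atm)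

/-- Lambda-terms, before identification up to conversion. -/
inductive Raw : Ctx → Ty → Type
  | var {Γ : Ctx} {a : Ty} (x : Var Γ a) : Raw Γ a
  | const {Γ : Ctx} {a : Ty} (c : Const a) : Raw Γ a
  | lam {Γ : Ctx} {a b : Ty} (t : Raw (a :: Γ) b) : Raw Γ (.arr a b)
  | app {Γ : Ctx} {a b : Ty} (t : Raw Γ (.arr a b)) (u : Raw Γ a) : Raw Γ b

/-- Renamings of variables. -/
abbrev Ren (Γ Δ : Ctx) : Type := ∀ ⦃a : Ty⦄, Var Γ a → Var Δ a

/-- Substitutions by raw terms. -/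
abbrev RawSub (Γ Δ : Ctx) : Type := ∀ ⦃a : Ty⦄, Var Γ a → Raw Δ a

/-- Extension of a renaming under a binder. -/
def Ren.lift {Γ Δ : Ctx} {b : Ty} (ρ : Ren Γ Δ) : Ren (b :: Γ) (b :: Δ)
  | _, .zero => .zero
  | _, .succ x => .succ (ρ x)

/-- Renaming in raw terms. -/
def Raw.rename : {Γ Δ : Ctx} → {a : Ty} → Ren Γ Δ → Raw Γ a → Raw Δ a
  | _, _, _, ρ, .var x => .var (ρ x)
  | _, _, _, _, .const c => .const c
  | _, _, _, ρ, .lam t => .lam (t.rename ρ.lift)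
  | _, _, _, ρ, .app t u => .app (t.rename ρ) (u.rename ρ)

/-- The renaming that introduces one new variable. -/
def Ren.shift {Γ : Ctx} {b : Ty} : Ren Γ (b :: Γ) := fun _ x => .succ x

/-- Extension of a substitution under a binder. -/
def RawSub.lift {Γ Δ : Ctx} {b : Ty} (σ : RawSub Γ Δ) : RawSub (b :: Γ) (b :: Δ)
  | _, .zero => .var .zero
  | _, .succ x => (σ x).rename Ren.shift

/-- Capture-avoiding simultaneous substitution in raw terms. -/
def Raw.subst : {Γ Δ : Ctx} → {a : Ty} → RawSub Γ Δ → Raw Γ a → Raw Δ a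
  | _, _, _, σ, .var x => σ x
  | _, _, _, _, .const c => .const c
  | _, _, _, σ, .lam t => .lam (t.subst σ.lift)
  | _, _, _, σ, .app t u => .app (t.subst σ) (u.subst σ)

/-- The substitution of `u` for the variable of index `0`. -/
def RawSub.single {Γ : Ctx} {b : Ty} (u : Raw Γ b) : RawSub (b :: Γ) Γ
  | _, .zero => u
  | _, .succ x => .var x

/-- Beta-eta-conversion. -/
inductive Conv : {Γ : Ctx} → {a : Ty} → Raw Γ a → Raw Γ a → Prop
  | refl {Γ : Ctx} {a : Ty} (t : Raw Γ a) : Conv t t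
  | symm {Γ : Ctx} {a : Ty} {t u : Raw Γ a} : Conv t u → Conv u t
  | trans {Γ : Ctx} {a : Ty} {t u v : Raw Γ a} : Conv t u → Conv u v → Conv t v
  | lam {Γ : Ctx} {a b : Ty} {t u : Raw (a :: Γ) b} : Conv t u → Conv (.lam t) (.lam u)
  | app {Γ : Ctx} {a b : Ty} {t t' : Raw Γ (.arr a b)} {u u' : Raw Γ a} :
      Conv t t' → Conv u u' → Conv (.app t u) (.app t' u')
  | beta {Γ : Ctx} {a b : Ty} (t : Raw (a :: Γ) b) (u : Raw Γ a) :
      Conv (.app (.lam t) u) (t.subst (RawSub.single u))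
  | eta {Γ : Ctx} {a b : Ty} (t : Raw Γ (.arr a b)) :
      Conv (.lam (.app (t.rename Ren.shift) (.var .zero))) t

/-! Conversion is preserved by renaming and substitution. -/

theorem Raw.rename_rename {Γ : Ctx} {a : Ty} (t : Raw Γ a) :
    ∀ {Δ Θ : Ctx} (ρ : Ren Γ Δ) (τ : Ren Δ Θ),
      (t.rename ρ).rename τ = t.rename (fun _ x => τ (ρ x)) := by
  induction t with
  | var x => intros; rfl
  | const c => intros; rfl
  | lam t ih =>
    intro Δ Θ ρ τ
    simp only [Raw.rename, ih]
    congr 2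
    funext a x
    cases x <;> rfl
  | app t u iht ihu => intro Δ Θ ρ τ; simp only [Raw.rename, iht, ihu]

theorem Raw.subst_rename {Γ : Ctx} {a : Ty} (t : Raw Γ a) :
    ∀ {Δ Θ : Ctx} (ρ : Ren Γ Δ) (σ : RawSub Δ Θ),
      (t.rename ρ).subst σ = t.subst (fun _ x => σ (ρ x)) := by
  induction t with
  | var x => intros; rfl
  | const c => intros; rfl
  | lam t ih =>
    intro Δ Θ ρ σ
    simp only [Raw.rename, Raw.subst, ih]
    congr 2
    funext a x
    cases x <;> rfl
  | app t u iht ihu => intro Δ Θ ρ σ; simp only [Raw.rename, Raw.subst, iht, ihu]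

theorem Raw.rename_subst {Γ : Ctx} {a : Ty} (t : Raw Γ a) :
    ∀ {Δ Θ : Ctx} (σ : RawSub Γ Δ) (ρ : Ren Δ Θ),
      (t.subst σ).rename ρ = t.subst (fun _ x => (σ x).rename ρ) := by
  induction t with
  | var x => intros; rfl
  | const c => intros; rfl
  | lam t ih =>
    intro Δ Θ σ ρ
    simp only [Raw.rename, Raw.subst, ih]
    congr 2
    funext a x
    cases x with
    | zero => rfl
    | succ x => simp only [RawSub.lift, Raw.rename_rename]; rfl
  | app t u iht ihu => intro Δ Θ σ ρ; simp only [Raw.rename, Raw.subst, iht, ihu]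

theorem Raw.subst_subst {Γ : Ctx} {a : Ty} (t : Raw Γ a) :
    ∀ {Δ Θ : Ctx} (σ : RawSub Γ Δ) (τ : RawSub Δ Θ),
      (t.subst σ).subst τ = t.subst (fun _ x => (σ x).subst τ) := by
  induction t with
  | var x => intros; rfl
  | const c => intros; rfl
  | lam t ih =>
    intro Δ Θ σ τ
    simp only [Raw.subst, ih]
    congr 2
    funext a x
    cases x with
    | zero => rfl
    | succ x => simp only [RawSub.lift, Raw.subst_rename, Raw.rename_subst]; rfl
  | app t u iht ihu => intro Δ Θ σ τ; simp only [Raw.subst, iht, ihu]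

theorem Raw.subst_var {Γ : Ctx} {a : Ty} (t : Raw Γ a) :
    t.subst (fun _ x => .var x) = t := by
  induction t with
  | var x => rfl
  | const c => rfl
  | @lam Γ a b t ih =>
    have h : (RawSub.lift (b := a) (fun _ x => Raw.var x) : RawSub (a :: Γ) (a :: Γ)) =
        fun _ x => Raw.var x := by
      funext c x
      cases x <;> rfl
    simp only [Raw.subst, h, ih]
  | app t u iht ihu => simp only [Raw.subst, iht, ihu]

theorem Raw.rename_eq_subst {Γ Δ : Ctx} {a : Ty} (ρ : Ren Γ Δ) (t : Raw Γ a) :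
    t.rename ρ = t.subst (fun _ x => .var (ρ x)) := by
  rw [← Raw.subst_rename t ρ (fun _ x => .var x), Raw.subst_var]

theorem Conv.subst {Γ : Ctx} {a : Ty} {t u : Raw Γ a} (h : Conv t u) :
    ∀ {Δ : Ctx} (σ : RawSub Γ Δ), Conv (t.subst σ) (u.subst σ) := by
  induction h with
  | refl t => intro Δ σ; exact .refl _
  | symm _ ih => intro Δ σ; exact .symm (ih σ)
  | trans _ _ ih₁ ih₂ => intro Δ σ; exact .trans (ih₁ σ) (ih₂ σ)
  | lam _ ih => intro Δ σ; exact .lam (ih _)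
  | app _ _ ih₁ ih₂ => intro Δ σ; exact .app (ih₁ σ) (ih₂ σ)
  | beta t u =>
    intro Δ σ
    have h := Conv.beta (t.subst σ.lift) (u.subst σ)
    have e : (t.subst σ.lift).subst (RawSub.single (u.subst σ)) =
        (t.subst (RawSub.single u)).subst σ := by
      rw [Raw.subst_subst, Raw.subst_subst]
      congr 1
      funext c x
      cases x with
      | zero => rfl
      | succ x =>
        simp only [RawSub.lift, RawSub.single, Raw.subst_rename, Raw.subst]
        exact Raw.subst_var (σ x)
    rw [e] at h
    exact h
  | @eta Γ a b t =>
    intro Δ σ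
    have h := Conv.eta (t.subst σ)
    have e : (t.subst σ).rename (Ren.shift (b := a)) = (t.rename Ren.shift).subst σ.lift := by
      rw [Raw.rename_subst, Raw.subst_rename]
      rfl
    rw [e] at h
    exact h

theorem Conv.rename {Γ Δ : Ctx} {a : Ty} (ρ : Ren Γ Δ) {t u : Raw Γ a} (h : Conv t u) :
    Conv (t.rename ρ) (u.rename ρ) := by
  rw [Raw.rename_eq_subst, Raw.rename_eq_subst]
  exact h.subst _

/-- Beta-eta-convertibility as a setoid. -/
def convSetoid (Γ : Ctx) (a : Ty) : Setoid (Raw Γ a) :=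
  ⟨Conv, Conv.refl, Conv.symm, Conv.trans⟩

/-- Terms of type `a` with free variables in `Γ`: lambda-terms up to beta-eta-conversion. -/
def Tm (Γ : Ctx) (a : Ty) : Type := Quotient (convSetoid Γ a)

/-- A variable as a term. -/
def Tm.var {Γ : Ctx} {a : Ty} (x : Var Γ a) : Tm Γ a := Quotient.mk (convSetoid Γ a) (.var x)

/-- A constant as a term. -/
def Tm.const {Γ : Ctx} {a : Ty} (c : Const a) : Tm Γ a := Quotient.mk (convSetoid Γ a) (.const c)

/-- Abstraction. -/
def Tm.lam {Γ : Ctx} {a b : Ty} : Tm (a :: Γ) b → Tm Γ (.arr a b) :=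
  Quotient.map (sa := convSetoid _ _) (sb := convSetoid _ _) Raw.lam fun _ _ h => Conv.lam h

/-- Application. -/
def Tm.app {Γ : Ctx} {a b : Ty} : Tm Γ (.arr a b) → Tm Γ a → Tm Γ b :=
  Quotient.map₂ (sa := convSetoid _ _) (sb := convSetoid _ _) (sc := convSetoid _ _)
    Raw.app fun _ _ h _ _ h' => Conv.app h h'

/-- Renaming of variables in a term. -/
def Tm.rename {Γ Δ : Ctx} {a : Ty} (ρ : Ren Γ Δ) : Tm Γ a → Tm Δ a :=
  Quotient.map (sa := convSetoid _ _) (sb := convSetoid _ _) (Raw.rename ρ)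
    fun _ _ h => Conv.rename ρ h

/-- A term seen in a context with one more variable. -/
def Tm.weaken {Γ : Ctx} {a b : Ty} (t : Tm Γ a) : Tm (b :: Γ) a := t.rename Ren.shift

/-- Substitutions of terms in context `Δ` for the variables of `Γ`. -/
abbrev Sub (Γ Δ : Ctx) : Type := ∀ ⦃a : Ty⦄, Var Γ a → Tm Δ a

/-- Simultaneous substitution in a term. The choice of representatives of the substituted terms is
immaterial, since conversion is a congruence. -/
noncomputable def Tm.subst {Γ Δ : Ctx} {a : Ty} (σ : Sub Γ Δ) : Tm Γ a → Tm Δ a :=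
  Quotient.map (sa := convSetoid _ _) (sb := convSetoid _ _)
    (Raw.subst fun b x => Quotient.out (s := convSetoid Δ b) (σ x)) fun _ _ h => Conv.subst h _

/-- Extension of a substitution under a binder. -/
def Sub.lift {Γ Δ : Ctx} {b : Ty} (σ : Sub Γ Δ) : Sub (b :: Γ) (b :: Δ)
  | _, .zero => .var .zero
  | _, .succ x => (σ x).weaken

/-- The substitution of `t` for the variable of index `0`. -/
def Sub.single {Γ : Ctx} {b : Ty} (t : Tm Γ b) : Sub (b :: Γ) Γ
  | _, .zero => t
  | _, .succ x => .var x

/-- The inclusion of a context into its extension by one variable. -/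
def Sub.shift {Γ : Ctx} {b : Ty} : Sub Γ (b :: Γ) := fun _ x => .var (.succ x)

/-- First `θ`, then `σ`. -/
noncomputable def Sub.comp {Γ Δ Θ : Ctx} (θ : Sub Γ Δ) (σ : Sub Δ Θ) : Sub Γ Θ :=
  fun _ x => (θ x).subst σ

section Variables

variable {Γ : Ctx} {a b c d e : Ty}

/-- The variable of index `0`. -/
def v0 : Tm (a :: Γ) a := .var .zero
/-- The variable of index `1`. -/
def v1 : Tm (a :: b :: Γ) b := .var (.succ .zero)
/-- The variable of index `2`. -/
def v2 : Tm (a :: b :: c :: Γ) c := .var (.succ (.succ .zero))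
/-- The variable of index `3`. -/
def v3 : Tm (a :: b :: c :: d :: Γ) d := .var (.succ (.succ (.succ .zero)))
/-- The variable of index `4`. -/
def v4 : Tm (a :: b :: c :: d :: e :: Γ) e := .var (.succ (.succ (.succ (.succ .zero))))

end Variables

/-! ### Formulas -/

/-- Predicate constants. -/
inductive Pred : Type
  | nat
  | eq | lt | le | sum
  | length | list | element | split | permute
  | seq | prog
  | same

/-- Atomic formulas, other than those of the predicate `nat`. -/
inductive Atom (Γ : Ctx) : Type
  -- predicates over natural numbers
  | eq (I J : Tm Γ .nt)
  | lt (I J : Tm Γ .nt)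
  | le (I J : Tm Γ .nt)
  | sum (I J K : Tm Γ .nt)
  -- predicates over lists
  | length (L : Tm Γ .lst) (I : Tm Γ .nt)
  | list (L : Tm Γ .lst)
  | element (X : Tm Γ .atm) (L : Tm Γ .lst)
  | split (L L₁ L₂ : Tm Γ .lst)
  | permute (L L' : Tm Γ .lst)
  -- sequents and theory of the object logic
  | seq (I : Tm Γ .nt) (L : Tm Γ .lst) (B : Tm Γ .prp)
  | prog (A : Tm Γ .atm) (G : Tm Γ .prp)
  -- equality at type `i`
  | same (M N : Tm Γ .i)

/-- The predicate of an atomic formula. -/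
def Atom.predicate {Γ : Ctx} : Atom Γ → Pred
  | .eq _ _ => .eq
  | .lt _ _ => .lt
  | .le _ _ => .le
  | .sum _ _ _ => .sum
  | .length _ _ => .length
  | .list _ => .list
  | .element _ _ => .element
  | .split _ _ _ => .split
  | .permute _ _ => .permute
  | .seq _ _ _ => .seq
  | .prog _ _ => .prog
  | .same _ _ => .same

/-- Substitution in an atomic formula. -/
noncomputable def Atom.subst {Γ Δ : Ctx} (σ : Sub Γ Δ) : Atom Γ → Atom Δ
  | .eq I J => .eq (I.subst σ) (J.subst σ)
  | .lt I J => .lt (I.subst σ) (J.subst σ)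
  | .le I J => .le (I.subst σ) (J.subst σ)
  | .sum I J K => .sum (I.subst σ) (J.subst σ) (K.subst σ)
  | .length L I => .length (L.subst σ) (I.subst σ)
  | .list L => .list (L.subst σ)
  | .element X L => .element (X.subst σ) (L.subst σ)
  | .split L L₁ L₂ => .split (L.subst σ) (L₁.subst σ) (L₂.subst σ)
  | .permute L L' => .permute (L.subst σ) (L'.subst σ)
  | .seq I L B => .seq (I.subst σ) (L.subst σ) (B.subst σ)
  | .prog A G => .prog (A.subst σ) (G.subst σ)
  | .same M N => .same (M.subst σ) (N.subst σ)

/-- Formulas with free variables in a context. -/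
inductive Fm : Ctx → Type
  | nat {Γ : Ctx} (I : Tm Γ .nt) : Fm Γ
  | atom {Γ : Ctx} (A : Atom Γ) : Fm Γ
  | bot {Γ : Ctx} : Fm Γ
  | top {Γ : Ctx} : Fm Γ
  | and {Γ : Ctx} (B C : Fm Γ) : Fm Γ
  | or {Γ : Ctx} (B C : Fm Γ) : Fm Γ
  | imp {Γ : Ctx} (B C : Fm Γ) : Fm Γ
  | all {Γ : Ctx} (a : Ty) (B : Fm (a :: Γ)) : Fm Γ
  | ex {Γ : Ctx} (a : Ty) (B : Fm (a :: Γ)) : Fm Γ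

/-- Substitution in a formula. -/
noncomputable def Fm.subst : {Γ Δ : Ctx} → Sub Γ Δ → Fm Γ → Fm Δ
  | _, _, σ, .nat I => .nat (I.subst σ)
  | _, _, σ, .atom A => .atom (A.subst σ)
  | _, _, _, .bot => .bot
  | _, _, _, .top => .top
  | _, _, σ, .and B C => .and (B.subst σ) (C.subst σ)
  | _, _, σ, .or B C => .or (B.subst σ) (C.subst σ)
  | _, _, σ, .imp B C => .imp (B.subst σ) (C.subst σ)
  | _, _, σ, .all a B => .all a (B.subst σ.lift)
  | _, _, σ, .ex a B => .ex a (B.subst σ.lift)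

/-- `B[t/x]`, where `x` is the variable of index `0`. -/
noncomputable def Fm.inst {Γ : Ctx} {a : Ty} (B : Fm (a :: Γ)) (t : Tm Γ a) : Fm Γ :=
  B.subst (Sub.single t)

/-- A formula seen in a context with one more variable. -/
noncomputable def Fm.weaken {Γ : Ctx} {a : Ty} (B : Fm Γ) : Fm (a :: Γ) := B.subst Sub.shift

/-- The level of a formula, for given levels of the predicates. -/
def Fm.level (lvl : Pred → ℕ) : {Γ : Ctx} → Fm Γ → ℕ
  | _, .nat _ => lvl .nat
  | _, .atom A => lvl A.predicate
  | _, .bot => 0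
  | _, .top => 0
  | _, .and B C => max (B.level lvl) (C.level lvl)
  | _, .or B C => max (B.level lvl) (C.level lvl)
  | _, .imp B C => max (B.level lvl + 1) (C.level lvl)
  | _, .all _ B => B.level lvl
  | _, .ex _ B => B.level lvl

/-! ### Definitions and derivability -/

/-- A definitional clause: `head` is defined by `body`, for all values of the variables in
`ctx`. -/
structure Clause : Type where
  ctx : Ctx
  head : Atom ctx
  body : Fm ctx

/-- A stratified set of definitional clauses. The predicate `nat` is never defined by clauses. -/
structure Definition : Type where
  clauses : Set Clause
  level : Pred → ℕ
  stratified : ∀ c ∈ clauses, c.body.level level ≤ level c.head.predicate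

/-- A unifier of the atom `A` and the head of the clause `c`. The variables of the clause are kept
apart from those of `A`: `left` acts on the latter and `right` on the former. -/
structure Unifier {Γ : Ctx} (A : Atom Γ) (c : Clause) : Type where
  cod : Ctx
  left : Sub Γ cod
  right : Sub c.ctx cod
  unifies : A.subst left = c.head.subst right

/-- Every unifier is an instance of a member of `S`. -/
def IsCompleteSetOfUnifiers {Γ : Ctx} {A : Atom Γ} {c : Clause} (S : Set (Unifier A c)) : Prop :=
  ∀ ρ : Unifier A c, ∃ θ ∈ S, ∃ σ : Sub θ.cod ρ.cod,
    ρ.left = θ.left.comp σ ∧ ρ.right = θ.right.comp σ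

/-- `Der D H C`: the sequent with antecedent `H` and consequent `C`, whose free variables are in
`Γ`, is derivable from the definition `D`. -/
inductive Der (D : Definition) : {Γ : Ctx} → Multiset (Fm Γ) → Fm Γ → Prop
  | botL {Γ : Ctx} {H : Multiset (Fm Γ)} {B : Fm Γ} : Der D (.bot ::ₘ H) B
  | topR {Γ : Ctx} {H : Multiset (Fm Γ)} : Der D H .top
  | andL₁ {Γ : Ctx} {H : Multiset (Fm Γ)} {B C E : Fm Γ} :
      Der D (B ::ₘ H) E → Der D (.and B C ::ₘ H) E
  | andL₂ {Γ : Ctx} {H : Multiset (Fm Γ)} {B C E : Fm Γ} :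
      Der D (C ::ₘ H) E → Der D (.and B C ::ₘ H) E
  | andR {Γ : Ctx} {H : Multiset (Fm Γ)} {B C : Fm Γ} :
      Der D H B → Der D H C → Der D H (.and B C)
  | orL {Γ : Ctx} {H : Multiset (Fm Γ)} {B C E : Fm Γ} :
      Der D (B ::ₘ H) E → Der D (C ::ₘ H) E → Der D (.or B C ::ₘ H) E
  | orR₁ {Γ : Ctx} {H : Multiset (Fm Γ)} {B C : Fm Γ} : Der D H B → Der D H (.or B C)
  | orR₂ {Γ : Ctx} {H : Multiset (Fm Γ)} {B C : Fm Γ} : Der D H C → Der D H (.or B C)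
  | impL {Γ : Ctx} {H : Multiset (Fm Γ)} {B C E : Fm Γ} :
      Der D H B → Der D (C ::ₘ H) E → Der D (.imp B C ::ₘ H) E
  | impR {Γ : Ctx} {H : Multiset (Fm Γ)} {B C : Fm Γ} :
      Der D (B ::ₘ H) C → Der D H (.imp B C)
  | allL {Γ : Ctx} {H : Multiset (Fm Γ)} {a : Ty} {B : Fm (a :: Γ)} {C : Fm Γ} (t : Tm Γ a) :
      Der D (B.inst t ::ₘ H) C → Der D (.all a B ::ₘ H) C
  | allR {Γ : Ctx} {H : Multiset (Fm Γ)} {a : Ty} {B : Fm (a :: Γ)} :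
      Der D (H.map Fm.weaken) B → Der D H (.all a B)
  | exL {Γ : Ctx} {H : Multiset (Fm Γ)} {a : Ty} {B : Fm (a :: Γ)} {C : Fm Γ} :
      Der D (B ::ₘ H.map Fm.weaken) C.weaken → Der D (.ex a B ::ₘ H) C
  | exR {Γ : Ctx} {H : Multiset (Fm Γ)} {a : Ty} {B : Fm (a :: Γ)} (t : Tm Γ a) :
      Der D H (B.inst t) → Der D H (.ex a B)
  | initAtom {Γ : Ctx} {H : Multiset (Fm Γ)} {A : Atom Γ} : Der D (.atom A ::ₘ H) (.atom A)
  | initNat {Γ : Ctx} {H : Multiset (Fm Γ)} {I : Tm Γ .nt} : Der D (.nat I ::ₘ H) (.nat I)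
  | contrL {Γ : Ctx} {H : Multiset (Fm Γ)} {B C : Fm Γ} :
      Der D (B ::ₘ B ::ₘ H) C → Der D (B ::ₘ H) C
  | cut {Γ : Ctx} {H₁ H₂ : Multiset (Fm Γ)} {B C : Fm Γ} :
      Der D H₁ B → Der D (B ::ₘ H₂) C → Der D (H₁ + H₂) C
  | natRzero {Γ : Ctx} {H : Multiset (Fm Γ)} : Der D H (.nat (.const .z))
  | natRsucc {Γ : Ctx} {H : Multiset (Fm Γ)} {I : Tm Γ .nt} :
      Der D H (.nat I) → Der D H (.nat ((Tm.const .s).app I))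
  -- in the second premise the eigenvariable `j` has index `0`, so that `B` itself is `B j`
  | natL {Γ : Ctx} {H : Multiset (Fm Γ)} {I : Tm Γ .nt} {C : Fm Γ} (B : Fm (.nt :: Γ)) :
      Der D 0 (B.inst (.const .z)) →
      Der D {B} ((B.subst (Sub.lift Sub.shift)).inst ((Tm.const .s).app v0)) →
      Der D (B.inst I ::ₘ H) C →
      Der D (.nat I ::ₘ H) C
  | defR {Γ : Ctx} {H : Multiset (Fm Γ)} {A : Atom Γ} (c : Clause) (hc : c ∈ D.clauses)
      (θ : Sub c.ctx Γ) (hA : A = c.head.subst θ) :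
      Der D H (c.body.subst θ) → Der D H (.atom A)
  | defL {Γ : Ctx} {H : Multiset (Fm Γ)} {A : Atom Γ} {C : Fm Γ}
      (S : (c : Clause) → Set (Unifier A c))
      (hS : ∀ c ∈ D.clauses, IsCompleteSetOfUnifiers (S c)) :
      (∀ c ∈ D.clauses, ∀ θ ∈ S c,
        Der D (c.body.subst θ.right ::ₘ H.map (Fm.subst θ.left)) (C.subst θ.left)) →
      Der D (.atom A ::ₘ H) C

/-- A closed formula is derivable from `D`. -/
def Derivable (D : Definition) (B : Fm []) : Prop := Der D 0 B

/-! ### Notation for terms -/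

section Terms

variable {Γ : Ctx} {a b c d : Ty}

/-- A constant applied to one argument. -/
def ap₁ (k : Const (.arr a b)) (t : Tm Γ a) : Tm Γ b := (Tm.const k).app t

/-- A constant applied to two arguments. -/
def ap₂ (k : Const (.arr a (.arr b c))) (t : Tm Γ a) (u : Tm Γ b) : Tm Γ c := (ap₁ k t).app u

/-- A constant applied to three arguments. -/
def ap₃ (k : Const (.arr a (.arr b (.arr c d)))) (t : Tm Γ a) (u : Tm Γ b) (v : Tm Γ c) : Tm Γ d :=
  (ap₂ k t u).app v

def z : Tm Γ .nt := .const .z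
def s (I : Tm Γ .nt) : Tm Γ .nt := ap₁ .s I
def nil : Tm Γ .lst := .const .nil
def cons (X : Tm Γ .atm) (L : Tm Γ .lst) : Tm Γ .lst := ap₂ .cons X L

/-- The atom `A` as a goal formula. -/
def atom (A : Tm Γ .atm) : Tm Γ .prp := ap₁ .atom A
def tt : Tm Γ .prp := .const .tt
/-- Object-level conjunction. -/
def amp (B C : Tm Γ .prp) : Tm Γ .prp := ap₂ .amp B C
/-- Object-level implication. -/
def oimp (A : Tm Γ .atm) (B : Tm Γ .prp) : Tm Γ .prp := ap₂ .imp A B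
/-- Object-level universal quantification over `i`. -/
def oall (B : Tm Γ (.arr .i .prp)) : Tm Γ .prp := ap₁ .forallI B

def num : Tm Γ .i := .const .num
def bool : Tm Γ .i := .const .bool
def arrow (T U : Tm Γ .i) : Tm Γ .i := ap₂ .arrow T U

def zero : Tm Γ .i := .const .zero
def tru : Tm Γ .i := .const .tru
def fls : Tm Γ .i := .const .fls
def succ (M : Tm Γ .i) : Tm Γ .i := ap₁ .succ M
def pred (M : Tm Γ .i) : Tm Γ .i := ap₁ .pred M
def isZero (M : Tm Γ .i) : Tm Γ .i := ap₁ .isZero M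
def cond (M N₁ N₂ : Tm Γ .i) : Tm Γ .i := ap₃ .cond M N₁ N₂
def abs (T : Tm Γ .i) (R : Tm Γ (.arr .i .i)) : Tm Γ .i := ap₂ .abs T R
def app (M N : Tm Γ .i) : Tm Γ .i := ap₂ .app M N
/-- The recursion construct of PCF. -/
def fix (T : Tm Γ .i) (R : Tm Γ (.arr .i .i)) : Tm Γ .i := ap₂ .fix T R

def typeof (M T : Tm Γ .i) : Tm Γ .atm := ap₂ .typeof M T
/-- Natural semantics: `M` evaluates to `V`. -/
def natsem (M V : Tm Γ .i) : Tm Γ .atm := ap₂ .natsem M V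
/-- One step of the transition semantics. -/
def transone (M N : Tm Γ .i) : Tm Γ .atm := ap₂ .transone M N
/-- Finitely many steps of the transition semantics. -/
def transsem (M N : Tm Γ .i) : Tm Γ .atm := ap₂ .transsem M N
def value (V : Tm Γ .i) : Tm Γ .atm := ap₁ .value V

end Terms

/-! ### The clauses -/

/-- Predicates over natural numbers. -/
def natClauses : List Clause :=
  [ -- `I = I`
    ⟨[.nt], .eq v0 v0, .top⟩,
    -- sum: variables `J`, and `I, J, K`
    ⟨[.nt], .sum z v0 v0, .nat v0⟩,
    ⟨[.nt, .nt, .nt], .sum (s v0) v1 (s v2), .atom (.sum v0 v1 v2)⟩,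
    -- less than
    ⟨[.nt], .lt z (s v0), .nat v0⟩,
    ⟨[.nt, .nt], .lt (s v0) (s v1), .atom (.lt v0 v1)⟩,
    -- less than or equal
    ⟨[.nt], .le v0 v0, .top⟩,
    ⟨[.nt, .nt], .le v0 v1, .atom (.lt v0 v1)⟩ ]

/-- Predicates over lists of atoms. -/
def listClauses : List Clause :=
  [ ⟨[], .length nil z, .top⟩,
    -- variables `X, L, I`
    ⟨[.atm, .lst, .nt], .length (cons v0 v1) (s v2), .atom (.length v1 v2)⟩,
    ⟨[.lst], .list v0, .ex .nt (.and (.nat v0) (.atom (.length v1 v0)))⟩,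
    -- variables `X, L`, and `X, Y, L`
    ⟨[.atm, .lst], .element v0 (cons v0 v1), .top⟩,
    ⟨[.atm, .atm, .lst], .element v0 (cons v1 v2), .atom (.element v0 v2)⟩,
    -- variables `X, L₁, L₂, L₃`
    ⟨[], .split nil nil nil, .top⟩,
    ⟨[.atm, .lst, .lst, .lst], .split (cons v0 v1) (cons v0 v2) v3, .atom (.split v1 v2 v3)⟩,
    ⟨[.atm, .lst, .lst, .lst], .split (cons v0 v1) v2 (cons v0 v3), .atom (.split v1 v2 v3)⟩,
    -- variables `X, L₁, L₂`
    ⟨[], .permute nil nil, .top⟩,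
    ⟨[.atm, .lst, .lst], .permute (cons v0 v1) v2,
      .ex .lst (.and (.atom (.split v3 (cons v1 nil) v0)) (.atom (.permute v2 v0)))⟩ ]

/-- Derivability in the intuitionistic object logic. -/
def intuitClauses : List Clause :=
  [ -- variables `I, A', L, A`
    ⟨[.nt, .atm, .lst, .atm], .seq v0 (cons v1 v2) (atom v3), .atom (.element v3 (cons v1 v2))⟩,
    ⟨[.nt, .lst], .seq v0 v1 tt, .top⟩,
    -- variables `I, L, B, C`
    ⟨[.nt, .lst, .prp, .prp], .seq (s v0) v1 (amp v2 v3),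
      .and (.atom (.seq v0 v1 v2)) (.atom (.seq v0 v1 v3))⟩,
    -- variables `I, L, A, B`
    ⟨[.nt, .lst, .atm, .prp], .seq (s v0) v1 (oimp v2 v3), .atom (.seq v0 (cons v2 v1) v3)⟩,
    -- variables `I, L, B`
    ⟨[.nt, .lst, .arr .i .prp], .seq (s v0) v1 (oall v2),
      .all .i (.atom (.seq v1 v2 (v3.app v0)))⟩,
    -- variables `I, L, A`
    ⟨[.nt, .lst, .atm], .seq (s v0) v1 (atom v2),
      .ex .prp (.and (.atom (.prog v3 v0)) (.atom (.seq v1 v2 v0)))⟩ ]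

/-- The clause stating that the object-level theory contains `G ⇒ A`, universally quantified over
the variables in `Γ`. -/
def progClause (Γ : Ctx) (A : Tm Γ .atm) (G : Tm Γ .prp) : Clause := ⟨Γ, .prog A G, .top⟩

/-- Typing of PCF. -/
def typingClauses : List Clause :=
  [ progClause [] (typeof zero num) tt,
    progClause [] (typeof tru bool) tt,
    progClause [] (typeof fls bool) tt,
    progClause [.i] (typeof (succ v0) num) (atom (typeof v0 num)),
    progClause [.i] (typeof (pred v0) num) (atom (typeof v0 num)),
    progClause [.i] (typeof (isZero v0) bool) (atom (typeof v0 num)),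
    -- variables `M, N₁, N₂, T`
    progClause [.i, .i, .i, .i] (typeof (cond v0 v1 v2) v3)
      (amp (atom (typeof v0 bool)) (amp (atom (typeof v1 v3)) (atom (typeof v2 v3)))),
    -- variables `T, R, U`; under the abstraction they have index `1, 2, 3`
    progClause [.i, .arr .i .i, .i] (typeof (abs v0 v1) (arrow v0 v2))
      (oall (.lam (oimp (typeof v0 v1) (atom (typeof (v2.app v0) v3))))),
    -- variables `M, N, T, U`
    progClause [.i, .i, .i, .i] (typeof (app v0 v1) v2)
      (amp (atom (typeof v0 (arrow v3 v2))) (atom (typeof v1 v3))),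
    -- variables `T, R`
    progClause [.i, .arr .i .i] (typeof (fix v0 v1) v0)
      (oall (.lam (oimp (typeof v0 v1) (atom (typeof (v2.app v0) v1))))) ]

/-- Natural semantics of PCF. -/
def natsemClauses : List Clause :=
  [ progClause [] (natsem zero zero) tt,
    progClause [] (natsem tru tru) tt,
    progClause [] (natsem fls fls) tt,
    -- variables `M, V`
    progClause [.i, .i] (natsem (succ v0) (succ v1)) (atom (natsem v0 v1)),
    progClause [.i] (natsem (pred v0) zero) (atom (natsem v0 zero)),
    progClause [.i, .i] (natsem (pred v0) v1) (atom (natsem v0 (succ v1))),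
    progClause [.i] (natsem (isZero v0) tru) (atom (natsem v0 zero)),
    progClause [.i, .i] (natsem (isZero v0) fls) (atom (natsem v0 (succ v1))),
    -- variables `M, N₁, N₂, V`
    progClause [.i, .i, .i, .i] (natsem (cond v0 v1 v2) v3)
      (amp (atom (natsem v0 tru)) (atom (natsem v1 v3))),
    progClause [.i, .i, .i, .i] (natsem (cond v0 v1 v2) v3)
      (amp (atom (natsem v0 fls)) (atom (natsem v2 v3))),
    -- variables `T, R`
    progClause [.i, .arr .i .i] (natsem (abs v0 v1) (abs v0 v1)) tt,
    -- variables `M, N, V, T, R`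
    progClause [.i, .i, .i, .i, .arr .i .i] (natsem (app v0 v1) v2)
      (amp (atom (natsem v0 (abs v3 v4))) (atom (natsem (v4.app v1) v2))),
    -- variables `T, R, V`
    progClause [.i, .arr .i .i, .i] (natsem (fix v0 v1) v2)
      (atom (natsem (v1.app (fix v0 v1)) v2)) ]

/-- Transition semantics and values of PCF. -/
def transClauses : List Clause :=
  [ -- variables `M, M'`
    progClause [.i, .i] (transone (succ v0) (succ v1)) (atom (transone v0 v1)),
    progClause [] (transone (pred zero) zero) tt,
    progClause [.i] (transone (pred (succ v0)) v0) (atom (value v0)),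
    progClause [.i, .i] (transone (pred v0) (pred v1)) (atom (transone v0 v1)),
    progClause [] (transone (isZero zero) tru) tt,
    progClause [.i] (transone (isZero (succ v0)) fls) (atom (value v0)),
    progClause [.i, .i] (transone (isZero v0) (isZero v1)) (atom (transone v0 v1)),
    -- variables `M, N`
    progClause [.i, .i] (transone (cond tru v0 v1) v0) tt,
    progClause [.i, .i] (transone (cond fls v0 v1) v1) tt,
    -- variables `M, N₁, N₂, M'`
    progClause [.i, .i, .i, .i] (transone (cond v0 v1 v2) (cond v3 v1 v2)) (atom (transone v0 v3)),
    -- variables `T, R, N`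
    progClause [.i, .arr .i .i, .i] (transone (app (abs v0 v1) v2) (v1.app v2)) tt,
    -- variables `M, N, M'`
    progClause [.i, .i, .i] (transone (app v0 v1) (app v2 v1)) (atom (transone v0 v2)),
    -- variables `T, R`
    progClause [.i, .arr .i .i] (transone (fix v0 v1) (v1.app (fix v0 v1))) tt,
    -- many steps: variables `M`, and `M, N, M'`
    progClause [.i] (transsem v0 v0) tt,
    progClause [.i, .i, .i] (transsem v0 v1) (amp (atom (transone v0 v2)) (atom (transsem v2 v1))),
    -- values
    progClause [] (value zero) tt,
    progClause [] (value tru) tt,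
    progClause [] (value fls) tt,
    progClause [.i] (value (succ v0)) (atom (value v0)),
    progClause [.i, .arr .i .i] (value (abs v0 v1)) tt ]

/-- Equality at type `i`. -/
def sameClauses : List Clause := [ ⟨[.i], .same v0 v0, .top⟩ ]

/-- The definition that accumulates the clauses for natural numbers, lists of atoms, the object
logic, PCF, and equality at type `i`. All predicates have level `0`. -/
def pcfDefinition : Definition where
  clauses := {c | c ∈ natClauses ++ listClauses ++ intuitClauses ++
    (typingClauses ++ natsemClauses ++ transClauses) ++ sameClauses}
  level := fun _ => 0
  stratified := by
    have h : ∀ c ∈ natClauses ++ listClauses ++ intuitClauses ++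
        (typingClauses ++ natsemClauses ++ transClauses) ++ sameClauses,
        c.body.level (fun _ => 0) = 0 := by
      simp [natClauses, listClauses, intuitClauses, typingClauses, natsemClauses, transClauses,
        sameClauses, progClause, Fm.level]
    intro c hc
    exact (h c hc).le

/-- The formula `∃ i (nat i ∧ seq i L B)`: the goal `B` is provable in the object logic from the
atoms in `L` and the theory. -/
def prvFrom {Γ : Ctx} (L : Tm Γ .lst) (B : Tm Γ .prp) : Fm Γ :=
  .ex .nt (.and (.nat v0) (.atom (.seq v0 L.weaken B.weaken)))

/-- The formula `∃ i (nat i ∧ seq i nil B)`. -/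
def prv {Γ : Ctx} (B : Tm Γ .prp) : Fm Γ := prvFrom nil B

end FOLDN

open FOLDN

/-!
A derivable sequent is used through what it says about every extension `(σ, H')` of its hypotheses
`H`, that is, `σ` and `H'` such that `H'` proves `B.subst σ` whenever `H` proves `B`: an eliminated
existential, disjunction or defined atom gives a continuation over such extensions. With this
reading the theorems about PCF have their usual informal proofs. The height of an object-level
derivation is a natural number, so the left rule for `nat` gives induction on derivations, and the
left rule for definitions, taken with the set of all unifiers, gives inversion of atoms.

To compare instances of two clauses, constants applied to arguments must be injective and
distinguishable up to conversion. This does not require a normalization theorem: terms are evaluated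
in a set-theoretic model in which a value of base type is a spine, whose head and arguments can be
read off, and conversion does not change the value.

Subject reduction at `β`-redexes and at `rec` needs cut for the object logic, which holds since the
hypotheses of its sequents are atoms: in a derivation from `L`, replace each use of an element of
`L` by a given derivation of it. In the induction for unicity of typing the typing contexts are not
empty, and variables of the logic cannot be compared with PCF terms; so the goal under a binder is
instantiated with `rec T (λ x. x)`, whose only type is `T`, both by the context and by the clauses.
-/

namespace FOLDN

/-! ### Substitution in terms and formulas -/

theorem Raw.subst_congr {Γ : Ctx} {a : Ty} (t : Raw Γ a) : ∀ {Δ : Ctx} {σ τ : RawSub Γ Δ},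
    (∀ ⦃c : Ty⦄ (x : Var Γ c), Conv (σ x) (τ x)) → Conv (t.subst σ) (t.subst τ) := by
  induction t with
  | var x => exact fun h => h x
  | const c => exact fun _ => .refl _
  | lam t ih =>
    intro Δ σ τ h
    refine .lam (ih fun c x => ?_)
    cases x with
    | zero => exact .refl _
    | succ x => exact (h x).rename _
  | app t u iht ihu => exact fun h => .app (iht h) (ihu h)

/-- The term of a raw term. -/
abbrev Raw.toTm {Γ : Ctx} {a : Ty} (t : Raw Γ a) : Tm Γ a := Quotient.mk (convSetoid Γ a) t

theorem Tm.subst_mk {Γ Δ : Ctx} {a : Ty} (σ : Sub Γ Δ) (τ : RawSub Γ Δ)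
    (h : ∀ ⦃c : Ty⦄ (x : Var Γ c), (τ x).toTm = σ x) (t : Raw Γ a) :
    t.toTm.subst σ = (t.subst τ).toTm := by
  refine Quotient.sound (Raw.subst_congr t fun c x => ?_)
  exact Quotient.exact ((Quotient.out_eq (s := convSetoid Δ c) (σ x)).trans (h x).symm)

/-- Representatives of the terms of a substitution. -/
noncomputable def Sub.out {Γ Δ : Ctx} (σ : Sub Γ Δ) : RawSub Γ Δ :=
  fun c x => Quotient.out (s := convSetoid Δ c) (σ x)

theorem Sub.out_toTm {Γ Δ : Ctx} (σ : Sub Γ Δ) ⦃c : Ty⦄ (x : Var Γ c) : (σ.out x).toTm = σ x :=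
  Quotient.out_eq (s := convSetoid Δ c) (σ x)

theorem Sub.out_lift_toTm {Γ Δ : Ctx} {b : Ty} (σ : Sub Γ Δ) ⦃c : Ty⦄ (x : Var (b :: Γ) c) :
    (σ.out.lift x).toTm = σ.lift x := by
  cases x with
  | zero => rfl
  | succ x =>
    change Tm.rename Ren.shift (σ.out x).toTm = _
    rw [σ.out_toTm]
    rfl

/-- The identity substitution. -/
def Sub.id {Γ : Ctx} : Sub Γ Γ := fun _ x => .var x

/-- Extension of a substitution by a term for the variable of index `0`. -/
def Sub.cons {Γ Δ : Ctx} {b : Ty} (t : Tm Δ b) (σ : Sub Γ Δ) : Sub (b :: Γ) Δ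
  | _, .zero => t
  | _, .succ x => σ x

/-- The substitution with empty domain. -/
def Sub.empty {Δ : Ctx} : Sub [] Δ := fun _ x => nomatch x

section

variable {Γ Δ Θ : Ctx} {a b c d e : Ty}

@[simp]
theorem Tm.subst_var (σ : Sub Γ Δ) (x : Var Γ a) : (Tm.var x).subst σ = σ x :=
  Tm.subst_mk σ σ.out σ.out_toTm (.var x) |>.trans (σ.out_toTm x)

@[simp]
theorem Tm.subst_app (σ : Sub Γ Δ) (t : Tm Γ (.arr a b)) (u : Tm Γ a) :
    (t.app u).subst σ = (t.subst σ).app (u.subst σ) := by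
  induction t using Quotient.ind
  induction u using Quotient.ind
  rfl

@[simp]
theorem Tm.subst_lam (σ : Sub Γ Δ) (t : Tm (a :: Γ) b) :
    t.lam.subst σ = (t.subst σ.lift).lam := by
  induction t using Quotient.ind with
  | _ t =>
    have h := Tm.subst_mk σ.lift σ.out.lift σ.out_lift_toTm t
    change _ = Tm.lam (Tm.subst σ.lift t.toTm)
    rw [h]
    exact Tm.subst_mk σ σ.out σ.out_toTm (.lam t)

theorem Tm.subst_subst (σ : Sub Γ Δ) (τ : Sub Δ Θ) (t : Tm Γ a) :
    (t.subst σ).subst τ = t.subst (σ.comp τ) := by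
  induction t using Quotient.ind with
  | _ t =>
    change (t.toTm.subst σ).subst τ = t.toTm.subst _
    rw [Tm.subst_mk σ _ σ.out_toTm, Tm.subst_mk τ _ τ.out_toTm,
      Tm.subst_mk (σ.comp τ) (fun _ x => (σ.out x).subst τ.out), Raw.subst_subst]
    intro c x
    rw [← Tm.subst_mk τ _ τ.out_toTm, σ.out_toTm]
    rfl

@[simp]
theorem Tm.subst_id (t : Tm Γ a) : t.subst Sub.id = t := by
  induction t using Quotient.ind with
  | _ t =>
    change t.toTm.subst _ = t.toTm
    rw [Tm.subst_mk Sub.id (fun _ x => .var x) fun _ _ => rfl, Raw.subst_var]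

theorem Tm.weaken_eq_subst (t : Tm Γ a) : (t.weaken : Tm (b :: Γ) a) = t.subst Sub.shift := by
  induction t using Quotient.ind with
  | _ t =>
    change (t.rename Ren.shift).toTm = t.toTm.subst _
    rw [Tm.subst_mk Sub.shift (fun _ x => .var (.succ x)) fun _ _ => rfl, Raw.rename_eq_subst]
    rfl

theorem Sub.shift_comp_lift (σ : Sub Γ Δ) :
    Sub.shift.comp (σ.lift (b := b)) = σ.comp Sub.shift := by
  funext c x
  simp only [Sub.comp, Sub.shift, Tm.subst_var, Sub.lift]
  exact Tm.weaken_eq_subst _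

theorem Sub.shift_comp_cons (σ : Sub Γ Δ) (t : Tm Δ b) : Sub.shift.comp (Sub.cons t σ) = σ := by
  funext c x
  simp only [Sub.comp, Sub.shift, Tm.subst_var]
  rfl

@[simp]
theorem Sub.single_eq_cons (t : Tm Γ b) : Sub.single t = Sub.cons t Sub.id := by
  funext c x
  cases x <;> rfl

@[simp]
theorem Tm.weaken_subst_lift (σ : Sub Γ Δ) (t : Tm Γ a) :
    (t.weaken (b := b)).subst σ.lift = (t.subst σ).weaken := by
  rw [Tm.weaken_eq_subst, Tm.weaken_eq_subst, Tm.subst_subst, Tm.subst_subst, Sub.shift_comp_lift]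

@[simp]
theorem Tm.weaken_subst_cons (σ : Sub Γ Δ) (t : Tm Γ a) (u : Tm Δ b) :
    t.weaken.subst (Sub.cons u σ) = t.subst σ := by
  rw [Tm.weaken_eq_subst, Tm.subst_subst, Sub.shift_comp_cons]

theorem Tm.lam_app (t : Tm (a :: Γ) b) (u : Tm Γ a) : t.lam.app u = t.subst (Sub.single u) := by
  induction t using Quotient.ind with
  | _ t =>
    induction u using Quotient.ind with
    | _ u =>
      refine (Quotient.sound (Conv.beta t u)).trans ?_
      refine (Tm.subst_mk (Sub.single u.toTm) (RawSub.single u) (fun c x => ?_) t).symm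
      cases x <;> rfl

theorem Sub.comp_id (σ : Sub Γ Δ) : σ.comp Sub.id = σ := by
  funext c x
  exact Tm.subst_id _

theorem Sub.id_comp (σ : Sub Γ Δ) : Sub.id.comp σ = σ := by
  funext c x
  exact Tm.subst_var σ x

theorem Sub.lift_id : (Sub.id.lift : Sub (b :: Γ) (b :: Γ)) = Sub.id := by
  funext c x
  cases x with
  | zero => rfl
  | succ x => exact (Tm.weaken_eq_subst _).trans (Tm.subst_var _ _)

theorem Sub.lift_comp (σ : Sub Γ Δ) (τ : Sub Δ Θ) :
    (σ.comp τ).lift (b := b) = σ.lift.comp τ.lift := by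
  funext c x
  cases x with
  | zero => exact (Tm.subst_var (τ.lift (b := b)) .zero).symm
  | succ x => exact (Tm.weaken_subst_lift τ (σ x)).symm

theorem Sub.lift_comp_cons (σ : Sub Γ Δ) (τ : Sub Δ Θ) (t : Tm Θ b) :
    σ.lift.comp (Sub.cons t τ) = Sub.cons t (σ.comp τ) := by
  funext c x
  cases x with
  | zero => exact Tm.subst_var _ _
  | succ x => exact Tm.weaken_subst_cons τ (σ x) t

theorem Sub.cons_comp (σ : Sub Γ Δ) (τ : Sub Δ Θ) (t : Tm Δ b) :
    (Sub.cons t σ).comp τ = Sub.cons (t.subst τ) (σ.comp τ) := by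
  funext c x
  cases x <;> rfl

theorem Sub.single_comp (σ : Sub Γ Δ) (t : Tm Γ b) :
    (Sub.single t).comp σ = σ.lift.comp (Sub.single (t.subst σ)) := by
  rw [Sub.single_eq_cons, Sub.single_eq_cons, Sub.cons_comp, Sub.lift_comp_cons, Sub.id_comp,
    Sub.comp_id]

theorem Atom.subst_subst (σ : Sub Γ Δ) (τ : Sub Δ Θ) (A : Atom Γ) :
    (A.subst σ).subst τ = A.subst (σ.comp τ) := by
  cases A <;> simp only [Atom.subst, Tm.subst_subst]

theorem Atom.subst_id (A : Atom Γ) : A.subst Sub.id = A := by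
  cases A <;> simp only [Atom.subst, Tm.subst_id]

theorem Fm.subst_subst (B : Fm Γ) : ∀ {Δ Θ : Ctx} (σ : Sub Γ Δ) (τ : Sub Δ Θ),
    (B.subst σ).subst τ = B.subst (σ.comp τ) := by
  induction B with
  | nat I => intros; simp only [Fm.subst, Tm.subst_subst]
  | atom A => intros; simp only [Fm.subst, Atom.subst_subst]
  | bot => intros; rfl
  | top => intros; rfl
  | and B C ihB ihC => intros; simp only [Fm.subst, ihB, ihC]
  | or B C ihB ihC => intros; simp only [Fm.subst, ihB, ihC]
  | imp B C ihB ihC => intros; simp only [Fm.subst, ihB, ihC]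
  | all a B ih => intros; simp only [Fm.subst, ih, Sub.lift_comp]
  | ex a B ih => intros; simp only [Fm.subst, ih, Sub.lift_comp]

@[simp]
theorem Fm.subst_id (B : Fm Γ) : B.subst Sub.id = B := by
  induction B with
  | nat I => simp only [Fm.subst, Tm.subst_id]
  | atom A => simp only [Fm.subst, Atom.subst_id]
  | bot => rfl
  | top => rfl
  | and B C ihB ihC => simp only [Fm.subst, ihB, ihC]
  | or B C ihB ihC => simp only [Fm.subst, ihB, ihC]
  | imp B C ihB ihC => simp only [Fm.subst, ihB, ihC]
  | all a B ih => simp only [Fm.subst, Sub.lift_id, ih]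
  | ex a B ih => simp only [Fm.subst, Sub.lift_id, ih]

theorem Fm.subst_weaken (B : Fm Γ) (σ : Sub Γ Δ) :
    (B.weaken (a := a)).subst σ.lift = (B.subst σ).weaken := by
  rw [Fm.weaken, Fm.weaken, Fm.subst_subst, Fm.subst_subst, Sub.shift_comp_lift]

theorem Fm.subst_inst (B : Fm (a :: Γ)) (σ : Sub Γ Δ) (t : Tm Γ a) :
    (B.inst t).subst σ = (B.subst σ.lift).inst (t.subst σ) := by
  rw [Fm.inst, Fm.inst, Fm.subst_subst, Fm.subst_subst, Sub.single_comp]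

theorem Fm.subst_lift_inst (B : Fm (a :: Γ)) (σ : Sub Γ Δ) (t : Tm Δ a) :
    (B.subst σ.lift).inst t = B.subst (Sub.cons t σ) := by
  rw [Fm.inst, Sub.single_eq_cons, Fm.subst_subst, Sub.lift_comp_cons, Sub.comp_id]

theorem Fm.shift_inst_var (B : Fm (a :: Γ)) :
    (B.subst (Sub.lift Sub.shift)).inst (Tm.var .zero) = B := by
  rw [Fm.subst_lift_inst]
  refine Eq.trans ?_ B.subst_id
  congr 1
  funext c x
  cases x <;> rfl

end

/-! ### Heads and arguments of terms -/

/-- A variable or a constant applied to terms. -/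
inductive Spine (Γ : Ctx) : Ty → Type
  | var {a : Ty} (x : Var Γ a) : Spine Γ a
  | const {a : Ty} (k : Const a) : Spine Γ a
  | app {a b : Ty} (n : Spine Γ (.arr a b)) (t : Tm Γ a) : Spine Γ b

/-- The set-theoretic model in which a function takes, along with the value of its argument, the
argument itself as a term, and a value of base type is a spine. -/
def Sem (Γ : Ctx) : Ty → Type
  | .i => Spine Γ .i
  | .nt => Spine Γ .nt
  | .atm => Spine Γ .atm
  | .prp => Spine Γ .prp
  | .lst => Spine Γ .lst
  | .arr a b => Tm Γ a → Sem Γ a → Sem Γ b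

/-- The element of the model represented by a spine. -/
def Spine.toSem {Γ : Ctx} : {a : Ty} → Spine Γ a → Sem Γ a
  | .i, n => n
  | .nt, n => n
  | .atm, n => n
  | .prp, n => n
  | .lst, n => n
  | .arr _ _, n => fun t _ => (n.app t).toSem

/-- Assignments of elements of the model to variables. -/
abbrev Env (Γ Δ : Ctx) : Type := ∀ ⦃a : Ty⦄, Var Γ a → Sem Δ a

/-- Extension of an assignment by a value for the variable of index `0`. -/
def Env.cons {Γ Δ : Ctx} {b : Ty} (v : Sem Δ b) (e : Env Γ Δ) : Env (b :: Γ) Δ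
  | _, .zero => v
  | _, .succ x => e x

/-- The value of a raw term, given both a term and a value for each variable. -/
noncomputable def Raw.eval {Δ : Ctx} :
    {Γ : Ctx} → {a : Ty} → Sub Γ Δ → Env Γ Δ → Raw Γ a → Sem Δ a
  | _, _, _, e, .var x => e x
  | _, _, _, _, .const k => (Spine.const k).toSem
  | _, _, σ, e, .lam t => fun u v => t.eval (Sub.cons u σ) (Env.cons v e)
  | _, _, σ, e, .app t u => t.eval σ e (u.toTm.subst σ) (u.eval σ e)

section

variable {Γ Δ Θ : Ctx} {a b c d : Ty}

theorem Raw.toTm_rename_subst (ρ : Ren Γ Θ) (σ : Sub Θ Δ) (t : Raw Γ a) :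
    (t.rename ρ).toTm.subst σ = t.toTm.subst fun _ x => σ (ρ x) := by
  rw [Tm.subst_mk σ _ σ.out_toTm, Raw.subst_rename]
  exact (Tm.subst_mk _ _ (fun _ _ => σ.out_toTm _) t).symm

theorem Raw.toTm_subst_subst (τ : RawSub Γ Θ) (σ : Sub Θ Δ) (t : Raw Γ a) :
    (t.subst τ).toTm.subst σ = t.toTm.subst fun _ x => (τ x).toTm.subst σ := by
  rw [← Tm.subst_mk (fun _ x => (τ x).toTm) τ fun _ _ => rfl, Tm.subst_subst]
  rfl

theorem Raw.eval_rename (t : Raw Γ a) : ∀ {Θ : Ctx} (ρ : Ren Γ Θ) (σ : Sub Θ Δ) (e : Env Θ Δ),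
    (t.rename ρ).eval σ e = t.eval (fun _ x => σ (ρ x)) fun _ x => e (ρ x) := by
  induction t with
  | var x => intros; rfl
  | const k => intros; rfl
  | lam t ih =>
    intro Θ ρ σ e
    funext u v
    simp only [Raw.rename, Raw.eval, ih]
    congr 1 <;> funext c x <;> cases x <;> rfl
  | app t u iht ihu =>
    intro Θ ρ σ e
    simp only [Raw.rename, Raw.eval, iht, ihu, Raw.toTm_rename_subst]

theorem Raw.eval_subst (t : Raw Γ a) : ∀ {Θ : Ctx} (τ : RawSub Γ Θ) (σ : Sub Θ Δ) (e : Env Θ Δ),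
    (t.subst τ).eval σ e =
      t.eval (fun _ x => (τ x).toTm.subst σ) fun _ x => (τ x).eval σ e := by
  induction t with
  | var x => intros; rfl
  | const k => intros; rfl
  | lam t ih =>
    intro Θ τ σ e
    funext u v
    simp only [Raw.subst, Raw.eval, ih]
    congr 1 <;> funext c x <;> cases x
    · exact Tm.subst_var _ _
    · exact Raw.toTm_rename_subst _ _ _
    · rfl
    · exact Raw.eval_rename _ _ _ _
  | app t u iht ihu =>
    intro Θ τ σ e
    simp only [Raw.subst, Raw.eval, iht, ihu, Raw.toTm_subst_subst]

theorem Raw.eval_eq_of_conv {t u : Raw Γ a} (h : Conv t u) :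
    ∀ (σ : Sub Γ Δ) (e : Env Γ Δ), t.eval σ e = u.eval σ e := by
  induction h with
  | refl t => intros; rfl
  | symm _ ih => exact fun σ e => (ih σ e).symm
  | trans _ _ ih₁ ih₂ => exact fun σ e => (ih₁ σ e).trans (ih₂ σ e)
  | lam _ ih => exact fun σ e => funext fun u => funext fun v => ih _ _
  | @app _ _ _ t t' u u' _ hu iht ihu =>
    intro σ e
    have hu' : u.toTm = u'.toTm := Quotient.sound hu
    simp only [Raw.eval, iht, ihu, hu']
  | beta t u =>
    intro σ e
    simp only [Raw.eval, Raw.eval_subst]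
    congr 1 <;> funext c x <;> cases x
    · rfl
    · exact (Tm.subst_var _ _).symm
    · rfl
    · rfl
  | eta t =>
    intro σ e
    funext u v
    simp only [Raw.eval, Raw.eval_rename]
    exact congrArg (fun w => t.eval σ e w v) (Tm.subst_var _ _)

/-- The value of a term when each variable denotes itself. -/
noncomputable def Tm.sem (t : Tm Γ a) : Sem Γ a :=
  Quotient.lift (s := convSetoid Γ a) (Raw.eval Sub.id fun _ x => (Spine.var x).toSem)
    (fun _ _ h => Raw.eval_eq_of_conv h _ _) t

theorem Tm.sem_app (t : Tm Γ (.arr a b)) (u : Tm Γ a) : (t.app u).sem = t.sem u u.sem := by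
  induction t using Quotient.ind with
  | _ t =>
    induction u using Quotient.ind with
    | _ u =>
      change t.eval _ _ (u.toTm.subst Sub.id) _ = t.eval _ _ u.toTm _
      rw [Tm.subst_id]
      rfl

/-- Base types. -/
def Ty.IsBase : Ty → Prop
  | .arr _ _ => False
  | _ => True

theorem Spine.toSem_injective (ha : a.IsBase) :
    Function.Injective (Spine.toSem : Spine Γ a → Sem Γ a) := by
  cases a
  case arr => exact ha.elim
  all_goals exact fun _ _ h => h

theorem sem_ap₁ (k : Const (.arr a b)) (t : Tm Γ a) :
    (ap₁ k t).sem = ((Spine.const k).app t).toSem := by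
  rw [ap₁, Tm.sem_app]
  rfl

theorem sem_ap₂ (k : Const (.arr a (.arr b c))) (t : Tm Γ a) (u : Tm Γ b) :
    (ap₂ k t u).sem = (((Spine.const k).app t).app u).toSem := by
  rw [ap₂, Tm.sem_app, sem_ap₁]
  rfl

theorem sem_ap₃ (k : Const (.arr a (.arr b (.arr c d)))) (t : Tm Γ a) (u : Tm Γ b)
    (v : Tm Γ c) : (ap₃ k t u v).sem = ((((Spine.const k).app t).app u).app v).toSem := by
  rw [ap₃, Tm.sem_app, sem_ap₂]
  rfl

theorem ap₁_inj (k : Const (.arr a b)) (hb : b.IsBase := by trivial) {t t' : Tm Γ a} :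
    ap₁ k t = ap₁ k t' ↔ t = t' := by
  refine ⟨fun h => ?_, congrArg _⟩
  have h' := congrArg Tm.sem h
  rw [sem_ap₁, sem_ap₁] at h'
  cases Spine.toSem_injective hb h'
  rfl

theorem ap₂_inj (k : Const (.arr a (.arr b c))) (hc : c.IsBase := by trivial)
    {t t' : Tm Γ a} {u u' : Tm Γ b} :
    ap₂ k t u = ap₂ k t' u' ↔ t = t' ∧ u = u' := by
  refine ⟨fun h => ?_, fun h => by rw [h.1, h.2]⟩
  have h' := congrArg Tm.sem h
  rw [sem_ap₂, sem_ap₂] at h'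
  cases Spine.toSem_injective hc h'
  exact ⟨rfl, rfl⟩

theorem ap₃_inj (k : Const (.arr a (.arr b (.arr c d)))) (hd : d.IsBase := by trivial)
    {t t' : Tm Γ a} {u u' : Tm Γ b} {v v' : Tm Γ c} :
    ap₃ k t u v = ap₃ k t' u' v' ↔ t = t' ∧ u = u' ∧ v = v' := by
  refine ⟨fun h => ?_, fun h => by rw [h.1, h.2.1, h.2.2]⟩
  have h' := congrArg Tm.sem h
  rw [sem_ap₃, sem_ap₃] at h'
  cases Spine.toSem_injective hd h'
  exact ⟨rfl, rfl, rfl⟩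

/-- The constant at the head of a spine, if there is one. -/
def Spine.head : {a : Ty} → Spine Γ a → Option (Σ b, Const b)
  | _, .var _ => none
  | a, .const k => some ⟨a, k⟩
  | _, .app n _ => n.head

/-- The constant at the head of the long normal form of a term of base type, if there is one. On
other types the value `none` is junk. -/
noncomputable def Tm.head : {a : Ty} → Tm Γ a → Option (Σ b, Const b)
  | .i, t => Spine.head (a := .i) t.sem
  | .nt, t => Spine.head (a := .nt) t.sem
  | .atm, t => Spine.head (a := .atm) t.sem
  | .prp, t => Spine.head (a := .prp) t.sem
  | .lst, t => Spine.head (a := .lst) t.sem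
  | .arr _ _, _ => none

theorem Tm.head_eq_of_sem_eq (ha : a.IsBase) {t : Tm Γ a} {n : Spine Γ a} (h : t.sem = n.toSem) :
    t.head = n.head := by
  cases a
  case arr => exact ha.elim
  all_goals exact congrArg Spine.head h

theorem Tm.head_const (k : Const a) (ha : a.IsBase := by trivial) :
    (Tm.const k : Tm Γ a).head = some ⟨_, k⟩ :=
  Tm.head_eq_of_sem_eq (n := .const k) ha rfl

theorem head_ap₁ (k : Const (.arr a b)) (t : Tm Γ a) (hb : b.IsBase := by trivial) :
    (ap₁ k t).head = some ⟨_, k⟩ :=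
  Tm.head_eq_of_sem_eq hb (sem_ap₁ k t)

theorem head_ap₂ (k : Const (.arr a (.arr b c))) (t : Tm Γ a) (u : Tm Γ b)
    (hc : c.IsBase := by trivial) : (ap₂ k t u).head = some ⟨_, k⟩ :=
  Tm.head_eq_of_sem_eq hc (sem_ap₂ k t u)

theorem head_ap₃ (k : Const (.arr a (.arr b (.arr c d)))) (t : Tm Γ a) (u : Tm Γ b)
    (v : Tm Γ c) (hd : d.IsBase := by trivial) : (ap₃ k t u v).head = some ⟨_, k⟩ :=
  Tm.head_eq_of_sem_eq hd (sem_ap₃ k t u v)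

end

section

variable {Γ : Ctx}

@[simp]
theorem s_inj {I I' : Tm Γ .nt} : s I = s I' ↔ I = I' := ap₁_inj _
@[simp]
theorem cons_inj {X X' : Tm Γ .atm} {L L' : Tm Γ .lst} :
    cons X L = cons X' L' ↔ X = X' ∧ L = L' := ap₂_inj _
@[simp]
theorem atom_inj {A A' : Tm Γ .atm} : atom A = atom A' ↔ A = A' := ap₁_inj _
@[simp]
theorem amp_inj {B B' C C' : Tm Γ .prp} : amp B C = amp B' C' ↔ B = B' ∧ C = C' :=
  ap₂_inj _
@[simp]
theorem oimp_inj {A A' : Tm Γ .atm} {B B' : Tm Γ .prp} :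
    oimp A B = oimp A' B' ↔ A = A' ∧ B = B' := ap₂_inj _
@[simp]
theorem oall_inj {B B' : Tm Γ (.arr .i .prp)} : oall B = oall B' ↔ B = B' := ap₁_inj _
@[simp]
theorem arrow_inj {T T' U U' : Tm Γ .i} : arrow T U = arrow T' U' ↔ T = T' ∧ U = U' :=
  ap₂_inj _
@[simp]
theorem succ_inj {M M' : Tm Γ .i} : succ M = succ M' ↔ M = M' := ap₁_inj _
@[simp]
theorem pred_inj {M M' : Tm Γ .i} : pred M = pred M' ↔ M = M' := ap₁_inj _
@[simp]
theorem isZero_inj {M M' : Tm Γ .i} : isZero M = isZero M' ↔ M = M' := ap₁_inj _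
@[simp]
theorem cond_inj {M M' N₁ N₁' N₂ N₂' : Tm Γ .i} :
    cond M N₁ N₂ = cond M' N₁' N₂' ↔ M = M' ∧ N₁ = N₁' ∧ N₂ = N₂' := ap₃_inj _
@[simp]
theorem abs_inj {T T' : Tm Γ .i} {R R' : Tm Γ (.arr .i .i)} :
    abs T R = abs T' R' ↔ T = T' ∧ R = R' := ap₂_inj _
@[simp]
theorem app_inj {M M' N N' : Tm Γ .i} : app M N = app M' N' ↔ M = M' ∧ N = N' :=
  ap₂_inj _
@[simp]
theorem fix_inj {T T' : Tm Γ .i} {R R' : Tm Γ (.arr .i .i)} :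
    fix T R = fix T' R' ↔ T = T' ∧ R = R' := ap₂_inj _
@[simp]
theorem typeof_inj {M M' N N' : Tm Γ .i} : typeof M N = typeof M' N' ↔ M = M' ∧ N = N' :=
  ap₂_inj _
@[simp]
theorem natsem_inj {M M' N N' : Tm Γ .i} : natsem M N = natsem M' N' ↔ M = M' ∧ N = N' :=
  ap₂_inj _
@[simp]
theorem transone_inj {M M' N N' : Tm Γ .i} :
    transone M N = transone M' N' ↔ M = M' ∧ N = N' := ap₂_inj _
@[simp]
theorem transsem_inj {M M' N N' : Tm Γ .i} :
    transsem M N = transsem M' N' ↔ M = M' ∧ N = N' := ap₂_inj _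
@[simp]
theorem value_inj {M M' : Tm Γ .i} : value M = value M' ↔ M = M' := ap₁_inj _

@[simp]
theorem head_z : (z : Tm Γ .nt).head = some ⟨_, .z⟩ := Tm.head_const _
@[simp]
theorem head_s (I : Tm Γ .nt) : (s I).head = some ⟨_, .s⟩ := head_ap₁ _ _
@[simp]
theorem head_nil : (nil : Tm Γ .lst).head = some ⟨_, .nil⟩ := Tm.head_const _
@[simp]
theorem head_cons (X : Tm Γ .atm) (L : Tm Γ .lst) : (cons X L).head = some ⟨_, .cons⟩ :=
  head_ap₂ _ _ _
@[simp]
theorem head_atom (A : Tm Γ .atm) : (atom A).head = some ⟨_, .atom⟩ := head_ap₁ _ _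
@[simp]
theorem head_tt : (tt : Tm Γ .prp).head = some ⟨_, .tt⟩ := Tm.head_const _
@[simp]
theorem head_amp (B C : Tm Γ .prp) : (amp B C).head = some ⟨_, .amp⟩ :=
  head_ap₂ _ _ _
@[simp]
theorem head_oimp (A : Tm Γ .atm) (B : Tm Γ .prp) : (oimp A B).head = some ⟨_, .imp⟩ :=
  head_ap₂ _ _ _
@[simp]
theorem head_oall (B : Tm Γ (.arr .i .prp)) : (oall B).head = some ⟨_, .forallI⟩ :=
  head_ap₁ _ _
@[simp]
theorem head_zero : (zero : Tm Γ .i).head = some ⟨_, .zero⟩ := Tm.head_const _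
@[simp]
theorem head_tru : (tru : Tm Γ .i).head = some ⟨_, .tru⟩ := Tm.head_const _
@[simp]
theorem head_fls : (fls : Tm Γ .i).head = some ⟨_, .fls⟩ := Tm.head_const _
@[simp]
theorem head_succ (M : Tm Γ .i) : (succ M).head = some ⟨_, .succ⟩ := head_ap₁ _ _
@[simp]
theorem head_pred (M : Tm Γ .i) : (pred M).head = some ⟨_, .pred⟩ := head_ap₁ _ _
@[simp]
theorem head_isZero (M : Tm Γ .i) : (isZero M).head = some ⟨_, .isZero⟩ :=
  head_ap₁ _ _
@[simp]
theorem head_cond (M N₁ N₂ : Tm Γ .i) : (cond M N₁ N₂).head = some ⟨_, .cond⟩ :=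
  head_ap₃ _ _ _ _
@[simp]
theorem head_abs (T : Tm Γ .i) (R : Tm Γ (.arr .i .i)) : (abs T R).head = some ⟨_, .abs⟩ :=
  head_ap₂ _ _ _
@[simp]
theorem head_app (M N : Tm Γ .i) : (app M N).head = some ⟨_, .app⟩ := head_ap₂ _ _ _
@[simp]
theorem head_fix (T : Tm Γ .i) (R : Tm Γ (.arr .i .i)) : (fix T R).head = some ⟨_, .fix⟩ :=
  head_ap₂ _ _ _
@[simp]
theorem head_typeof (M N : Tm Γ .i) : (typeof M N).head = some ⟨_, .typeof⟩ :=
  head_ap₂ _ _ _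
@[simp]
theorem head_natsem (M N : Tm Γ .i) : (natsem M N).head = some ⟨_, .natsem⟩ :=
  head_ap₂ _ _ _
@[simp]
theorem head_transone (M N : Tm Γ .i) : (transone M N).head = some ⟨_, .transone⟩ :=
  head_ap₂ _ _ _
@[simp]
theorem head_transsem (M N : Tm Γ .i) : (transsem M N).head = some ⟨_, .transsem⟩ :=
  head_ap₂ _ _ _
@[simp]
theorem head_value (M : Tm Γ .i) : (value M).head = some ⟨_, .value⟩ := head_ap₁ _ _

theorem Tm.absurd_of_head_ne {a : Ty} {t u : Tm Γ a} (h : t = u) (hne : t.head ≠ u.head) : False :=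
  hne (congrArg Tm.head h)

end

/-! ### Structural rules -/

section

variable {D : Definition} {Γ Δ : Ctx}

theorem Der.init (B : Fm Γ) : ∀ H : Multiset (Fm Γ), Der D (B ::ₘ H) B := by
  induction B with
  | nat I => exact fun _ => .initNat
  | atom A => exact fun _ => .initAtom
  | bot => exact fun _ => .botL
  | top => exact fun _ => .topR
  | and B C ihB ihC => exact fun H => .andR (.andL₁ (ihB H)) (.andL₂ (ihC H))
  | or B C ihB ihC => exact fun H => .orL (.orR₁ (ihB H)) (.orR₂ (ihC H))
  | imp B C ihB ihC =>
    intro H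
    refine .impR ?_
    rw [Multiset.cons_swap]
    exact .impL (ihB H) (ihC _)
  | all a B ih =>
    intro H
    refine .allR ?_
    rw [Multiset.map_cons]
    refine .allL (Tm.var .zero) ?_
    rw [Fm.shift_inst_var]
    exact ih _
  | ex a B ih =>
    intro H
    refine .exL (.exR (Tm.var .zero) ?_)
    rw [Fm.shift_inst_var]
    exact ih _

theorem Der.weaken {H : Multiset (Fm Γ)} {C : Fm Γ} (h : Der D H C) (B : Fm Γ) :
    Der D (B ::ₘ H) C := by
  have h' := h.cut (.init C {B})
  rwa [add_comm, Multiset.singleton_add] at h'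

theorem isCompleteSetOfUnifiers_univ {A : Atom Γ} {c : Clause} :
    IsCompleteSetOfUnifiers (Set.univ : Set (Unifier A c)) :=
  fun ρ => ⟨ρ, trivial, Sub.id, (Sub.comp_id _).symm, (Sub.comp_id _).symm⟩

theorem IsCompleteSetOfUnifiers.exists_comp_eq {A : Atom Γ} {c : Clause} {S : Set (Unifier A c)}
    (hS : IsCompleteSetOfUnifiers S) (σ : Sub Γ Δ) (ρ : Unifier (A.subst σ) c) :
    ∃ θ ∈ S, ∃ τ : Sub θ.cod ρ.cod, σ.comp ρ.left = θ.left.comp τ ∧ ρ.right = θ.right.comp τ :=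
  hS ⟨ρ.cod, σ.comp ρ.left, ρ.right, by rw [← Atom.subst_subst]; exact ρ.unifies⟩

theorem Der.defL_unifiers {H : Multiset (Fm Γ)} {A : Atom Γ} {C : Fm Γ}
    (h : ∀ c ∈ D.clauses, ∀ θ : Unifier A c,
      Der D (c.body.subst θ.right ::ₘ H.map (Fm.subst θ.left)) (C.subst θ.left)) :
    Der D (.atom A ::ₘ H) C :=
  .defL (fun _ => Set.univ) (fun _ _ => isCompleteSetOfUnifiers_univ) fun c hc θ _ => h c hc θ

theorem Fm.map_weaken_subst {a : Ty} (H : Multiset (Fm Γ)) (σ : Sub Γ Δ) :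
    (H.map (Fm.weaken (a := a))).map (Fm.subst σ.lift) =
      (H.map (Fm.subst σ)).map Fm.weaken := by
  simp only [Multiset.map_map, Function.comp_def, Fm.subst_weaken]

theorem Fm.subst_step {a : Ty} (B : Fm (a :: Γ)) (σ : Sub Γ Δ) (t : Tm (a :: Γ) a) :
    ((B.subst Sub.shift.lift).inst t).subst σ.lift =
      ((B.subst σ.lift).subst Sub.shift.lift).inst (t.subst σ.lift) := by
  rw [Fm.subst_inst, Fm.subst_subst, Fm.subst_subst, ← Sub.lift_comp, ← Sub.lift_comp,
    Sub.shift_comp_lift]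

theorem Der.subst {H : Multiset (Fm Γ)} {C : Fm Γ} (h : Der D H C) :
    ∀ {Δ : Ctx} (σ : Sub Γ Δ), Der D (H.map (Fm.subst σ)) (C.subst σ) := by
  induction h with
    (intro Δ σ
     try simp only [Multiset.map_cons, Multiset.map_singleton, Multiset.map_add,
       Fm.subst_inst] at *)
  | botL => exact .botL
  | topR => exact .topR
  | andL₁ _ ih => exact .andL₁ (ih σ)
  | andL₂ _ ih => exact .andL₂ (ih σ)
  | andR _ _ ih₁ ih₂ => exact .andR (ih₁ σ) (ih₂ σ)
  | orL _ _ ih₁ ih₂ => exact .orL (ih₁ σ) (ih₂ σ)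
  | orR₁ _ ih => exact .orR₁ (ih σ)
  | orR₂ _ ih => exact .orR₂ (ih σ)
  | impL _ _ ih₁ ih₂ => exact .impL (ih₁ σ) (ih₂ σ)
  | impR _ ih => exact .impR (ih σ)
  | allL t _ ih => exact .allL (t.subst σ) (ih σ)
  | allR _ ih => exact .allR (Fm.map_weaken_subst _ σ ▸ ih σ.lift)
  | exL _ ih => exact .exL (Fm.map_weaken_subst _ σ ▸ Fm.subst_weaken _ σ ▸ ih σ.lift)
  | exR t _ ih => exact .exR (t.subst σ) (ih σ)
  | initAtom => exact .initAtom
  | initNat => exact .initNat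
  | contrL _ ih => exact .contrL (ih σ)
  | cut _ _ ih₁ ih₂ => exact .cut (ih₁ σ) (ih₂ σ)
  | natRzero => exact .natRzero
  | natRsucc _ ih =>
    rw [Fm.subst, Tm.subst_app]
    exact .natRsucc (ih σ)
  | natL B _ _ _ ih₁ ih₂ ih₃ =>
    refine .natL (B.subst σ.lift) (ih₁ σ) ?_ (ih₃ σ)
    have h := ih₂ σ.lift
    rwa [← Fm.subst_inst, Fm.subst_step, Tm.subst_app, v0, Tm.subst_var] at h
  | defR c hc θ hA _ ih =>
    refine .defR c hc (θ.comp σ) (by rw [hA, Atom.subst_subst]) ?_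
    rw [← Fm.subst_subst]
    exact ih σ
  | defL S hS _ ih =>
    refine .defL_unifiers fun c hc ρ => ?_
    obtain ⟨θ, hθ, τ, h₁, h₂⟩ := (hS c hc).exists_comp_eq σ ρ
    have h := ih c hc θ hθ τ
    simp only [Multiset.map_map, Function.comp_def, Fm.subst_subst, ← h₁, ← h₂] at h ⊢
    exact h
theorem Der.contract {H K : Multiset (Fm Γ)} {C : Fm Γ} (h : Der D (K + (K + H)) C) :
    Der D (K + H) C := by
  induction K using Multiset.induction_on generalizing H with
  | empty => simpa using h
  | cons B K ih =>
    rw [Multiset.cons_add]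
    refine .contrL ?_
    rw [← Multiset.add_cons, ← Multiset.add_cons]
    refine ih ?_
    convert h using 1
    simp only [Multiset.cons_add, Multiset.add_cons]

theorem Der.cut_shared {H : Multiset (Fm Γ)} {B C : Fm Γ} (h : Der D H B)
    (h' : Der D (B ::ₘ H) C) : Der D H C := by
  have h := Der.contract (H := 0) (K := H) (C := C) (D := D) (by simpa using Der.cut h h')
  simpa using h
end

/-! ### Natural deduction over extensions of the hypotheses -/

section

variable {D : Definition} {Γ Δ Θ : Ctx} {a b c : Ty}

/-- What is derivable from `H` is, after the substitution `σ`, derivable from `H'`. -/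
def Ext (D : Definition) (σ : Sub Γ Δ) (H : Multiset (Fm Γ)) (H' : Multiset (Fm Δ)) : Prop :=
  ∀ ⦃B : Fm Γ⦄, Der D H B → Der D H' (B.subst σ)

theorem Ext.map (σ : Sub Γ Δ) (H : Multiset (Fm Γ)) : Ext D σ H (H.map (Fm.subst σ)) :=
  fun _ h => h.subst σ

theorem Ext.map_cons (σ : Sub Γ Δ) (H : Multiset (Fm Γ)) (B : Fm Δ) :
    Ext D σ H (B ::ₘ H.map (Fm.subst σ)) :=
  fun _ h => (h.subst σ).weaken B

theorem Ext.trans {σ : Sub Γ Δ} {τ : Sub Δ Θ}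
    {H : Multiset (Fm Γ)} {H' : Multiset (Fm Δ)} {K : Multiset (Fm Θ)} (e : Ext D σ H H')
    (e' : Ext D τ H' K) : Ext D (σ.comp τ) H K := by
  intro B h
  rw [← Fm.subst_subst]
  exact e' (e h)

theorem Der.imp_intro {H : Multiset (Fm Γ)} {B C : Fm Γ}
    (k : ∀ H' : Multiset (Fm Γ), (∀ ⦃F : Fm Γ⦄, Der D H F → Der D H' F) → Der D H' B →
      Der D H' C) : Der D H (.imp B C) :=
  .impR (k _ (fun _ h => h.weaken B) (.init B H))

theorem Der.imp_elim {H : Multiset (Fm Γ)} {B C : Fm Γ} (h : Der D H (.imp B C))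
    (hB : Der D H B) : Der D H C :=
  h.cut_shared (.impL hB (.init C H))

theorem Der.and_left {H : Multiset (Fm Γ)} {B C : Fm Γ} (h : Der D H (.and B C)) : Der D H B :=
  h.cut_shared (.andL₁ (.init B H))

theorem Der.and_right {H : Multiset (Fm Γ)} {B C : Fm Γ} (h : Der D H (.and B C)) : Der D H C :=
  h.cut_shared (.andL₂ (.init C H))

theorem Der.all_intro {H : Multiset (Fm Γ)} {a : Ty} {B : Fm (a :: Γ)}
    (k : ∀ (Δ : Ctx) (σ : Sub Γ Δ) (H' : Multiset (Fm Δ)), Ext D σ H H' → ∀ t : Tm Δ a,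
      Der D H' (B.subst (Sub.cons t σ))) : Der D H (.all a B) := by
  have h := k _ Sub.shift _ (Ext.map Sub.shift H) (Tm.var .zero)
  rw [← Fm.subst_lift_inst, Fm.shift_inst_var] at h
  exact .allR h

theorem Der.all_elim {H : Multiset (Fm Γ)} {a : Ty} {B : Fm (a :: Γ)} (h : Der D H (.all a B))
    (t : Tm Γ a) : Der D H (B.subst (Sub.cons t Sub.id)) := by
  rw [← Sub.single_eq_cons]
  exact h.cut_shared (.allL t (.init _ H))

theorem Der.ex_intro {H : Multiset (Fm Γ)} {a : Ty} {B : Fm (a :: Γ)} (t : Tm Γ a)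
    (h : Der D H (B.subst (Sub.cons t Sub.id))) : Der D H (.ex a B) := by
  rw [← Sub.single_eq_cons] at h
  exact .exR t h

theorem Der.ex_elim {H : Multiset (Fm Γ)} {a : Ty} {B : Fm (a :: Γ)} {C : Fm Γ}
    (h : Der D H (.ex a B))
    (k : ∀ (Δ : Ctx) (σ : Sub Γ Δ) (H' : Multiset (Fm Δ)), Ext D σ H H' → ∀ t : Tm Δ a,
      Der D H' (B.subst (Sub.cons t σ)) → Der D H' (C.subst σ)) : Der D H C := by
  refine h.cut_shared (.exL (k _ Sub.shift _ (Ext.map_cons Sub.shift H B) (Tm.var .zero) ?_))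
  rw [← Fm.subst_lift_inst, Fm.shift_inst_var]
  exact .init _ _

theorem Der.def_elim {H : Multiset (Fm Γ)} {A : Atom Γ} {C : Fm Γ} (h : Der D H (.atom A))
    (k : ∀ (Δ : Ctx) (σ : Sub Γ Δ) (H' : Multiset (Fm Δ)), Ext D σ H H' → ∀ c ∈ D.clauses,
      ∀ τ : Sub c.ctx Δ, A.subst σ = c.head.subst τ → Der D H' (c.body.subst τ) →
        Der D H' (C.subst σ)) : Der D H C := by
  refine h.cut_shared (.defL_unifiers fun c hc θ => ?_)
  exact k _ θ.left _ (Ext.map_cons _ _ _) c hc θ.right θ.unifies (.init _ _)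

theorem Der.all_imp_intro {B C : Fm (a :: Γ)}
    (k : ∀ (Δ : Ctx) (σ : Sub Γ Δ) (H' : Multiset (Fm Δ)), Ext D σ H H' → ∀ t : Tm Δ a,
      Der D H' (B.subst (Sub.cons t σ)) → Der D H' (C.subst (Sub.cons t σ))) :
    Der D H (.all a (.imp B C)) :=
  .all_intro fun Δ σ _ e t => .imp_intro fun _ e' h => k Δ σ _ (fun _ h => e' (e h)) t h

theorem Der.all₂_intro {B : Fm (b :: a :: Γ)}
    (k : ∀ (Δ : Ctx) (σ : Sub Γ Δ) (H' : Multiset (Fm Δ)), Ext D σ H H' →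
      ∀ (t : Tm Δ a) (u : Tm Δ b), Der D H' (B.subst (Sub.cons u (Sub.cons t σ)))) :
    Der D H (.all a (.all b B)) := by
  refine .all_intro fun Δ σ _ e t => .all_intro fun Θ τ K e' u => ?_
  rw [Fm.subst_subst, Sub.lift_comp_cons, Sub.cons_comp]
  exact k Θ _ K (e.trans e') _ u

theorem Der.all₂_imp_intro {B C : Fm (b :: a :: Γ)}
    (k : ∀ (Δ : Ctx) (σ : Sub Γ Δ) (H' : Multiset (Fm Δ)), Ext D σ H H' →
      ∀ (t : Tm Δ a) (u : Tm Δ b), Der D H' (B.subst (Sub.cons u (Sub.cons t σ))) →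
        Der D H' (C.subst (Sub.cons u (Sub.cons t σ)))) :
    Der D H (.all a (.all b (.imp B C))) :=
  .all₂_intro fun Δ σ _ e t u => .imp_intro fun _ e' h => k Δ σ _ (fun _ h => e' (e h)) t u h

theorem Der.all₃_imp_intro {B C : Fm (c :: b :: a :: Γ)}
    (k : ∀ (Δ : Ctx) (σ : Sub Γ Δ) (H' : Multiset (Fm Δ)), Ext D σ H H' →
      ∀ (t : Tm Δ a) (u : Tm Δ b) (v : Tm Δ c),
        Der D H' (B.subst (Sub.cons v (Sub.cons u (Sub.cons t σ)))) →
          Der D H' (C.subst (Sub.cons v (Sub.cons u (Sub.cons t σ))))) :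
    Der D H (.all a (.all b (.all c (.imp B C)))) := by
  refine .all₂_intro fun Δ σ _ e t u => .all_imp_intro fun Θ τ K e' v h => ?_
  rw [Fm.subst_subst, Sub.lift_comp_cons, Sub.cons_comp, Sub.cons_comp] at h ⊢
  exact k Θ _ K (e.trans e') _ _ v h

theorem Der.imp₂_intro {B C E : Fm Γ}
    (k : ∀ H' : Multiset (Fm Γ), (∀ {F : Fm Γ}, Der D H F → Der D H' F) → Der D H' B →
      Der D H' C → Der D H' E) : Der D H (.imp B (.imp C E)) :=
  .imp_intro fun _ e h => .imp_intro fun K e' h' => k K (fun h => e' (e h)) (e' h) h'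

theorem Der.all₃_imp₂_intro {B C E : Fm (c :: b :: a :: Γ)}
    (k : ∀ (Δ : Ctx) (σ : Sub Γ Δ) (H' : Multiset (Fm Δ)), Ext D σ H H' →
      ∀ (t : Tm Δ a) (u : Tm Δ b) (v : Tm Δ c),
        Der D H' (B.subst (Sub.cons v (Sub.cons u (Sub.cons t σ)))) →
          Der D H' (C.subst (Sub.cons v (Sub.cons u (Sub.cons t σ)))) →
            Der D H' (E.subst (Sub.cons v (Sub.cons u (Sub.cons t σ))))) :
    Der D H (.all a (.all b (.all c (.imp B (.imp C E))))) :=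
  .all₃_imp_intro fun Δ σ _ e t u v h => .imp_intro fun K e' h' =>
    k Δ σ K (fun _ h => e' (e h)) t u v (e' h) h'

theorem Der.all₂_imp_all_imp_intro {B : Fm (b :: a :: Γ)} {C E : Fm (c :: b :: a :: Γ)}
    (k : ∀ (Δ : Ctx) (σ : Sub Γ Δ) (H' : Multiset (Fm Δ)), Ext D σ H H' →
      ∀ (t : Tm Δ a) (u : Tm Δ b) (v : Tm Δ c),
        Der D H' (B.subst (Sub.cons u (Sub.cons t σ))) →
          Der D H' (C.subst (Sub.cons v (Sub.cons u (Sub.cons t σ)))) →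
            Der D H' (E.subst (Sub.cons v (Sub.cons u (Sub.cons t σ))))) :
    Der D H (.all a (.all b (.imp B (.all c (.imp C E))))) := by
  refine .all₂_imp_intro fun Δ σ _ e t u h => .all_imp_intro fun Θ τ K e' v h' => ?_
  have h := e' h
  rw [Fm.subst_subst, Sub.cons_comp, Sub.cons_comp] at h
  rw [Fm.subst_subst, Sub.lift_comp_cons, Sub.cons_comp, Sub.cons_comp] at h' ⊢
  exact k Θ _ K (e.trans e') _ _ v h h'

theorem Der.nat_induction (P : ∀ {Γ : Ctx}, Tm Γ .nt → Fm Γ)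
    (hP : ∀ {Γ Δ : Ctx} (σ : Sub Γ Δ) (I : Tm Γ .nt), (P I).subst σ = P (I.subst σ))
    (hz : ∀ {Γ : Ctx} (H : Multiset (Fm Γ)), Der D H (P z))
    (hs : ∀ {Γ : Ctx} (H : Multiset (Fm Γ)) (I : Tm Γ .nt), Der D H (.nat I) → Der D H (P I) →
      Der D H (P (s I)))
    {H : Multiset (Fm Γ)} {I : Tm Γ .nt} (h : Der D H (.nat I)) : Der D H (P I) := by
  have e : ∀ {Δ : Ctx} (I : Tm Δ .nt) (σ : Sub Γ Δ),
      (Fm.and (.nat v0) (P v0)).subst (Sub.cons I σ) = .and (.nat I) (P I) := by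
    intro Δ I σ
    simp only [Fm.subst, hP, v0, Tm.subst_var, Sub.cons]
  refine h.cut_shared (.natL (.and (.nat v0) (P v0)) ?_ ?_ ?_)
  · rw [Fm.inst, Sub.single_eq_cons, e]
    exact .andR .natRzero (hz _)
  · rw [Fm.subst_lift_inst, e]
    exact .andR (.natRsucc (Der.init _ 0).and_left)
      (hs _ _ (Der.init _ 0).and_left (Der.init _ 0).and_right)
  · rw [Fm.inst, Sub.single_eq_cons, e]
    exact (Der.init _ _).and_right

end

/-! ### Substitution in PCF terms and clauses -/

attribute [simp] v0 v1 v2 v3 v4 Sub.cons Sub.lift Fm.subst Atom.subst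

section

variable {Γ Δ : Ctx} {a b c d : Ty} (σ : Sub Γ Δ)

@[simp]
theorem Tm.weaken_var (x : Var Γ a) : ((Tm.var x).weaken : Tm (b :: Γ) a) = .var (.succ x) := rfl

theorem ap₁_subst (k : Const (.arr a b)) (t : Tm Γ a) : (ap₁ k t).subst σ = ap₁ k (t.subst σ) :=
  Tm.subst_app _ _ _

theorem ap₂_subst (k : Const (.arr a (.arr b c))) (t : Tm Γ a) (u : Tm Γ b) :
    (ap₂ k t u).subst σ = ap₂ k (t.subst σ) (u.subst σ) := by
  rw [ap₂, Tm.subst_app, ap₁_subst]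
  rfl

theorem ap₃_subst (k : Const (.arr a (.arr b (.arr c d)))) (t : Tm Γ a) (u : Tm Γ b)
    (v : Tm Γ c) : (ap₃ k t u v).subst σ = ap₃ k (t.subst σ) (u.subst σ) (v.subst σ) := by
  rw [ap₃, Tm.subst_app, ap₂_subst]
  rfl

@[simp]
theorem z_subst : (z : Tm Γ .nt).subst σ = z := rfl
@[simp]
theorem nil_subst : (nil : Tm Γ .lst).subst σ = nil := rfl
@[simp]
theorem tt_subst : (tt : Tm Γ .prp).subst σ = tt := rfl
@[simp]
theorem num_subst : (num : Tm Γ .i).subst σ = num := rfl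
@[simp]
theorem bool_subst : (bool : Tm Γ .i).subst σ = bool := rfl
@[simp]
theorem zero_subst : (zero : Tm Γ .i).subst σ = zero := rfl
@[simp]
theorem tru_subst : (tru : Tm Γ .i).subst σ = tru := rfl
@[simp]
theorem fls_subst : (fls : Tm Γ .i).subst σ = fls := rfl
@[simp]
theorem s_subst (I : Tm Γ .nt) : (s I).subst σ = s (I.subst σ) := ap₁_subst _ _ _
@[simp]
theorem cons_subst (X : Tm Γ .atm) (L : Tm Γ .lst) :
    (cons X L).subst σ = cons (X.subst σ) (L.subst σ) := ap₂_subst _ _ _ _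
@[simp]
theorem atom_subst (A : Tm Γ .atm) : (atom A).subst σ = atom (A.subst σ) := ap₁_subst _ _ _
@[simp]
theorem amp_subst (B C : Tm Γ .prp) : (amp B C).subst σ = amp (B.subst σ) (C.subst σ) :=
  ap₂_subst _ _ _ _
@[simp]
theorem oimp_subst (A : Tm Γ .atm) (B : Tm Γ .prp) :
    (oimp A B).subst σ = oimp (A.subst σ) (B.subst σ) := ap₂_subst _ _ _ _
@[simp]
theorem oall_subst (B : Tm Γ (.arr .i .prp)) : (oall B).subst σ = oall (B.subst σ) :=
  ap₁_subst _ _ _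
@[simp]
theorem arrow_subst (T U : Tm Γ .i) : (arrow T U).subst σ = arrow (T.subst σ) (U.subst σ) :=
  ap₂_subst _ _ _ _
@[simp]
theorem succ_subst (M : Tm Γ .i) : (succ M).subst σ = succ (M.subst σ) := ap₁_subst _ _ _
@[simp]
theorem pred_subst (M : Tm Γ .i) : (pred M).subst σ = pred (M.subst σ) := ap₁_subst _ _ _
@[simp]
theorem isZero_subst (M : Tm Γ .i) : (isZero M).subst σ = isZero (M.subst σ) :=
  ap₁_subst _ _ _
@[simp]
theorem cond_subst (M N₁ N₂ : Tm Γ .i) :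
    (cond M N₁ N₂).subst σ = cond (M.subst σ) (N₁.subst σ) (N₂.subst σ) := ap₃_subst _ _ _ _ _
@[simp]
theorem abs_subst (T : Tm Γ .i) (R : Tm Γ (.arr .i .i)) :
    (abs T R).subst σ = abs (T.subst σ) (R.subst σ) := ap₂_subst _ _ _ _
@[simp]
theorem app_subst (M N : Tm Γ .i) : (app M N).subst σ = app (M.subst σ) (N.subst σ) :=
  ap₂_subst _ _ _ _
@[simp]
theorem fix_subst (T : Tm Γ .i) (R : Tm Γ (.arr .i .i)) :
    (fix T R).subst σ = fix (T.subst σ) (R.subst σ) := ap₂_subst _ _ _ _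
@[simp]
theorem typeof_subst (M N : Tm Γ .i) :
    (typeof M N).subst σ = typeof (M.subst σ) (N.subst σ) :=
  ap₂_subst _ _ _ _
@[simp]
theorem natsem_subst (M N : Tm Γ .i) :
    (natsem M N).subst σ = natsem (M.subst σ) (N.subst σ) :=
  ap₂_subst _ _ _ _
@[simp]
theorem transone_subst (M N : Tm Γ .i) :
    (transone M N).subst σ = transone (M.subst σ) (N.subst σ) := ap₂_subst _ _ _ _
@[simp]
theorem transsem_subst (M N : Tm Γ .i) :
    (transsem M N).subst σ = transsem (M.subst σ) (N.subst σ) := ap₂_subst _ _ _ _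
@[simp]
theorem value_subst (M : Tm Γ .i) : (value M).subst σ = value (M.subst σ) := ap₁_subst _ _ _

@[simp]
theorem prvFrom_subst (L : Tm Γ .lst) (B : Tm Γ .prp) :
    (prvFrom L B).subst σ = prvFrom (L.subst σ) (B.subst σ) := by
  simp [prvFrom]

@[simp]
theorem prv_subst (B : Tm Γ .prp) : (prv B).subst σ = prv (B.subst σ) := by
  simp [prv]

end

/-! ### Inversion of atoms -/

/-- The clauses of the object-level theory. -/
def progClauses : List Clause := typingClauses ++ natsemClauses ++ transClauses

/-- `G ⇒ A` is an instance of a clause of the object-level theory. -/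
def Prog {Γ : Ctx} (A : Tm Γ .atm) (G : Tm Γ .prp) : Prop :=
  ∃ c ∈ progClauses, ∃ τ : Sub c.ctx Γ, Atom.prog A G = c.head.subst τ

theorem Prog.subst {Γ Δ : Ctx} {A : Tm Γ .atm} {G : Tm Γ .prp} (h : Prog A G) (σ : Sub Γ Δ) :
    Prog (A.subst σ) (G.subst σ) := by
  obtain ⟨c, hc, τ, h⟩ := h
  refine ⟨c, hc, τ.comp σ, ?_⟩
  rw [← Atom.subst_subst, ← h]
  rfl

theorem body_of_mem_progClauses : ∀ c ∈ progClauses, c.body = .top := by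
  simp [progClauses, typingClauses, natsemClauses, transClauses, progClause]

theorem predicate_of_mem_progClauses : ∀ c ∈ progClauses, c.head.predicate = .prog := by
  simp [progClauses, typingClauses, natsemClauses, transClauses, progClause, Atom.predicate]

theorem Atom.predicate_subst {Γ Δ : Ctx} (σ : Sub Γ Δ) (A : Atom Γ) :
    (A.subst σ).predicate = A.predicate := by
  cases A <;> rfl

/-- The group of clauses for a predicate. -/
def clausesFor : Pred → List Clause
  | .seq => intuitClauses
  | .prog => progClauses
  | .same => sameClauses
  | .length | .list | .element | .split | .permute => listClauses
  | _ => natClauses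

theorem clausesFor_predicate {c : Clause} {cs : List Clause} (hc : c ∈ cs)
    (hcs : cs ∈ [natClauses, listClauses, intuitClauses, progClauses, sameClauses]) :
    clausesFor c.head.predicate = cs := by
  simp only [List.mem_cons, List.not_mem_nil, or_false] at hcs
  rcases hcs with rfl | rfl | rfl | rfl | rfl
  case inr.inr.inr.inl => rw [predicate_of_mem_progClauses c hc, clausesFor]
  all_goals
    revert c
    simp [natClauses, listClauses, intuitClauses, sameClauses, clausesFor, Atom.predicate]

theorem clausesFor_mem (p : Pred) :
    clausesFor p ∈ [natClauses, listClauses, intuitClauses, progClauses, sameClauses] := by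
  cases p <;> simp [clausesFor]

theorem mem_clauses_iff_exists (c : Clause) : c ∈ pcfDefinition.clauses ↔
    ∃ cs ∈ [natClauses, listClauses, intuitClauses, progClauses, sameClauses], c ∈ cs := by
  simp [pcfDefinition, progClauses, or_assoc]

theorem mem_clauses_iff (c : Clause) :
    c ∈ pcfDefinition.clauses ↔ c ∈ clausesFor c.head.predicate := by
  rw [mem_clauses_iff_exists]
  refine ⟨fun ⟨cs, hcs, hc⟩ => ?_, fun hc => ⟨_, clausesFor_mem _, hc⟩⟩
  rwa [clausesFor_predicate hc hcs]

/-- Derivability from the clauses for PCF. -/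
abbrev PDer {Γ : Ctx} (H : Multiset (Fm Γ)) (C : Fm Γ) : Prop := Der pcfDefinition H C

/-- Extension of hypotheses, for the clauses for PCF. -/
abbrev PExt {Γ Δ : Ctx} (σ : Sub Γ Δ) (H : Multiset (Fm Γ)) (H' : Multiset (Fm Δ)) : Prop :=
  Ext pcfDefinition σ H H'

section

variable {Γ : Ctx} {H : Multiset (Fm Γ)} {C : Fm Γ}

theorem Der.atom_elim {A : Atom Γ} (h : PDer H (.atom A))
    (k : ∀ (Δ : Ctx) (σ : Sub Γ Δ) (H' : Multiset (Fm Δ)), PExt σ H H' →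
      ∀ c ∈ clausesFor A.predicate, ∀ τ : Sub c.ctx Δ, A.subst σ = c.head.subst τ →
        PDer H' (c.body.subst τ) → PDer H' (C.subst σ)) : PDer H C := by
  refine Der.def_elim h fun Δ σ H' e c hc τ hA hB => k Δ σ H' e c ?_ τ hA hB
  rw [mem_clauses_iff] at hc
  rwa [← Atom.predicate_subst σ, hA, Atom.predicate_subst]

theorem Der.atom_intro {A : Atom Γ} (c : Clause) (τ : Sub c.ctx Γ)
    (h : PDer H (c.body.subst τ)) (hA : A = c.head.subst τ := by simp)
    (hc : c ∈ clausesFor c.head.predicate := by simp [clausesFor, Atom.predicate, natClauses,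
      listClauses, intuitClauses, sameClauses]) : PDer H (.atom A) :=
  Der.defR c ((mem_clauses_iff c).2 hc) τ hA h

theorem Der.prog_intro {A : Tm Γ .atm} {G : Tm Γ .prp} (h : Prog A G) :
    PDer H (.atom (.prog A G)) := by
  obtain ⟨c, hc, τ, h⟩ := h
  refine Der.atom_intro c τ ?_ h (by rwa [predicate_of_mem_progClauses c hc])
  rw [body_of_mem_progClauses c hc]
  exact .topR

theorem Der.prog_elim {A : Tm Γ .atm} {G : Tm Γ .prp} (h : PDer H (.atom (.prog A G)))
    (k : ∀ (Δ : Ctx) (σ : Sub Γ Δ) (H' : Multiset (Fm Δ)), PExt σ H H' →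
      Prog (A.subst σ) (G.subst σ) → PDer H' (C.subst σ)) : PDer H C :=
  h.atom_elim fun Δ σ H' e c hc τ hA _ => k Δ σ H' e ⟨c, hc, τ, hA⟩

theorem Der.same_intro (M : Tm Γ .i) : PDer H (.atom (.same M M)) :=
  Der.atom_intro ⟨[.i], .same v0 v0, .top⟩
    (Sub.cons M Sub.empty) .topR

theorem Der.same_elim {M N : Tm Γ .i} (h : PDer H (.atom (.same M N)))
    (k : ∀ (Δ : Ctx) (σ : Sub Γ Δ) (H' : Multiset (Fm Δ)), PExt σ H H' →
      M.subst σ = N.subst σ → PDer H' (C.subst σ)) : PDer H C := by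
  refine h.atom_elim fun Δ σ H' e c hc τ hA _ => k Δ σ H' e ?_
  simp only [clausesFor, Atom.predicate, sameClauses, List.mem_singleton] at hc
  subst hc
  simp only [Atom.subst, Atom.same.injEq] at hA
  rw [hA.1, hA.2]

theorem Der.element_head (X : Tm Γ .atm) (L : Tm Γ .lst) :
    PDer H (.atom (.element X (cons X L))) :=
  Der.atom_intro ⟨[.atm, .lst], .element v0 (cons v0 v1), .top⟩
    (Sub.cons X (Sub.cons L Sub.empty)) .topR

theorem Der.element_tail {X : Tm Γ .atm} (Y : Tm Γ .atm) {L : Tm Γ .lst}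
    (h : PDer H (.atom (.element X L))) : PDer H (.atom (.element X (cons Y L))) :=
  Der.atom_intro ⟨[.atm, .atm, .lst], .element v0 (cons v1 v2), .atom (.element v0 v2)⟩
    (Sub.cons X (Sub.cons Y (Sub.cons L Sub.empty))) (by simpa using h)

theorem Der.element_elim {X : Tm Γ .atm} {L : Tm Γ .lst} (h : PDer H (.atom (.element X L)))
    (k₁ : ∀ (Δ : Ctx) (σ : Sub Γ Δ) (H' : Multiset (Fm Δ)), PExt σ H H' → ∀ L' : Tm Δ .lst,
      L.subst σ = cons (X.subst σ) L' → PDer H' (C.subst σ))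
    (k₂ : ∀ (Δ : Ctx) (σ : Sub Γ Δ) (H' : Multiset (Fm Δ)), PExt σ H H' →
      ∀ (Y : Tm Δ .atm) (L' : Tm Δ .lst), L.subst σ = cons Y L' →
        PDer H' (.atom (.element (X.subst σ) L')) → PDer H' (C.subst σ)) : PDer H C := by
  refine h.atom_elim fun Δ σ H' e c hc τ hA hB => ?_
  simp only [clausesFor, Atom.predicate, listClauses, List.mem_cons, List.not_mem_nil,
    or_false] at hc
  rcases hc with rfl | rfl | rfl | rfl | rfl | rfl | rfl | rfl | rfl | rfl
  case inr.inr.inr.inl =>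
    simp only [Atom.subst, Atom.element.injEq, cons_subst] at hA
    exact k₁ Δ σ H' e _ (by rw [hA.2, hA.1])
  case inr.inr.inr.inr.inl =>
    simp only [Atom.subst, Atom.element.injEq, cons_subst, Fm.subst] at hA hB
    exact k₂ Δ σ H' e _ _ hA.2 (by rw [hA.1]; exact hB)
  all_goals nomatch hA

/-- The last step in the derivation of an object-level sequent of height at most `I`. -/
inductive SeqStep (H : Multiset (Fm Γ)) : Tm Γ .nt → Tm Γ .lst → Tm Γ .prp → Prop
  | init {I : Tm Γ .nt} {L : Tm Γ .lst} {A : Tm Γ .atm} :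
      PDer H (.atom (.element A L)) → SeqStep H I L (atom A)
  | tt {I : Tm Γ .nt} {L : Tm Γ .lst} : SeqStep H I L tt
  | amp {I : Tm Γ .nt} {L : Tm Γ .lst} {B C : Tm Γ .prp} : PDer H (.atom (.seq I L B)) →
      PDer H (.atom (.seq I L C)) → SeqStep H (s I) L (amp B C)
  | oimp {I : Tm Γ .nt} {L : Tm Γ .lst} {A : Tm Γ .atm} {B : Tm Γ .prp} :
      PDer H (.atom (.seq I (cons A L) B)) → SeqStep H (s I) L (oimp A B)
  | oall {I : Tm Γ .nt} {L : Tm Γ .lst} {B : Tm Γ (.arr .i .prp)} :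
      PDer H (.all .i (.atom (.seq I.weaken L.weaken (B.weaken.app v0)))) →
        SeqStep H (s I) L (oall B)
  | prog {I : Tm Γ .nt} {L : Tm Γ .lst} {A : Tm Γ .atm} {G : Tm Γ .prp} : Prog A G →
      PDer H (.atom (.seq I L G)) → SeqStep H (s I) L (atom A)

theorem Der.seq_init {I : Tm Γ .nt} {L : Tm Γ .lst} {A : Tm Γ .atm}
    (h : PDer H (.atom (.element A L))) : PDer H (.atom (.seq I L (atom A))) := by
  have seq_init_cons : ∀ {Δ : Ctx} {H' : Multiset (Fm Δ)} (I : Tm Δ .nt) (A Y : Tm Δ .atm)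
      (L : Tm Δ .lst), PDer H' (.atom (.element A (cons Y L))) →
        PDer H' (.atom (.seq I (cons Y L) (atom A))) := fun I A Y L h =>
    Der.atom_intro ⟨[.nt, .atm, .lst, .atm], .seq v0 (cons v1 v2) (atom v3),
        .atom (.element v3 (cons v1 v2))⟩
      (Sub.cons I (Sub.cons Y (Sub.cons L (Sub.cons A Sub.empty)))) (by simpa using h)
  refine h.element_elim (fun Δ σ H' e L' hL => ?_) (fun Δ σ H' e Y L' hL _ => ?_)
  all_goals
    have h := e h
    simp only [Fm.subst, Atom.subst, atom_subst, hL] at h ⊢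
    exact seq_init_cons _ _ _ _ h

theorem Der.seq_intro {I : Tm Γ .nt} {L : Tm Γ .lst} {B : Tm Γ .prp} (h : SeqStep H I L B) :
    PDer H (.atom (.seq I L B)) := by
  cases h with
  | init h => exact Der.seq_init h
  | tt =>
    exact Der.atom_intro ⟨[.nt, .lst], .seq v0 v1 tt, .top⟩
      (Sub.cons I (Sub.cons L Sub.empty)) .topR
  | @amp I _ B C h₁ h₂ =>
    exact Der.atom_intro ⟨[.nt, .lst, .prp, .prp], .seq (s v0) v1 (amp v2 v3),
        .and (.atom (.seq v0 v1 v2)) (.atom (.seq v0 v1 v3))⟩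
      (Sub.cons I (Sub.cons L (Sub.cons B (Sub.cons C Sub.empty))))
      (by simpa using .andR h₁ h₂)
  | @oimp I _ A B h =>
    exact Der.atom_intro ⟨[.nt, .lst, .atm, .prp], .seq (s v0) v1 (oimp v2 v3),
        .atom (.seq v0 (cons v2 v1) v3)⟩
      (Sub.cons I (Sub.cons L (Sub.cons A (Sub.cons B Sub.empty)))) (by simpa using h)
  | @oall I _ B h =>
    exact Der.atom_intro ⟨[.nt, .lst, .arr .i .prp], .seq (s v0) v1 (oall v2),
        .all .i (.atom (.seq v1 v2 (v3.app v0)))⟩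
      (Sub.cons I (Sub.cons L (Sub.cons B Sub.empty))) (by simpa using h)
  | @prog I _ A G hG h =>
    exact Der.atom_intro ⟨[.nt, .lst, .atm], .seq (s v0) v1 (atom v2),
        .ex .prp (.and (.atom (.prog v3 v0)) (.atom (.seq v1 v2 v0)))⟩
      (Sub.cons I (Sub.cons L (Sub.cons A Sub.empty)))
      (Der.ex_intro G (by simpa using .andR (Der.prog_intro hG) h))

theorem Der.seq_elim {I : Tm Γ .nt} {L : Tm Γ .lst} {B : Tm Γ .prp}
    (h : PDer H (.atom (.seq I L B)))
    (k : ∀ (Δ : Ctx) (σ : Sub Γ Δ) (H' : Multiset (Fm Δ)), PExt σ H H' →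
      SeqStep H' (I.subst σ) (L.subst σ) (B.subst σ) → PDer H' (C.subst σ)) : PDer H C := by
  refine h.atom_elim fun Δ σ H' e c hc τ hA hB => ?_
  simp only [clausesFor, Atom.predicate, intuitClauses, List.mem_cons, List.not_mem_nil,
    or_false] at hc
  rcases hc with rfl | rfl | rfl | rfl | rfl | rfl
  all_goals
    simp only [Atom.subst, Atom.seq.injEq, cons_subst, Fm.subst, s_subst, atom_subst, tt_subst,
      amp_subst, oimp_subst, oall_subst, Tm.subst_app, v0, v1, v2, v3, Tm.subst_var,
      Sub.lift] at hA hB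
    obtain ⟨h₁, h₂, h₃⟩ := hA
  · exact k Δ σ H' e (by rw [h₁, h₂, h₃]; exact .init hB)
  · exact k Δ σ H' e (by rw [h₁, h₂, h₃]; exact .tt)
  · exact k Δ σ H' e (by rw [h₁, h₂, h₃]; exact .amp hB.and_left hB.and_right)
  · exact k Δ σ H' e (by rw [h₁, h₂, h₃]; exact .oimp hB)
  · exact k Δ σ H' e (by rw [h₁, h₂, h₃]; exact .oall hB)
  · refine hB.ex_elim fun Θ ρ K e₁ G hG => ?_
    simp only [Fm.subst, Atom.subst, Tm.weaken_subst_cons, Tm.subst_var, Sub.cons] at hG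
    refine hG.and_left.prog_elim fun Ξ π J e₂ hP => ?_
    rw [Fm.subst_subst, Fm.subst_subst]
    refine k Ξ _ J (e.trans (e₁.trans e₂)) ?_
    simp only [← Tm.subst_subst, h₁, h₂, h₃, s_subst, atom_subst]
    exact .prog hP (e₂ hG.and_right)

end

/-! ### Weakening and cut in the object logic -/

section

variable {Γ Δ : Ctx} {H : Multiset (Fm Γ)}

/-- The formula `seq I L B`. -/
abbrev seqF (I : Tm Γ .nt) (L : Tm Γ .lst) (B : Tm Γ .prp) : Fm Γ := .atom (.seq I L B)

/-- The formula `element X L`. -/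
abbrev elementF (X : Tm Γ .atm) (L : Tm Γ .lst) : Fm Γ := .atom (.element X L)

theorem SeqStep.of_z {L : Tm Γ .lst} {B : Tm Γ .prp} (h : SeqStep H z L B) (J : Tm Γ .nt) :
    SeqStep H J L B := by
  generalize hI : z = I at h
  cases h with
  | init h => exact .init h
  | tt => exact .tt
  | _ => exact (Tm.absurd_of_head_ne hI (by simp)).elim

theorem SeqStep.amp_inv {I : Tm Γ .nt} {L : Tm Γ .lst} {B C : Tm Γ .prp}
    (h : SeqStep H I L (FOLDN.amp B C)) :
    ∃ I', I = s I' ∧ PDer H (seqF I' L B) ∧ PDer H (seqF I' L C) := by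
  generalize hB : FOLDN.amp B C = G at h
  cases h with
  | amp h₁ h₂ =>
    obtain ⟨rfl, rfl⟩ := amp_inj.1 hB
    exact ⟨_, rfl, h₁, h₂⟩
  | _ => exact (Tm.absurd_of_head_ne hB (by simp)).elim

theorem SeqStep.oimp_inv {I : Tm Γ .nt} {L : Tm Γ .lst} {A : Tm Γ .atm} {B : Tm Γ .prp}
    (h : SeqStep H I L (FOLDN.oimp A B)) :
    ∃ I', I = s I' ∧ PDer H (seqF I' (cons A L) B) := by
  generalize hB : FOLDN.oimp A B = G at h
  cases h with
  | oimp h =>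
    obtain ⟨rfl, rfl⟩ := oimp_inj.1 hB
    exact ⟨_, rfl, h⟩
  | _ => exact (Tm.absurd_of_head_ne hB (by simp)).elim

theorem SeqStep.oall_inv {I : Tm Γ .nt} {L : Tm Γ .lst} {B : Tm Γ (.arr .i .prp)}
    (h : SeqStep H I L (FOLDN.oall B)) :
    ∃ I', I = s I' ∧ ∀ N, PDer H (seqF I' L (B.app N)) := by
  generalize hB : FOLDN.oall B = G at h
  cases h with
  | oall h =>
    obtain rfl := oall_inj.1 hB
    exact ⟨_, rfl, fun N => by simpa using h.all_elim N⟩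
  | _ => exact (Tm.absurd_of_head_ne hB (by simp)).elim

theorem SeqStep.atom_inv {I : Tm Γ .nt} {L : Tm Γ .lst} {A : Tm Γ .atm}
    (h : SeqStep H I L (atom A)) :
    PDer H (elementF A L) ∨ ∃ I' G, I = s I' ∧ Prog A G ∧ PDer H (seqF I' L G) := by
  generalize hB : atom A = G at h
  cases h with
  | init h =>
    obtain rfl := atom_inj.1 hB
    exact .inl h
  | prog h₁ h₂ =>
    obtain rfl := atom_inj.1 hB
    exact .inr ⟨_, _, rfl, h₁, h₂⟩
  | _ => exact (Tm.absurd_of_head_ne hB (by simp)).elim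

/-- The formula saying that the elements of `L` have derivations of height `K` from `L'`. -/
noncomputable def coverF (K : Tm Γ .nt) (L L' : Tm Γ .lst) : Fm Γ :=
  .all .atm (.imp (elementF v0 L.weaken) (seqF K.weaken L'.weaken (atom v0)))

@[simp]
theorem coverF_subst (σ : Sub Γ Δ) (K : Tm Γ .nt) (L L' : Tm Γ .lst) :
    (coverF K L L').subst σ = coverF (K.subst σ) (L.subst σ) (L'.subst σ) := by
  simp [coverF]

theorem coverF_intro {K : Tm Γ .nt} {L L' : Tm Γ .lst}
    (k : ∀ (Δ : Ctx) (σ : Sub Γ Δ) (H' : Multiset (Fm Δ)), PExt σ H H' →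
      ∀ X : Tm Δ .atm, PDer H' (elementF X (L.subst σ)) →
        PDer H' (seqF (K.subst σ) (L'.subst σ) (atom X))) :
    PDer H (coverF K L L') :=
  .all_imp_intro fun Δ σ H' e X h => by simpa using k Δ σ H' e X (by simpa using h)

theorem coverF_elim {K : Tm Γ .nt} {L L' : Tm Γ .lst} (h : PDer H (coverF K L L')) {X : Tm Γ .atm}
    (h' : PDer H (elementF X L)) : PDer H (seqF K L' (atom X)) := by
  simpa using (h.all_elim X).imp_elim (by simpa using h')

theorem coverF_self (K : Tm Γ .nt) (L : Tm Γ .lst) : PDer H (coverF K L L) :=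
  coverF_intro fun _ _ _ _ _ hX => .seq_init hX

theorem coverF_self_cons (K : Tm Γ .nt) (A : Tm Γ .atm) (L : Tm Γ .lst) :
    PDer H (coverF K L (cons A L)) := by
  refine coverF_intro fun Δ σ H' _ X hX => ?_
  rw [cons_subst]
  exact .seq_init (.element_tail _ hX)

theorem coverF_cons {K : Tm Γ .nt} {A : Tm Γ .atm} {L L' : Tm Γ .lst}
    (hA : PDer H (seqF K L' (atom A))) (h : PDer H (coverF K L L')) :
    PDer H (coverF K (cons A L) L') := by
  refine coverF_intro fun Δ σ H' e X hX => hX.element_elim (fun Θ τ J e' M hM => ?_)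
    (fun Θ τ J e' Y M hM hX => ?_)
  · have hA := e' (e hA)
    simp only [Fm.subst, Atom.subst, atom_subst, cons_subst, cons_inj] at hA hM ⊢
    rwa [← hM.1]
  · have h := e' (e h)
    simp only [coverF_subst, cons_subst, cons_inj, Fm.subst, Atom.subst, atom_subst] at h hM ⊢
    exact coverF_elim h (hM.2 ▸ hX)

/-- The formula saying that a sequent of height `I` whose hypotheses have derivations of height `K`
has a derivation of height `J`. -/
noncomputable def cutF (K I J : Tm Γ .nt) : Fm Γ :=
  .all .lst (.all .lst (.all .prp (.imp
    (.and (coverF K.weaken.weaken.weaken v2 v1) (seqF I.weaken.weaken.weaken v2 v0))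
    (seqF J.weaken.weaken.weaken v1 v0))))

@[simp]
theorem cutF_subst (σ : Sub Γ Δ) (K I J : Tm Γ .nt) :
    (cutF K I J).subst σ = cutF (K.subst σ) (I.subst σ) (J.subst σ) := by
  simp [cutF]

theorem cutF_elim {K I J : Tm Γ .nt} (h : PDer H (cutF K I J)) {L L' : Tm Γ .lst}
    {B : Tm Γ .prp} (hL : PDer H (coverF K L L')) (hB : PDer H (seqF I L B)) :
    PDer H (seqF J L' B) := by
  have h := (h.all_elim L).all_elim L'
  simpa using (h.all_elim B).imp_elim (by simpa using .andR hL hB)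

theorem cutF_intro {K I J : Tm Γ .nt}
    (k : ∀ (Δ : Ctx) (σ : Sub Γ Δ) (H' : Multiset (Fm Δ)), PExt σ H H' →
      ∀ (L L' : Tm Δ .lst) (B : Tm Δ .prp), PDer H' (coverF (K.subst σ) L L') →
        SeqStep H' (I.subst σ) L B → PDer H' (seqF (J.subst σ) L' B)) : PDer H (cutF K I J) := by
  refine .all₃_imp_intro fun Δ σ H' e L L' B h => ?_
  refine Der.seq_elim h.and_right fun Θ τ M e' hB => ?_
  have hL := e' h.and_left
  simp at hL hB ⊢
  simpa [← Tm.subst_subst] using k Θ _ M (e.trans e') _ _ _ (by simpa [← Tm.subst_subst] using hL)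
    (by simpa [← Tm.subst_subst] using hB)

/-- The formula saying that sequents of height `I` are also of height `J`, even after weakening:
weakening is the cut with hypotheses of height `z`, which can only be initial. -/
noncomputable abbrev monoF (I J : Tm Γ .nt) : Fm Γ := cutF z I J

theorem monoF_elim {I J : Tm Γ .nt} (h : PDer H (monoF I J)) {L : Tm Γ .lst} {B : Tm Γ .prp}
    (h' : PDer H (seqF I L B)) : PDer H (seqF J L B) :=
  cutF_elim h (coverF_self z L) h'

theorem monoF_trans {I J K : Tm Γ .nt} (h : PDer H (monoF I J)) (h' : PDer H (monoF J K)) :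
    PDer H (monoF I K) := by
  refine cutF_intro fun Δ σ H' e L L' B hL hB => ?_
  have h := e h
  have h' := e h'
  simp only [cutF_subst, z_subst] at h h' hL
  exact monoF_elim h' (cutF_elim h hL (.seq_intro hB))

theorem seqF_of_seqF_z {L : Tm Γ .lst} {B : Tm Γ .prp} (J : Tm Γ .nt)
    (h : PDer H (seqF z L B)) : PDer H (seqF J L B) :=
  h.seq_elim fun _ _ _ _ h => .seq_intro (h.of_z _)

theorem cutF_z (K : Tm Γ .nt) : PDer H (cutF K z K) := by
  refine cutF_intro fun Δ σ H' _ L L' B hL hB => ?_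
  generalize hI : z.subst σ = I at hB
  cases hB with
  | init h => exact coverF_elim hL h
  | tt => exact .seq_intro .tt
  | _ => exact (Tm.absurd_of_head_ne hI (by simp)).elim

theorem cutF_s {K I J : Tm Γ .nt}
    (hcons : ∀ (Δ : Ctx) (σ : Sub Γ Δ) (H' : Multiset (Fm Δ)), PExt σ H H' →
      ∀ (A : Tm Δ .atm) (L L' : Tm Δ .lst), PDer H' (coverF (K.subst σ) L L') →
        PDer H' (coverF (K.subst σ) (cons A L) (cons A L')))
    (hKJ : PDer H (monoF K (s J))) (h : PDer H (cutF K I J)) : PDer H (cutF K (s I) (s J)) := by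
  refine cutF_intro fun Δ σ H' e L L' B hL hB => ?_
  have h := e h
  have hKJ := e hKJ
  simp only [cutF_subst, s_subst, z_subst] at h hB hKJ ⊢
  generalize hI : s (I.subst σ) = M at hB
  cases hB with
  | init h => exact monoF_elim hKJ (coverF_elim hL h)
  | tt => exact .seq_intro .tt
  | amp h₁ h₂ =>
    obtain rfl := s_inj.1 hI
    exact .seq_intro (.amp (cutF_elim h hL h₁) (cutF_elim h hL h₂))
  | oimp h₁ =>
    obtain rfl := s_inj.1 hI
    exact .seq_intro (.oimp (cutF_elim h (hcons _ _ _ e _ _ _ hL) h₁))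
  | prog hP h₁ =>
    obtain rfl := s_inj.1 hI
    exact .seq_intro (.prog hP (cutF_elim h hL h₁))
  | oall h₁ =>
    obtain rfl := s_inj.1 hI
    refine .seq_intro (.oall (.all_intro fun Θ τ M e' N => ?_))
    have h := e' h
    have hL := e' hL
    have h₁ := (e' h₁).all_elim N
    simp only [cutF_subst, coverF_subst, Fm.subst, Atom.subst, Tm.weaken_subst_lift, v0,
      Tm.subst_app, Tm.subst_var, Sub.lift, Tm.weaken_subst_cons, Tm.subst_id, Sub.cons]
      at h hL h₁ ⊢
    exact cutF_elim h hL h₁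

theorem monoF_z (J : Tm Γ .nt) : PDer H (monoF z J) :=
  cutF_intro fun _ _ _ _ _ _ _ hL hB =>
    seqF_of_seqF_z _ (cutF_elim (cutF_z z) hL (.seq_intro hB))

theorem monoF_s {I J : Tm Γ .nt} (h : PDer H (monoF I J)) : PDer H (monoF (s I) (s J)) := by
  refine cutF_s (fun Δ σ H' _ A L L' hL => coverF_cons (.seq_init (.element_head _ _)) ?_)
    (monoF_z _) h
  refine coverF_intro fun Θ τ K e X hX => ?_
  have hL := e hL
  simp only [coverF_subst, z_subst, cons_subst] at hL ⊢
  refine (coverF_elim hL hX).seq_elim fun Ξ ρ M _ h => ?_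
  simp only [z_subst, atom_subst, Fm.subst, Atom.subst, cons_subst] at h ⊢
  rcases h.atom_inv with h | ⟨J, G, hJ, -⟩
  · exact .seq_init (.element_tail _ h)
  · exact (Tm.absurd_of_head_ne hJ (by simp)).elim

theorem monoF_refl {I : Tm Γ .nt} (h : PDer H (.nat I)) : PDer H (monoF I I) :=
  Der.nat_induction (fun I => monoF I I) (by intros; simp) (fun _ => monoF_z _)
    (fun _ _ _ h => monoF_s h) h

theorem monoF_self_s {I : Tm Γ .nt} (h : PDer H (.nat I)) : PDer H (monoF I (s I)) :=
  Der.nat_induction (fun I => monoF I (s I)) (by intros; simp) (fun _ => monoF_z _)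
    (fun _ _ _ h => monoF_s h) h

theorem coverF_cons_cons {K : Tm Γ .nt} {L L' : Tm Γ .lst} (hK : PDer H (.nat K)) (A : Tm Γ .atm)
    (h : PDer H (coverF K L L')) : PDer H (coverF K (cons A L) (cons A L')) := by
  refine coverF_cons (.seq_init (.element_head _ _)) (coverF_intro fun Δ σ H' e X hX => ?_)
  have h := e h
  rw [coverF_subst] at h
  rw [cons_subst]
  exact cutF_elim (monoF_refl (e hK)) (coverF_self_cons _ _ _) (coverF_elim h hX)

theorem exists_common_height {I J : Tm Γ .nt} (hI : PDer H (.nat I)) (hJ : PDer H (.nat J)) :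
    PDer H (.ex .nt (.and (.nat v0) (.and (monoF I.weaken v0) (monoF J.weaken v0)))) := by
  have h := Der.nat_induction (D := pcfDefinition) (H := H) (I := I)
    (fun I => .all .nt (.imp (.nat v0)
      (.ex .nt (.and (.nat v0) (.and (monoF I.weaken.weaken v0) (monoF v1 v0))))))
    (by intros; simp) ?_ ?_ hI
  · simpa using (h.all_elim J).imp_elim (by simpa using hJ)
  · refine fun H => .all_imp_intro fun Δ σ H' _ J hJ => Der.ex_intro J ?_
    simp only [Fm.subst, v0, Tm.subst_var, Sub.cons, Sub.lift, cutF_subst, z_subst,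
      Tm.weaken_subst_lift, Tm.weaken_subst_cons, v1, Tm.subst_id] at hJ ⊢
    exact .andR hJ (.andR (monoF_z _) (monoF_refl hJ))
  · refine fun H I _ h => .all_imp_intro fun Δ σ H' e J hJ => ?_
    have h := ((e h).all_elim J).imp_elim (by simpa using hJ)
    refine h.ex_elim fun Θ τ K _ M hM => ?_
    simp only [Fm.subst, v0, Tm.subst_var, Sub.lift, cutF_subst, z_subst, Tm.weaken_subst_lift, v1,
      Tm.weaken_var, Tm.weaken_subst_cons, Tm.subst_id, Sub.cons, s_subst] at hM ⊢
    refine .ex_intro (s M) ?_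
    simp only [Fm.subst, Tm.subst_var, Sub.cons, cutF_subst, z_subst, Tm.weaken_subst_cons, s_subst,
      Tm.subst_id]
    exact .andR (.natRsucc hM.and_left) (.andR (monoF_s hM.and_right.and_left)
      (monoF_trans hM.and_right.and_right (monoF_self_s hM.and_left)))

theorem exists_cut_height {K I : Tm Γ .nt} (hK : PDer H (.nat K)) (hI : PDer H (.nat I)) :
    PDer H (.ex .nt (.and (.nat v0) (cutF K.weaken I.weaken v0))) := by
  have h := Der.nat_induction (D := pcfDefinition) (H := H) (I := I)
    (fun I => .all .nt (.imp (.nat v0) (.ex .nt (.and (.nat v0)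
      (.and (monoF v1 v0) (cutF v1 I.weaken.weaken v0))))))
    (by intros; simp) ?_ ?_ hI
  · have h := (h.all_elim K).imp_elim (by simpa using hK)
    refine h.ex_elim fun Δ σ H' _ J h => .ex_intro J ?_
    simp only [Fm.subst, v0, Tm.subst_var, Sub.lift, v1, cutF_subst, z_subst, Sub.cons,
      Tm.weaken_subst_lift, Tm.weaken_subst_cons, Tm.subst_id] at h ⊢
    exact .andR h.and_left h.and_right.and_right
  · refine fun H => .all_imp_intro fun Δ σ H' _ K hK => Der.ex_intro K ?_
    simp only [Fm.subst, v0, Tm.subst_var, Sub.cons, Sub.lift, v1, cutF_subst, z_subst,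
      Tm.weaken_subst_lift, Tm.weaken_subst_cons, Tm.subst_id] at hK ⊢
    exact .andR hK (.andR (monoF_refl hK) (cutF_z _))
  · refine fun H I _ h => .all_imp_intro fun Δ σ H' e K hK => ?_
    have h := ((e h).all_elim K).imp_elim (by simpa using hK)
    refine h.ex_elim fun Θ τ M e' J hJ => ?_
    have hK := e' hK
    simp only [Fm.subst, v0, Tm.subst_var, Sub.lift, v1, cutF_subst, z_subst, Tm.weaken_var,
      Tm.weaken_subst_lift, Sub.cons, Tm.weaken_subst_cons, Tm.subst_id, s_subst] at hJ hK ⊢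
    refine .ex_intro (s J) ?_
    simp only [Fm.subst, Tm.subst_var, Sub.cons, cutF_subst, z_subst, Tm.weaken_subst_cons,
      Tm.subst_id, s_subst]
    have hKJ := monoF_trans hJ.and_right.and_left (monoF_self_s hJ.and_left)
    exact .andR (.natRsucc hJ.and_left) (.andR hKJ
      (cutF_s (fun _ _ _ e A _ _ => coverF_cons_cons (e hK) A) hKJ hJ.and_right.and_right))

theorem Der.eq_intro (I : Tm Γ .nt) : PDer H (.atom (.eq I I)) :=
  Der.atom_intro ⟨[.nt], .eq v0 v0, .top⟩ (Sub.cons I Sub.empty) .topR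

theorem Der.eq_elim {I J : Tm Γ .nt} {C : Fm Γ} (h : PDer H (.atom (.eq I J)))
    (k : ∀ (Δ : Ctx) (σ : Sub Γ Δ) (H' : Multiset (Fm Δ)), PExt σ H H' →
      I.subst σ = J.subst σ → PDer H' (C.subst σ)) : PDer H C := by
  refine h.atom_elim fun Δ σ H' e c hc τ hA _ => ?_
  simp only [clausesFor, Atom.predicate, natClauses, List.mem_cons, List.not_mem_nil,
    or_false] at hc
  rcases hc with rfl | rfl | rfl | rfl | rfl | rfl | rfl
  case inl =>
    simp only [Atom.subst, Atom.eq.injEq] at hA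
    exact k Δ σ H' e (by rw [hA.1, hA.2])
  all_goals nomatch hA

theorem Der.nat_pred {I : Tm Γ .nt} (h : PDer H (.nat (s I))) : PDer H (.nat I) := by
  have h := Der.nat_induction (D := pcfDefinition) (H := H) (I := s I)
    (fun J => .all .nt (.imp (.atom (.eq J.weaken (s v0))) (.nat v0))) (by intros; simp) ?_ ?_ h
  · simpa using (h.all_elim I).imp_elim (by simpa using Der.eq_intro (s I))
  · refine fun H => .all_imp_intro fun Δ σ H' _ J hJ => Der.eq_elim hJ fun Θ τ K _ h => ?_
    exact (Tm.absurd_of_head_ne h (by simp)).elim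
  · refine fun H I hI _ => .all_imp_intro fun Δ σ H' e J hJ => Der.eq_elim hJ fun Θ τ K e' h => ?_
    have hI := e' (e hI)
    simp only [Tm.weaken_subst_cons, s_subst, v0, Tm.subst_var, Sub.cons, s_inj, Fm.subst] at h hI ⊢
    rwa [← h]

theorem seqF_mono_s {I : Tm Γ .nt} {L : Tm Γ .lst} {B : Tm Γ .prp} (hI : PDer H (.nat (s I)))
    (h : PDer H (seqF I L B)) : PDer H (seqF (s I) L B) :=
  monoF_elim (monoF_self_s hI.nat_pred) h

theorem seqF_amp_elim {I : Tm Γ .nt} {L : Tm Γ .lst} {B C : Tm Γ .prp} (hI : PDer H (.nat I))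
    (h : PDer H (seqF I L (amp B C))) : PDer H (seqF I L B) ∧ PDer H (seqF I L C) := by
  have h' : PDer H (.and (seqF I L B) (seqF I L C)) := by
    refine h.seq_elim fun Δ σ H' e h => ?_
    rw [amp_subst] at h
    obtain ⟨J, hJ, h₁, h₂⟩ := h.amp_inv
    have hI := e hI
    simp only [Fm.subst, Atom.subst, hJ] at hI ⊢
    exact .andR (seqF_mono_s hI h₁) (seqF_mono_s hI h₂)
  exact ⟨h'.and_left, h'.and_right⟩

theorem seqF_oimp_elim {I : Tm Γ .nt} {L : Tm Γ .lst} {A : Tm Γ .atm} {B : Tm Γ .prp}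
    (hI : PDer H (.nat I)) (h : PDer H (seqF I L (oimp A B))) : PDer H (seqF I (cons A L) B) := by
  refine h.seq_elim fun Δ σ H' e h => ?_
  rw [oimp_subst] at h
  obtain ⟨J, hJ, h₁⟩ := h.oimp_inv
  have hI := e hI
  simp only [Fm.subst, Atom.subst, cons_subst, hJ] at hI ⊢
  exact seqF_mono_s hI h₁

theorem seqF_oall_elim {I : Tm Γ .nt} {L : Tm Γ .lst} {B : Tm Γ (.arr .i .prp)}
    (hI : PDer H (.nat I)) (h : PDer H (seqF I L (oall B))) (N : Tm Γ .i) :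
    PDer H (seqF I L (B.app N)) := by
  refine h.seq_elim fun Δ σ H' e h => ?_
  rw [oall_subst] at h
  obtain ⟨J, hJ, h₁⟩ := h.oall_inv
  have hI := e hI
  simp only [Fm.subst, Atom.subst, Tm.subst_app, hJ] at hI ⊢
  exact seqF_mono_s hI (h₁ _)

/-! ### Provability -/

theorem prvFrom_intro {I : Tm Γ .nt} {L : Tm Γ .lst} {B : Tm Γ .prp} (hI : PDer H (.nat I))
    (h : PDer H (seqF I L B)) : PDer H (prvFrom L B) :=
  .ex_intro I (by simpa using .andR hI h)

theorem prvFrom_elim {L : Tm Γ .lst} {B : Tm Γ .prp} {C : Fm Γ} (h : PDer H (prvFrom L B))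
    (k : ∀ (Δ : Ctx) (σ : Sub Γ Δ) (H' : Multiset (Fm Δ)), PExt σ H H' → ∀ I : Tm Δ .nt,
      PDer H' (.nat I) → PDer H' (seqF I (L.subst σ) (B.subst σ)) → PDer H' (C.subst σ)) :
    PDer H C := by
  refine Der.ex_elim h fun Δ σ H' e I h => ?_
  simp at h
  exact k Δ σ H' e I h.and_left h.and_right

theorem prv_tt : PDer H (prv tt) := prvFrom_intro .natRzero (.seq_intro .tt)

theorem prv_atom_intro {A : Tm Γ .atm} {G : Tm Γ .prp} (hP : Prog A G) (h : PDer H (prv G)) :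
    PDer H (prv (atom A)) := by
  refine prvFrom_elim h fun Δ σ H' _ I hI h => ?_
  rw [prv_subst, atom_subst]
  exact prvFrom_intro (.natRsucc hI) (.seq_intro (.prog (hP.subst σ) h))

theorem prv_amp_intro {B C : Tm Γ .prp} (hB : PDer H (prv B)) (hC : PDer H (prv C)) :
    PDer H (prv (amp B C)) := by
  refine prvFrom_elim hB fun Δ σ H' e I hI hB => prvFrom_elim
    (by simpa using e hC : PDer H' (prv (C.subst σ))) fun Θ τ K e' J hJ hC => ?_
  have hI := e' hI
  have hB := e' hB
  refine (exists_common_height hI hJ).ex_elim fun Ξ ρ M e'' N hN => ?_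
  have hB := e'' hB
  have hC := e'' hC
  simp only [Fm.subst, Atom.subst, nil_subst, v0, Tm.subst_var, Sub.cons, cutF_subst, z_subst,
    Tm.weaken_subst_cons, prv_subst, amp_subst] at hB hC hN ⊢
  exact prvFrom_intro (.natRsucc hN.and_left) (.seq_intro
    (.amp (monoF_elim hN.and_right.and_left hB) (monoF_elim hN.and_right.and_right hC)))

theorem prv_amp_elim {B C : Tm Γ .prp} (h : PDer H (prv (amp B C))) :
    PDer H (prv B) ∧ PDer H (prv C) := by
  constructor
  all_goals
    refine prvFrom_elim h fun Δ σ H' _ I hI h => ?_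
    rw [amp_subst] at h
    rw [prv_subst]
  · exact prvFrom_intro hI (seqF_amp_elim hI h).1
  · exact prvFrom_intro hI (seqF_amp_elim hI h).2

theorem Der.not_element_nil {X : Tm Γ .atm} {C : Fm Γ} (h : PDer H (elementF X nil)) :
    PDer H C :=
  h.element_elim (fun _ _ _ _ _ h => (Tm.absurd_of_head_ne h (by simp)).elim)
    (fun _ _ _ _ _ _ h => (Tm.absurd_of_head_ne h (by simp)).elim)

theorem seqF_nil_elim {I : Tm Γ .nt} {A : Tm Γ .atm} {C : Fm Γ}
    (h : PDer H (seqF I nil (atom A)))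
    (k : ∀ (Δ : Ctx) (σ : Sub Γ Δ) (H' : Multiset (Fm Δ)), PExt σ H H' →
      ∀ (J : Tm Δ .nt) (G : Tm Δ .prp), I.subst σ = s J → Prog (A.subst σ) G →
        PDer H' (seqF J nil G) → PDer H' (C.subst σ)) : PDer H C := by
  refine h.seq_elim fun Δ σ H' e h => ?_
  rw [atom_subst] at h
  rcases h.atom_inv with h | ⟨J, G, hJ, hP, h⟩
  · exact Der.not_element_nil h
  · exact k Δ σ H' e J G hJ hP h

theorem prv_atom_elim {A : Tm Γ .atm} {C : Fm Γ} (h : PDer H (prv (atom A)))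
    (k : ∀ (Δ : Ctx) (σ : Sub Γ Δ) (H' : Multiset (Fm Δ)), PExt σ H H' →
      ∀ G : Tm Δ .prp, Prog (A.subst σ) G → PDer H' (prv G) → PDer H' (C.subst σ)) :
    PDer H C := by
  refine prvFrom_elim h fun Δ σ H' e I hI h => ?_
  rw [atom_subst, nil_subst] at h
  refine seqF_nil_elim h fun Θ τ K e' J G hJ hP h => ?_
  have hI := e' hI
  rw [Fm.subst, hJ] at hI
  rw [Fm.subst_subst]
  refine k Θ _ K (e.trans e') G ?_ (prvFrom_intro hI.nat_pred h)
  rwa [← Tm.subst_subst]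

theorem prv_cut {A : Tm Γ .atm} {B : Tm Γ .prp} (hA : PDer H (prv (atom A)))
    (hB : PDer H (prvFrom (cons A nil) B)) : PDer H (prv B) := by
  refine prvFrom_elim hA fun Δ σ H' e K hK hA => prvFrom_elim
    (by simpa using e hB : PDer H' (prvFrom (cons (A.subst σ) nil) (B.subst σ)))
    fun Θ τ M e' I hI hB => ?_
  have hA := e' hA
  have hK := e' hK
  refine (exists_cut_height hK hI).ex_elim fun Ξ ρ N e'' J hJ => ?_
  have hB := e'' hB
  have hA := e'' hA
  simp only [Fm.subst, Atom.subst, cons_subst, nil_subst, atom_subst, v0, Tm.subst_var, Sub.cons,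
    cutF_subst, Tm.weaken_subst_cons, prv_subst] at hB hA hJ ⊢
  exact prvFrom_intro hJ.and_left (cutF_elim hJ.and_right
    (coverF_cons hA (coverF_intro fun _ _ _ _ _ hX => .not_element_nil hX)) hB)

end

/-! ### Instances of the PCF clauses -/

section

variable {Γ : Ctx}

/-- The goal `⋀ n (n : T ⇒ R n : U)`. -/
def bodyGoal (T : Tm Γ .i) (R : Tm Γ (.arr .i .i)) (U : Tm Γ .i) : Tm Γ .prp :=
  oall (.lam (oimp (typeof v0 T.weaken) (atom (typeof (R.weaken.app v0) U.weaken))))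

@[simp]
theorem bodyGoal_subst {Δ : Ctx} (σ : Sub Γ Δ) (T U : Tm Γ .i) (R : Tm Γ (.arr .i .i)) :
    (bodyGoal T R U).subst σ = bodyGoal (T.subst σ) (R.subst σ) (U.subst σ) := by
  simp [bodyGoal]

theorem Prog.of_mem {Δ : Ctx} {A : Tm Δ .atm} {G : Tm Δ .prp}
    (hc : progClause Δ A G ∈ progClauses) (τ : Sub Δ Γ) : Prog (A.subst τ) (G.subst τ) :=
  ⟨_, hc, τ, rfl⟩

theorem Prog.of_typingClauses {Δ : Ctx} {A : Tm Δ .atm} {G : Tm Δ .prp} {A' : Tm Γ .atm}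
    {G' : Tm Γ .prp} (n : ℕ) (τ : Sub Δ Γ)
    (hn : typingClauses[n]? = some (progClause Δ A G) := by rfl)
    (hA : A.subst τ = A' := by simp) (hG : G.subst τ = G' := by simp [bodyGoal]) : Prog A' G' :=
  hA ▸ hG ▸ .of_mem (List.mem_append_left _ (List.mem_append_left _ (List.mem_of_getElem? hn))) τ

theorem Prog.of_natsemClauses {Δ : Ctx} {A : Tm Δ .atm} {G : Tm Δ .prp} {A' : Tm Γ .atm}
    {G' : Tm Γ .prp} (n : ℕ) (τ : Sub Δ Γ)
    (hn : natsemClauses[n]? = some (progClause Δ A G) := by rfl)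
    (hA : A.subst τ = A' := by simp) (hG : G.subst τ = G' := by simp [bodyGoal]) : Prog A' G' :=
  hA ▸ hG ▸ .of_mem (List.mem_append_left _ (List.mem_append_right _ (List.mem_of_getElem? hn))) τ

theorem Prog.of_transClauses {Δ : Ctx} {A : Tm Δ .atm} {G : Tm Δ .prp} {A' : Tm Γ .atm}
    {G' : Tm Γ .prp} (n : ℕ) (τ : Sub Δ Γ)
    (hn : transClauses[n]? = some (progClause Δ A G) := by rfl)
    (hA : A.subst τ = A' := by simp) (hG : G.subst τ = G' := by simp [bodyGoal]) : Prog A' G' :=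
  hA ▸ hG ▸ .of_mem (List.mem_append_right _ (List.mem_of_getElem? hn)) τ

/-- Instances of the typing clauses. -/
inductive TypeofProg : Tm Γ .i → Tm Γ .i → Tm Γ .prp → Prop
  | zero : TypeofProg zero num tt
  | tru : TypeofProg tru bool tt
  | fls : TypeofProg fls bool tt
  | succ (M : Tm Γ .i) : TypeofProg (succ M) num (atom (typeof M num))
  | pred (M : Tm Γ .i) : TypeofProg (pred M) num (atom (typeof M num))
  | isZero (M : Tm Γ .i) : TypeofProg (isZero M) bool (atom (typeof M num))
  | cond (M N₁ N₂ T : Tm Γ .i) : TypeofProg (cond M N₁ N₂) T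
      (amp (atom (typeof M bool)) (amp (atom (typeof N₁ T)) (atom (typeof N₂ T))))
  | abs (T : Tm Γ .i) (R : Tm Γ (.arr .i .i)) (U : Tm Γ .i) :
      TypeofProg (abs T R) (arrow T U) (bodyGoal T R U)
  | app (M N T U : Tm Γ .i) : TypeofProg (app M N) T
      (amp (atom (typeof M (arrow U T))) (atom (typeof N U)))
  | fix (T : Tm Γ .i) (R : Tm Γ (.arr .i .i)) : TypeofProg (fix T R) T (bodyGoal T R T)

/-- Instances of the clauses of the natural semantics. -/
inductive NatsemProg : Tm Γ .i → Tm Γ .i → Tm Γ .prp → Prop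
  | zero : NatsemProg zero zero tt
  | tru : NatsemProg tru tru tt
  | fls : NatsemProg fls fls tt
  | succ (M V : Tm Γ .i) : NatsemProg (succ M) (succ V) (atom (natsem M V))
  | predZero (M : Tm Γ .i) : NatsemProg (pred M) FOLDN.zero (atom (natsem M FOLDN.zero))
  | predSucc (M V : Tm Γ .i) : NatsemProg (pred M) V (atom (natsem M (FOLDN.succ V)))
  | isZeroZero (M : Tm Γ .i) : NatsemProg (isZero M) FOLDN.tru (atom (natsem M FOLDN.zero))
  | isZeroSucc (M V : Tm Γ .i) :
      NatsemProg (isZero M) FOLDN.fls (atom (natsem M (FOLDN.succ V)))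
  | condTru (M N₁ N₂ V : Tm Γ .i) : NatsemProg (cond M N₁ N₂) V
      (amp (atom (natsem M FOLDN.tru)) (atom (natsem N₁ V)))
  | condFls (M N₁ N₂ V : Tm Γ .i) : NatsemProg (cond M N₁ N₂) V
      (amp (atom (natsem M FOLDN.fls)) (atom (natsem N₂ V)))
  | abs (T : Tm Γ .i) (R : Tm Γ (.arr .i .i)) : NatsemProg (abs T R) (abs T R) tt
  | app (M N V T : Tm Γ .i) (R : Tm Γ (.arr .i .i)) : NatsemProg (app M N) V
      (amp (atom (natsem M (FOLDN.abs T R))) (atom (natsem (R.app N) V)))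
  | fix (T : Tm Γ .i) (R : Tm Γ (.arr .i .i)) (V : Tm Γ .i) :
      NatsemProg (fix T R) V (atom (natsem (R.app (fix T R)) V))

/-- Instances of the clauses for one step of the transition semantics. -/
inductive TransoneProg : Tm Γ .i → Tm Γ .i → Tm Γ .prp → Prop
  | succ (M M' : Tm Γ .i) : TransoneProg (succ M) (succ M') (atom (transone M M'))
  | predZero : TransoneProg (pred zero) zero tt
  | predSucc (V : Tm Γ .i) : TransoneProg (pred (FOLDN.succ V)) V (atom (value V))
  | pred (M M' : Tm Γ .i) : TransoneProg (pred M) (pred M') (atom (transone M M'))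
  | isZeroZero : TransoneProg (isZero zero) tru tt
  | isZeroSucc (V : Tm Γ .i) : TransoneProg (isZero (FOLDN.succ V)) fls (atom (value V))
  | isZero (M M' : Tm Γ .i) : TransoneProg (isZero M) (isZero M') (atom (transone M M'))
  | condTru (M N : Tm Γ .i) : TransoneProg (cond tru M N) M tt
  | condFls (M N : Tm Γ .i) : TransoneProg (cond fls M N) N tt
  | cond (M N₁ N₂ M' : Tm Γ .i) :
      TransoneProg (cond M N₁ N₂) (cond M' N₁ N₂) (atom (transone M M'))
  | appAbs (T : Tm Γ .i) (R : Tm Γ (.arr .i .i)) (N : Tm Γ .i) :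
      TransoneProg (app (abs T R) N) (R.app N) tt
  | app (M N M' : Tm Γ .i) : TransoneProg (app M N) (app M' N) (atom (transone M M'))
  | fix (T : Tm Γ .i) (R : Tm Γ (.arr .i .i)) : TransoneProg (fix T R) (R.app (fix T R)) tt

/-- Instances of the clauses for finitely many steps of the transition semantics. -/
inductive TranssemProg : Tm Γ .i → Tm Γ .i → Tm Γ .prp → Prop
  | refl (M : Tm Γ .i) : TranssemProg M M tt
  | step (M N M' : Tm Γ .i) : TranssemProg M N (amp (atom (transone M M')) (atom (transsem M' N)))

/-- Instances of the clauses for values. -/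
inductive ValueProg : Tm Γ .i → Tm Γ .prp → Prop
  | zero : ValueProg zero tt
  | tru : ValueProg tru tt
  | fls : ValueProg fls tt
  | succ (V : Tm Γ .i) : ValueProg (succ V) (atom (value V))
  | abs (T : Tm Γ .i) (R : Tm Γ (.arr .i .i)) : ValueProg (abs T R) tt

/-- Instances of all the clauses for `prog`. -/
inductive PcfProg : Tm Γ .atm → Tm Γ .prp → Prop
  | typeof {M T : Tm Γ .i} {G : Tm Γ .prp} (h : TypeofProg M T G) : PcfProg (typeof M T) G
  | natsem {M V : Tm Γ .i} {G : Tm Γ .prp} (h : NatsemProg M V G) : PcfProg (natsem M V) G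
  | transone {M N : Tm Γ .i} {G : Tm Γ .prp} (h : TransoneProg M N G) : PcfProg (transone M N) G
  | transsem {M N : Tm Γ .i} {G : Tm Γ .prp} (h : TranssemProg M N G) : PcfProg (transsem M N) G
  | value {V : Tm Γ .i} {G : Tm Γ .prp} (h : ValueProg V G) : PcfProg (value V) G

theorem Prog.pcfProg {A : Tm Γ .atm} {G : Tm Γ .prp} (h : Prog A G) : PcfProg A G := by
  obtain ⟨c, hc, τ, h⟩ := h
  simp only [progClauses, typingClauses, natsemClauses, transClauses, List.mem_append,
    List.mem_cons, List.not_mem_nil, or_false, or_assoc] at hc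
  repeat' rcases hc with hc | hc
  all_goals
    dsimp only [progClause] at τ h
    obtain ⟨rfl, rfl⟩ := Atom.prog.inj h
    simp only [v0, v1, v2, v3, v4, Sub.lift, Tm.subst_var, Tm.subst_app, Tm.subst_lam,
      atom_subst, amp_subst, oimp_subst, oall_subst, tt_subst, num_subst, bool_subst, arrow_subst,
      zero_subst, tru_subst, fls_subst, succ_subst, pred_subst, isZero_subst, cond_subst,
      abs_subst, app_subst, fix_subst, typeof_subst, natsem_subst, transone_subst, transsem_subst,
      value_subst]
    constructor
    constructor

theorem Prog.typeof {M T : Tm Γ .i} {G : Tm Γ .prp} (h : Prog (typeof M T) G) :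
    TypeofProg M T G := by
  generalize hA : FOLDN.typeof M T = A at h
  cases h.pcfProg with
  | typeof h =>
    obtain ⟨rfl, rfl⟩ := typeof_inj.1 hA
    exact h
  | _ => cases Tm.absurd_of_head_ne hA (by simp)

theorem Prog.natsem {M V : Tm Γ .i} {G : Tm Γ .prp} (h : Prog (natsem M V) G) :
    NatsemProg M V G := by
  generalize hA : FOLDN.natsem M V = A at h
  cases h.pcfProg with
  | natsem h =>
    obtain ⟨rfl, rfl⟩ := natsem_inj.1 hA
    exact h
  | _ => cases Tm.absurd_of_head_ne hA (by simp)

theorem Prog.transone {M N : Tm Γ .i} {G : Tm Γ .prp} (h : Prog (transone M N) G) :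
    TransoneProg M N G := by
  generalize hA : FOLDN.transone M N = A at h
  cases h.pcfProg with
  | transone h =>
    obtain ⟨rfl, rfl⟩ := transone_inj.1 hA
    exact h
  | _ => cases Tm.absurd_of_head_ne hA (by simp)

theorem Prog.transsem {M N : Tm Γ .i} {G : Tm Γ .prp} (h : Prog (transsem M N) G) :
    TranssemProg M N G := by
  generalize hA : FOLDN.transsem M N = A at h
  cases h.pcfProg with
  | transsem h =>
    obtain ⟨rfl, rfl⟩ := transsem_inj.1 hA
    exact h
  | _ => cases Tm.absurd_of_head_ne hA (by simp)

theorem Prog.value {V : Tm Γ .i} {G : Tm Γ .prp} (h : Prog (value V) G) :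
    ValueProg V G := by
  generalize hA : FOLDN.value V = A at h
  cases h.pcfProg with
  | value h =>
    obtain rfl := value_inj.1 hA
    exact h
  | _ => cases Tm.absurd_of_head_ne hA (by simp)

theorem TypeofProg.prog {M T : Tm Γ .i} {G : Tm Γ .prp} (h : TypeofProg M T G) :
    Prog (FOLDN.typeof M T) G := by
  cases h with
  | zero => exact .of_typingClauses 0 .empty
  | tru => exact .of_typingClauses 1 .empty
  | fls => exact .of_typingClauses 2 .empty
  | succ M => exact .of_typingClauses 3 (.cons M .empty)
  | pred M => exact .of_typingClauses 4 (.cons M .empty)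
  | isZero M => exact .of_typingClauses 5 (.cons M .empty)
  | cond M N₁ N₂ T =>
    exact .of_typingClauses 6 (.cons M (.cons N₁ (.cons N₂ (.cons T .empty))))
  | abs T R U => exact .of_typingClauses 7 (.cons T (.cons R (.cons U .empty)))
  | app M N T U =>
    exact .of_typingClauses 8 (.cons M (.cons N (.cons T (.cons U .empty))))
  | fix T R => exact .of_typingClauses 9 (.cons T (.cons R .empty))

theorem NatsemProg.prog {M V : Tm Γ .i} {G : Tm Γ .prp} (h : NatsemProg M V G) :
    Prog (FOLDN.natsem M V) G := by
  cases h with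
  | zero => exact .of_natsemClauses 0 .empty
  | tru => exact .of_natsemClauses 1 .empty
  | fls => exact .of_natsemClauses 2 .empty
  | succ M V => exact .of_natsemClauses 3 (.cons M (.cons V .empty))
  | predZero M => exact .of_natsemClauses 4 (.cons M .empty)
  | predSucc M V => exact .of_natsemClauses 5 (.cons M (.cons V .empty))
  | isZeroZero M => exact .of_natsemClauses 6 (.cons M .empty)
  | isZeroSucc M V => exact .of_natsemClauses 7 (.cons M (.cons V .empty))
  | condTru M N₁ N₂ V =>
    exact .of_natsemClauses 8 (.cons M (.cons N₁ (.cons N₂ (.cons V .empty))))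
  | condFls M N₁ N₂ V =>
    exact .of_natsemClauses 9 (.cons M (.cons N₁ (.cons N₂ (.cons V .empty))))
  | abs T R => exact .of_natsemClauses 10 (.cons T (.cons R .empty))
  | app M N V T R =>
    exact .of_natsemClauses 11 (.cons M (.cons N (.cons V (.cons T (.cons R .empty)))))
  | fix T R V => exact .of_natsemClauses 12 (.cons T (.cons R (.cons V .empty)))

theorem TransoneProg.prog {M N : Tm Γ .i} {G : Tm Γ .prp} (h : TransoneProg M N G) :
    Prog (FOLDN.transone M N) G := by
  cases h with
  | succ M M' => exact .of_transClauses 0 (.cons M (.cons M' .empty))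
  | predZero => exact .of_transClauses 1 .empty
  | predSucc V => exact .of_transClauses 2 (.cons N .empty)
  | pred M M' => exact .of_transClauses 3 (.cons M (.cons M' .empty))
  | isZeroZero => exact .of_transClauses 4 .empty
  | isZeroSucc V => exact .of_transClauses 5 (.cons V .empty)
  | isZero M M' => exact .of_transClauses 6 (.cons M (.cons M' .empty))
  | condTru M N' => exact .of_transClauses 7 (.cons N (.cons N' .empty))
  | condFls M N' => exact .of_transClauses 8 (.cons M (.cons N .empty))
  | cond M N₁ N₂ M' =>
    exact .of_transClauses 9 (.cons M (.cons N₁ (.cons N₂ (.cons M' .empty))))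
  | appAbs T R N => exact .of_transClauses 10 (.cons T (.cons R (.cons N .empty)))
  | app M N M' => exact .of_transClauses 11 (.cons M (.cons N (.cons M' .empty)))
  | fix T R => exact .of_transClauses 12 (.cons T (.cons R .empty))

theorem TranssemProg.prog {M N : Tm Γ .i} {G : Tm Γ .prp} (h : TranssemProg M N G) :
    Prog (FOLDN.transsem M N) G := by
  cases h with
  | refl => exact .of_transClauses 13 (.cons M .empty)
  | step _ M' => exact .of_transClauses 14 (.cons M (.cons N (.cons M' .empty)))

theorem ValueProg.prog {V : Tm Γ .i} {G : Tm Γ .prp} (h : ValueProg V G) :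
    Prog (FOLDN.value V) G := by
  cases h with
  | zero => exact .of_transClauses 15 .empty
  | tru => exact .of_transClauses 16 .empty
  | fls => exact .of_transClauses 17 .empty
  | succ V => exact .of_transClauses 18 (.cons V .empty)
  | abs T R => exact .of_transClauses 19 (.cons T (.cons R .empty))

end

/-! ### Induction on derivations of the object logic -/

/-- Families of object-level atoms with two parameters. -/
abbrev AtmFam : Type := ∀ Γ : Ctx, Tm Γ .i → Tm Γ .i → Tm Γ .atm

/-- Families of formulas with three parameters. -/
abbrev FmFam (a : Ty) : Type := ∀ Γ : Ctx, Tm Γ .i → Tm Γ .i → Tm Γ a → Fm Γ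

/-- The family commutes with substitution. -/
abbrev AtmFam.Natural (A : AtmFam) : Prop :=
  ∀ (Γ Δ : Ctx) (σ : Sub Γ Δ) (m v : Tm Γ .i), (A Γ m v).subst σ = A Δ (m.subst σ) (v.subst σ)

/-- The family commutes with substitution. -/
abbrev FmFam.Natural {a : Ty} (P : FmFam a) : Prop :=
  ∀ (Γ Δ : Ctx) (σ : Sub Γ Δ) (m v : Tm Γ .i) (u : Tm Γ a),
    (P Γ m v u).subst σ = P Δ (m.subst σ) (v.subst σ) (u.subst σ)

section

variable {a : Ty} {A : AtmFam} {P C : FmFam a} {Γ Δ : Ctx} {H : Multiset (Fm Γ)}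

/-- `P m v u ⊃ C m v u` for all derivations of height `I` of the atom `A m v`. -/
noncomputable def indF (A : AtmFam) (P C : FmFam a) (I : Tm Γ .nt) : Fm Γ :=
  .all .i (.all .i (.all a (.imp
    (.and (seqF I.weaken.weaken.weaken nil (atom (A _ v2 v1))) (P _ v2 v1 v0)) (C _ v2 v1 v0))))

/-- The goal `G` has a derivation of a height for which the induction hypothesis holds. -/
def SubDer (A : AtmFam) (P C : FmFam a) (H : Multiset (Fm Γ)) (G : Tm Γ .prp) : Prop :=
  ∃ I : Tm Γ .nt, PDer H (.nat I) ∧ PDer H (indF A P C I) ∧ PDer H (seqF I nil G)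

theorem SubDer.prv {G : Tm Γ .prp} (h : SubDer A P C H G) : PDer H (prv G) :=
  have ⟨_, hI, _, h⟩ := h
  prvFrom_intro hI h

theorem SubDer.amp {B B' : Tm Γ .prp} (h : SubDer A P C H (amp B B')) :
    SubDer A P C H B ∧ SubDer A P C H B' := by
  obtain ⟨I, hI, hi, h⟩ := h
  have h := seqF_amp_elim hI h
  exact ⟨⟨I, hI, hi, h.1⟩, ⟨I, hI, hi, h.2⟩⟩

theorem indF_subst (hA : A.Natural) (hP : P.Natural) (hC : C.Natural) (σ : Sub Γ Δ)
    (I : Tm Γ .nt) : (indF A P C I).subst σ = indF A P C (I.subst σ) := by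
  simp [indF, hA, hP, hC]

theorem indF_elim (hA : A.Natural) (hP : P.Natural) (hC : C.Natural) {I : Tm Γ .nt}
    (h : PDer H (indF A P C I)) {m v : Tm Γ .i} {u : Tm Γ a}
    (hs : PDer H (seqF I nil (atom (A _ m v)))) (hm : PDer H (P _ m v u)) :
    PDer H (C _ m v u) := by
  have h := (h.all_elim m).all_elim v
  simpa [hA, hP, hC] using (h.all_elim u).imp_elim (by simpa [hA, hP, hC] using .andR hs hm)

theorem SubDer.ext (hA : A.Natural) (hP : P.Natural) (hC : C.Natural) {G : Tm Γ .prp}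
    (h : SubDer A P C H G) {σ : Sub Γ Δ} {H' : Multiset (Fm Δ)} (e : PExt σ H H') :
    SubDer A P C H' (G.subst σ) := by
  obtain ⟨I, hI, hi, h⟩ := h
  exact ⟨_, e hI, indF_subst hA hP hC σ I ▸ e hi, e h⟩

theorem SubDer.induction_hypothesis (hA : A.Natural) (hP : P.Natural) (hC : C.Natural)
    {m v : Tm Γ .i} {u : Tm Γ a} (h : SubDer A P C H (atom (A _ m v)))
    (hm : PDer H (P _ m v u)) : PDer H (C _ m v u) :=
  have ⟨_, _, hi, hs⟩ := h
  indF_elim hA hP hC hi hs hm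

theorem indF_of_nat (hA : A.Natural) (hP : P.Natural) (hC : C.Natural)
    (step : ∀ (Γ : Ctx) (H : Multiset (Fm Γ)) (m v : Tm Γ .i) (u : Tm Γ a) (G : Tm Γ .prp),
      Prog (A _ m v) G → PDer H (P _ m v u) → SubDer A P C H G → PDer H (C _ m v u))
    {I : Tm Γ .nt} (hI : PDer H (.nat I)) : PDer H (indF A P C I) := by
  refine Der.nat_induction (fun I => indF A P C I) (indF_subst hA hP hC)
    (fun H => ?_) (fun H I hI hi => ?_) hI
  · refine .all₃_imp_intro fun Δ σ H' _ m v u h => ?_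
    have hs := Der.and_left h
    simp only [Fm.subst, Atom.subst, Tm.weaken_subst_cons, z_subst, nil_subst, v2, v1, atom_subst,
      hA, Tm.subst_var, Sub.cons] at hs
    refine seqF_nil_elim hs fun Θ τ K _ J G hJ _ _ => ?_
    exact (Tm.absurd_of_head_ne hJ (by simp)).elim
  · refine .all₃_imp_intro fun Δ σ H' e m v u h => ?_
    have hs := Der.and_left h
    have hm := Der.and_right h
    simp only [Fm.subst, Atom.subst, Tm.weaken_subst_cons, s_subst, nil_subst, v2, v1, atom_subst,
      hA, Tm.subst_var, Sub.cons, v0, hP, hC] at hs hm ⊢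
    refine seqF_nil_elim hs fun Θ τ K e' J G hJ hG hs => ?_
    have hI := e' (e hI)
    have hi := e' (e hi)
    have hm := e' hm
    simp only [hA, hP, hC, indF_subst hA hP hC, Fm.subst,
      s_subst, s_inj] at hI hi hm hJ hG ⊢
    subst hJ
    exact step _ _ _ _ _ _ hG hm ⟨_, hI, hi, hs⟩

theorem prv_induction
    (step : ∀ (Γ : Ctx) (H : Multiset (Fm Γ)) (m v : Tm Γ .i) (u : Tm Γ a) (G : Tm Γ .prp),
      Prog (A _ m v) G → PDer H (P _ m v u) → SubDer A P C H G →
      (∀ {m v : Tm Γ .i} {u : Tm Γ a}, SubDer A P C H (atom (A _ m v)) → PDer H (P _ m v u) →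
        PDer H (C _ m v u)) → PDer H (C _ m v u))
    {m v : Tm Γ .i} {u : Tm Γ a} (h : PDer H (prv (atom (A _ m v)))) (hm : PDer H (P _ m v u))
    (hA : A.Natural := by intro _ _ _ _ _; simp) (hP : P.Natural := by intro _ _ _ _ _ _; simp)
    (hC : C.Natural := by intro _ _ _ _ _ _; simp) : PDer H (C _ m v u) := by
  refine prvFrom_elim h fun Δ σ H' e I hI h => ?_
  have hm := e hm
  rw [nil_subst, atom_subst, hA] at h
  rw [hP] at hm
  rw [hC]
  refine indF_elim hA hP hC (indF_of_nat hA hP hC (fun Γ H m v u G hG hm hs => ?_) hI) h hm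
  exact step Γ H m v u G hG hm hs (SubDer.induction_hypothesis hA hP hC)

theorem prv_induction₂ {B : ∀ Γ : Ctx, Tm Γ .i → Tm Γ .i → Tm Γ a → Tm Γ .atm}
    (step : ∀ (Γ : Ctx) (H : Multiset (Fm Γ)) (m v : Tm Γ .i) (u : Tm Γ a) (G G' : Tm Γ .prp),
      Prog (A _ m v) G → Prog (B _ m v u) G' → PDer H (P _ m v u) → PDer H (prv G') →
      SubDer A P C H G →
      (∀ {m v : Tm Γ .i} {u : Tm Γ a}, SubDer A P C H (atom (A _ m v)) → PDer H (P _ m v u) →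
        PDer H (C _ m v u)) → PDer H (C _ m v u))
    {m v : Tm Γ .i} {u : Tm Γ a} (h : PDer H (prv (atom (A _ m v)))) (hm : PDer H (P _ m v u))
    (hPB : ∀ (Γ : Ctx) (H : Multiset (Fm Γ)) (m v : Tm Γ .i) (u : Tm Γ a), PDer H (P _ m v u) →
      PDer H (prv (atom (B _ m v u))) := by exact fun _ _ _ _ _ h => h)
    (hA : A.Natural := by intro _ _ _ _ _; simp) (hP : P.Natural := by intro _ _ _ _ _ _; simp)
    (hC : C.Natural := by intro _ _ _ _ _ _; simp)
    (hB : ∀ (Γ Δ : Ctx) (σ : Sub Γ Δ) (m v : Tm Γ .i) (u : Tm Γ a),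
      (B _ m v u).subst σ = B _ (m.subst σ) (v.subst σ) (u.subst σ) := by intros; simp) :
    PDer H (C _ m v u) := by
  refine prv_induction (fun Γ H m v u G hG hm hs _ => ?_) h hm hA hP hC
  refine prv_atom_elim (hPB _ _ _ _ _ hm) fun Δ σ H' e G' hG' h' => ?_
  have hm := e hm
  rw [hB] at hG'
  rw [hP] at hm
  rw [hC]
  exact step _ _ _ _ _ _ _ (hA _ _ σ m v ▸ hG.subst σ) hG' hm h' (hs.ext hA hP hC e)
    (SubDer.induction_hypothesis hA hP hC)

end

section

variable {Γ : Ctx} {H : Multiset (Fm Γ)}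

/-- The formula `▷ A`. -/
abbrev prvA (A : Tm Γ .atm) : Fm Γ := prv (atom A)

/-- The formula `M ≡ N`. -/
abbrev sameF (M N : Tm Γ .i) : Fm Γ := .atom (.same M N)

/-! ### Equality -/

theorem Der.same_rewrite {M N : Tm Γ .i} (h : PDer H (sameF M N)) (F : Fm (.i :: Γ))
    (h' : PDer H (F.subst (Sub.cons N Sub.id))) : PDer H (F.subst (Sub.cons M Sub.id)) := by
  refine h.same_elim fun Δ σ H' e heq => ?_
  have h' := e h'
  rwa [Fm.subst_subst, Sub.cons_comp, ← heq, ← Sub.cons_comp, ← Fm.subst_subst] at h'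

theorem Der.same_congr {M N : Tm Γ .i} (h : PDer H (sameF M N)) (F : Tm (.i :: Γ) .i) :
    PDer H (sameF (F.subst (Sub.cons M Sub.id)) (F.subst (Sub.cons N Sub.id))) := by
  refine h.same_elim fun Δ σ H' _ heq => ?_
  simp only [Fm.subst, Atom.subst, Tm.subst_subst, Sub.cons_comp, heq]
  exact .same_intro _

theorem Der.same_absurd {M N : Tm Γ .i} {C : Fm Γ} (h : PDer H (sameF M N))
    (hne : ∀ (Δ : Ctx) (σ : Sub Γ Δ), (M.subst σ).head ≠ (N.subst σ).head) : PDer H C :=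
  h.same_elim fun _ σ _ _ heq => (Tm.absurd_of_head_ne heq (hne _ σ)).elim

theorem Der.same_succ_inv {M N : Tm Γ .i} (h : PDer H (sameF (succ M) (succ N))) :
    PDer H (sameF M N) := by
  refine h.same_elim fun Δ σ H' _ heq => ?_
  rw [succ_subst, succ_subst, succ_inj] at heq
  rw [Fm.subst, Atom.subst, heq]
  exact .same_intro _

theorem Der.same_arrow_inv {T T' U U' : Tm Γ .i} (h : PDer H (sameF (arrow T U) (arrow T' U'))) :
    PDer H (sameF U U') := by
  refine h.same_elim fun Δ σ H' _ heq => ?_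
  rw [arrow_subst, arrow_subst, arrow_inj] at heq
  rw [Fm.subst, Atom.subst, heq.2]
  exact .same_intro _

theorem Der.same_abs_rewrite {T T' : Tm Γ .i} {R R' : Tm Γ (.arr .i .i)}
    (h : PDer H (sameF (abs T R) (abs T' R'))) (F : Fm (.arr .i .i :: Γ))
    (h' : PDer H (F.subst (Sub.cons R' Sub.id))) : PDer H (F.subst (Sub.cons R Sub.id)) := by
  refine h.same_elim fun Δ σ H' e heq => ?_
  have h' := e h'
  rw [abs_subst, abs_subst, abs_inj] at heq
  rwa [Fm.subst_subst, Sub.cons_comp, ← heq.2, ← Sub.cons_comp, ← Fm.subst_subst] at h'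

/-! ### Determinacy of the semantics -/

theorem prv_natsem {M V : Tm Γ .i} {G : Tm Γ .prp} (hP : NatsemProg M V G) (h : PDer H (prv G)) :
    PDer H (prvA (natsem M V)) :=
  prv_atom_intro hP.prog h

theorem prv_transone {M N : Tm Γ .i} {G : Tm Γ .prp} (hP : TransoneProg M N G)
    (h : PDer H (prv G)) : PDer H (prvA (transone M N)) :=
  prv_atom_intro hP.prog h

theorem prv_transsem_refl (M : Tm Γ .i) : PDer H (prvA (transsem M M)) :=
  prv_atom_intro (TranssemProg.refl M).prog prv_tt

theorem prv_transsem_step {M M' N : Tm Γ .i} (h : PDer H (prvA (transone M M')))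
    (h' : PDer H (prvA (transsem M' N))) : PDer H (prvA (transsem M N)) :=
  prv_atom_intro (TranssemProg.step M N M').prog (prv_amp_intro h h')

theorem prv_value {V : Tm Γ .i} {G : Tm Γ .prp} (hP : ValueProg V G) (h : PDer H (prv G)) :
    PDer H (prvA (value V)) :=
  prv_atom_intro hP.prog h

theorem prv_typeof {M T : Tm Γ .i} {G : Tm Γ .prp} (hP : TypeofProg M T G) (h : PDer H (prv G)) :
    PDer H (prvA (typeof M T)) :=
  prv_atom_intro hP.prog h

theorem natsem_deterministic {m v u : Tm Γ .i} (h : PDer H (prvA (natsem m v)))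
    (h' : PDer H (prvA (natsem m u))) : PDer H (sameF v u) := by
  refine prv_induction₂ (A := fun _ m v => natsem m v) (P := fun _ m _ u => prvA (natsem m u))
    (C := fun _ _ v u => sameF v u) (B := fun _ m _ u => natsem m u)
    (fun Γ H m v u G G' hG hG' _ h' hs ih => ?_) h h'
  replace hG := hG.natsem
  replace hG' := hG'.natsem
  generalize hm : m = m' at hG'
  cases hG <;> cases hG'
  all_goals first
    | (exfalso; refine Tm.absurd_of_head_ne hm ?_; simp; done)
    | obtain ⟨rfl, rfl, rfl⟩ := cond_inj.1 hm
    | obtain ⟨rfl, rfl⟩ := abs_inj.1 hm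
    | obtain ⟨rfl, rfl⟩ := app_inj.1 hm
    | obtain ⟨rfl, rfl⟩ := fix_inj.1 hm
    | obtain rfl := succ_inj.1 hm
    | obtain rfl := pred_inj.1 hm
    | obtain rfl := isZero_inj.1 hm
    | skip
  case zero.zero | tru.tru | fls.fls | abs.abs | predZero.predZero | isZeroZero.isZeroZero |
      isZeroSucc.isZeroSucc =>
    exact .same_intro _
  case succ.succ => simpa using (ih hs h').same_congr (succ v0)
  case predSucc.predSucc => exact (ih hs h').same_succ_inv
  case predZero.predSucc | predSucc.predZero | isZeroZero.isZeroSucc | isZeroSucc.isZeroZero =>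
    exact (ih hs h').same_absurd (by simp)
  case condTru.condTru | condFls.condFls => exact ih hs.amp.2 (prv_amp_elim h').2
  case condTru.condFls | condFls.condTru =>
    exact (ih hs.amp.1 (prv_amp_elim h').1).same_absurd (by simp)
  case app.app =>
    have hR := (ih hs.amp.1 (prv_amp_elim h').1).same_abs_rewrite
      (prvA (natsem (v0.app (Tm.weaken _)) u.weaken)) (by simpa using (prv_amp_elim h').2)
    exact ih hs.amp.2 (by simpa using hR)
  case fix.fix => exact ih hs h'

theorem value_not_transone {m u : Tm Γ .i} {C : Fm Γ} (h : PDer H (prvA (value m)))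
    (h' : PDer H (prvA (transone m u))) : PDer H C := by
  refine Der.cut_shared (B := .bot) ?_ .botL
  refine prv_induction₂ (v := m) (A := fun _ m _ => value m)
    (P := fun _ m _ u => prvA (transone m u)) (C := fun _ _ _ _ => .bot)
    (B := fun _ m _ u => transone m u) (fun Γ H m v u G G' hG hG' _ h' hs ih => ?_) h h'
  replace hG := hG.value
  replace hG' := hG'.transone
  generalize hm : m = m' at hG'
  cases hG <;> cases hG'
  case succ.succ =>
    obtain rfl := succ_inj.1 hm
    exact ih (v := v) hs h'
  all_goals exact (Tm.absurd_of_head_ne hm (by simp)).elim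

theorem transone_deterministic {m v u : Tm Γ .i} (h : PDer H (prvA (transone m v)))
    (h' : PDer H (prvA (transone m u))) : PDer H (sameF v u) := by
  refine prv_induction₂ (A := fun _ m v => transone m v) (P := fun _ m _ u => prvA (transone m u))
    (C := fun _ _ v u => sameF v u) (B := fun _ m _ u => transone m u)
    (fun Γ H m v u G G' hG hG' _ h' hs ih => ?_) h h'
  replace hG := hG.transone
  replace hG' := hG'.transone
  generalize hm : m = m' at hG'
  cases hG <;> cases hG'
  all_goals first
    | (exfalso; refine Tm.absurd_of_head_ne hm ?_; simp; done)
    | (exfalso; refine Tm.absurd_of_head_ne (pred_inj.1 hm) ?_; simp; done)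
    | (exfalso; refine Tm.absurd_of_head_ne (isZero_inj.1 hm) ?_; simp; done)
    | (exfalso; refine Tm.absurd_of_head_ne (cond_inj.1 hm).1 ?_; simp; done)
    | obtain rfl := succ_inj.1 (pred_inj.1 hm)
    | obtain rfl := succ_inj.1 (isZero_inj.1 hm)
    | (obtain ⟨hR, rfl⟩ := app_inj.1 hm; obtain ⟨rfl, rfl⟩ := abs_inj.1 hR)
    | obtain ⟨rfl, rfl, rfl⟩ := cond_inj.1 hm
    | obtain ⟨_, rfl, rfl⟩ := cond_inj.1 hm
    | obtain ⟨rfl, rfl⟩ := app_inj.1 hm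
    | obtain ⟨rfl, rfl⟩ := fix_inj.1 hm
    | obtain rfl := succ_inj.1 hm
    | obtain rfl := pred_inj.1 hm
    | obtain rfl := isZero_inj.1 hm
    | skip
  case succ.succ => simpa using (ih hs h').same_congr (succ v0)
  case pred.pred => simpa using (ih hs h').same_congr (pred v0)
  case isZero.isZero => simpa using (ih hs h').same_congr (isZero v0)
  case cond.cond =>
    simpa using (ih hs h').same_congr (cond v0 (Tm.weaken _) (Tm.weaken _))
  case app.app => simpa using (ih hs h').same_congr (app v0 (Tm.weaken _))
  case predZero.pred | isZeroZero.isZero | condTru.cond | condFls.cond | appAbs.app =>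
    exact value_not_transone (prv_value (by constructor) prv_tt) h'
  case predSucc.pred | isZeroSucc.isZero =>
    exact value_not_transone (prv_value (.succ _) hs.prv) h'
  case pred.predZero | isZero.isZeroZero | cond.condTru | cond.condFls | app.appAbs =>
    exact value_not_transone (prv_value (by constructor) prv_tt) hs.prv
  case pred.predSucc | isZero.isZeroSucc =>
    exact value_not_transone (prv_value (.succ _) h') hs.prv
  all_goals exact .same_intro _

theorem transsem_deterministic {m v u : Tm Γ .i} (hv : PDer H (prvA (value v)))
    (h : PDer H (prvA (transsem m v))) (hu : PDer H (prvA (value u)))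
    (h' : PDer H (prvA (transsem m u))) : PDer H (sameF v u) := by
  refine prv_induction₂ (A := fun _ m v => transsem m v)
    (P := fun _ m v u => .and (prvA (transsem m u)) (.and (prvA (value v)) (prvA (value u))))
    (C := fun _ _ v u => sameF v u) (B := fun _ m _ u => transsem m u)
    (fun Γ H m v u G G' hG hG' hP h' hs ih => ?_) h (.andR h' (.andR hv hu))
    (fun _ _ _ _ _ h => h.and_left)
  have hv := hP.and_right.and_left
  have hu := hP.and_right.and_right
  replace hG := hG.transsem
  replace hG' := hG'.transsem
  cases hG <;> cases hG'
  case refl.refl => exact .same_intro _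
  case refl.step => exact value_not_transone hv (prv_amp_elim h').1
  case step.refl => exact value_not_transone hu hs.amp.1.prv
  case step.step =>
    have heq := transone_deterministic hs.amp.1.prv (prv_amp_elim h').1
    have h' := heq.same_rewrite (prvA (transsem v0 u.weaken)) (by simpa using (prv_amp_elim h').2)
    exact ih hs.amp.2 (.andR (by simpa using h') (.andR hv hu))

/-! ### Equivalence of the semantics -/

theorem transsem_trans {m v u : Tm Γ .i} (h : PDer H (prvA (transsem m v)))
    (h' : PDer H (prvA (transsem v u))) : PDer H (prvA (transsem m u)) := by
  refine prv_induction (A := fun _ m v => transsem m v) (P := fun _ _ v u => prvA (transsem v u))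
    (C := fun _ m _ u => prvA (transsem m u)) (fun Γ H m v u G hG h' hs ih => ?_) h h'
  cases hG.transsem with
  | refl => exact h'
  | step => exact prv_transsem_step hs.amp.1.prv (ih hs.amp.2 h')

theorem transsem_tail {m v u : Tm Γ .i} {G : Tm Γ .prp} (h : PDer H (prvA (transsem m v)))
    (hP : TransoneProg v u G) (h' : PDer H (prv G)) : PDer H (prvA (transsem m u)) :=
  transsem_trans h (prv_transsem_step (prv_transone hP h') (prv_transsem_refl u))

/-- The function `F` preserves single steps. -/
noncomputable def preservesStepsF (F : Tm Γ (.arr .i .i)) : Fm Γ :=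
  .all .i (.all .i (.imp (prvA (transone v1 v0))
    (prvA (transone (F.weaken.weaken.app v1) (F.weaken.weaken.app v0)))))

@[simp]
theorem preservesStepsF_subst {Δ : Ctx} (F : Tm Γ (.arr .i .i)) (σ : Sub Γ Δ) :
    (preservesStepsF F).subst σ = preservesStepsF (F.subst σ) := by
  simp [preservesStepsF]

theorem transsem_congr (f : Tm (.i :: Γ) .i)
    (hf : ∀ (Δ : Ctx) (σ : Sub Γ Δ) (H' : Multiset (Fm Δ)) (m m' : Tm Δ .i),
      PDer H' (prvA (transone m m')) →
        PDer H' (prvA (transone (f.subst (Sub.cons m σ)) (f.subst (Sub.cons m' σ)))))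
    {m v : Tm Γ .i} (h : PDer H (prvA (transsem m v))) :
    PDer H (prvA (transsem (f.subst (Sub.cons m Sub.id)) (f.subst (Sub.cons v Sub.id)))) := by
  have h := prv_induction (A := fun _ m v => transsem m v)
    (P := fun _ _ _ F => preservesStepsF F) (u := f.lam)
    (C := fun _ m v F => prvA (transsem (F.app m) (F.app v)))
    (fun Γ H m v F G hG hF hs ih => ?_) h ?_
  · simpa [Tm.lam_app] using h
  · cases hG.transsem with
    | refl => exact prv_transsem_refl _
    | step _ M' =>
      refine prv_transsem_step ?_ (ih hs.amp.2 hF)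
      have hF := hF.all_elim m
      simpa using (hF.all_elim M').imp_elim (by simpa using hs.amp.1.prv)
  · refine .all₂_imp_intro fun Δ σ H' _ m m' h => ?_
    simp only [v1, v0, prv_subst, atom_subst, transone_subst, Tm.subst_var, Sub.cons, Tm.subst_app,
      Tm.weaken_subst_cons, Tm.subst_lam, Tm.lam_app, Sub.single_eq_cons, Tm.subst_subst,
      Sub.lift_comp_cons, Sub.comp_id] at h ⊢
    exact hf _ _ _ _ _ h

theorem transsem_succ {m v : Tm Γ .i} (h : PDer H (prvA (transsem m v))) :
    PDer H (prvA (transsem (succ m) (succ v))) := by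
  simpa using transsem_congr (succ v0)
    (fun _ _ _ _ _ h => by simpa using prv_transone (.succ _ _) h) h

theorem transsem_pred {m v : Tm Γ .i} (h : PDer H (prvA (transsem m v))) :
    PDer H (prvA (transsem (pred m) (pred v))) := by
  simpa using transsem_congr (pred v0)
    (fun _ _ _ _ _ h => by simpa using prv_transone (.pred _ _) h) h

theorem transsem_isZero {m v : Tm Γ .i} (h : PDer H (prvA (transsem m v))) :
    PDer H (prvA (transsem (isZero m) (isZero v))) := by
  simpa using transsem_congr (isZero v0)
    (fun _ _ _ _ _ h => by simpa using prv_transone (.isZero _ _) h) h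

theorem transsem_cond {m v : Tm Γ .i} (h : PDer H (prvA (transsem m v))) (N₁ N₂ : Tm Γ .i) :
    PDer H (prvA (transsem (cond m N₁ N₂) (cond v N₁ N₂))) := by
  simpa using transsem_congr (cond v0 N₁.weaken N₂.weaken)
    (fun _ _ _ _ _ h => by simpa using prv_transone (.cond _ _ _ _) h) h

theorem transsem_app {m v : Tm Γ .i} (h : PDer H (prvA (transsem m v))) (N : Tm Γ .i) :
    PDer H (prvA (transsem (app m N) (app v N))) := by
  simpa using transsem_congr (app v0 N.weaken)
    (fun _ _ _ _ _ h => by simpa using prv_transone (.app _ _ _) h) h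

theorem value_succ_inv {V : Tm Γ .i} (h : PDer H (prvA (value (succ V)))) :
    PDer H (prvA (value V)) := by
  refine prv_atom_elim h fun Δ σ H' _ G hG h => ?_
  rw [value_subst, succ_subst] at hG
  generalize hm : succ (V.subst σ) = m at hG
  replace hG := hG.value
  cases hG
  case succ =>
    obtain rfl := succ_inj.1 hm
    simpa using h
  all_goals exact (Tm.absurd_of_head_ne hm (by simp)).elim

theorem value_of_natsem {m v : Tm Γ .i} (h : PDer H (prvA (natsem m v))) :
    PDer H (prvA (value v)) := by
  refine prv_induction (a := .i) (u := m) (A := fun _ m v => natsem m v) (P := fun _ _ _ _ => .top)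
    (C := fun _ _ v _ => prvA (value v)) (fun Γ H m v u G hG _ hs ih => ?_) h .topR
  replace ih := fun {m v : Tm Γ .i} h => ih (m := m) (v := v) (u := u) h .topR
  cases hG.natsem with
  | zero => exact prv_value .zero prv_tt
  | tru | isZeroZero => exact prv_value .tru prv_tt
  | fls | isZeroSucc => exact prv_value .fls prv_tt
  | succ => exact prv_value (.succ _) (ih hs)
  | predZero | fix => exact ih hs
  | predSucc => exact value_succ_inv (ih hs)
  | condTru | condFls | app => exact ih hs.amp.2
  | abs => exact prv_value (.abs _ _) prv_tt

theorem transsem_of_natsem {m v : Tm Γ .i} (h : PDer H (prvA (natsem m v))) :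
    PDer H (prvA (transsem m v)) := by
  refine prv_induction (a := .i) (u := m) (A := fun _ m v => natsem m v) (P := fun _ _ _ _ => .top)
    (C := fun _ m v _ => prvA (transsem m v)) (fun Γ H m v u G hG _ hs ih => ?_) h .topR
  replace ih := fun {m v : Tm Γ .i} h => ih (m := m) (v := v) (u := u) h .topR
  cases hG.natsem with
  | zero | tru | fls | abs => exact prv_transsem_refl _
  | succ => exact transsem_succ (ih hs)
  | predZero => exact transsem_tail (transsem_pred (ih hs)) .predZero prv_tt
  | predSucc =>
    exact transsem_tail (transsem_pred (ih hs)) (.predSucc _)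
      (value_succ_inv (value_of_natsem hs.prv))
  | isZeroZero => exact transsem_tail (transsem_isZero (ih hs)) .isZeroZero prv_tt
  | isZeroSucc =>
    exact transsem_tail (transsem_isZero (ih hs)) (.isZeroSucc _)
      (value_succ_inv (value_of_natsem hs.prv))
  | condTru =>
    exact transsem_trans (transsem_tail (transsem_cond (ih hs.amp.1) _ _) (.condTru _ _) prv_tt)
      (ih hs.amp.2)
  | condFls =>
    exact transsem_trans (transsem_tail (transsem_cond (ih hs.amp.1) _ _) (.condFls _ _) prv_tt)
      (ih hs.amp.2)
  | app =>
    exact transsem_trans (transsem_tail (transsem_app (ih hs.amp.1) _) (.appAbs _ _ _) prv_tt)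
      (ih hs.amp.2)
  | fix => exact prv_transsem_step (prv_transone (.fix _ _) prv_tt) (ih hs)

theorem natsem_of_value {v : Tm Γ .i} (h : PDer H (prvA (value v))) :
    PDer H (prvA (natsem v v)) := by
  refine prv_induction (a := .i) (u := v) (v := v) (A := fun _ m _ => value m)
    (P := fun _ _ _ _ => .top) (C := fun _ m _ _ => prvA (natsem m m))
    (fun Γ H m v u G hG _ hs ih => ?_) h .topR
  cases hG.value with
  | zero => exact prv_natsem .zero prv_tt
  | tru => exact prv_natsem .tru prv_tt
  | fls => exact prv_natsem .fls prv_tt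
  | succ => exact prv_natsem (.succ _ _) (ih (v := v) (u := u) hs .topR)
  | abs => exact prv_natsem (.abs _ _) prv_tt

theorem natsem_of_transone {m v u : Tm Γ .i} (h : PDer H (prvA (transone m v)))
    (h' : PDer H (prvA (natsem v u))) : PDer H (prvA (natsem m u)) := by
  refine prv_induction₂ (A := fun _ m v => transone m v) (P := fun _ _ v u => prvA (natsem v u))
    (C := fun _ m _ u => prvA (natsem m u)) (B := fun _ _ v u => natsem v u)
    (fun Γ H m v u G G' hG hG' hP h' hs ih => ?_) h h'
  replace hG := hG.transone
  replace hG' := hG'.natsem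
  generalize hm : v = v' at hG'
  cases hG
  case predSucc => exact prv_natsem (.predSucc _ _) (prv_natsem (.succ _ _) hP)
  case condTru =>
    exact prv_natsem (.condTru _ _ _ _) (prv_amp_intro (prv_natsem .tru prv_tt) hP)
  case condFls =>
    exact prv_natsem (.condFls _ _ _ _) (prv_amp_intro (prv_natsem .fls prv_tt) hP)
  case appAbs => exact prv_natsem (.app _ _ _ _ _) (prv_amp_intro (prv_natsem (.abs _ _) prv_tt) hP)
  case fix => exact prv_natsem (.fix _ _ _) hP
  all_goals cases hG'
  all_goals first
    | (exfalso; refine Tm.absurd_of_head_ne hm ?_; simp; done)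
    | obtain ⟨rfl, rfl, rfl⟩ := cond_inj.1 hm
    | obtain ⟨rfl, rfl⟩ := app_inj.1 hm
    | obtain rfl := succ_inj.1 hm
    | obtain rfl := pred_inj.1 hm
    | obtain rfl := isZero_inj.1 hm
    | skip
  case predZero.zero => exact prv_natsem (.predZero _) (prv_natsem .zero prv_tt)
  case isZeroZero.tru => exact prv_natsem (.isZeroZero _) (prv_natsem .zero prv_tt)
  case isZeroSucc.fls =>
    exact prv_natsem (.isZeroSucc _ _) (prv_natsem (.succ _ _) (natsem_of_value hs.prv))
  case succ.succ => exact prv_natsem (.succ _ _) (ih hs h')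
  case pred.predZero => exact prv_natsem (.predZero _) (ih hs h')
  case pred.predSucc => exact prv_natsem (.predSucc _ _) (ih hs h')
  case isZero.isZeroZero => exact prv_natsem (.isZeroZero _) (ih hs h')
  case isZero.isZeroSucc => exact prv_natsem (.isZeroSucc _ _) (ih hs h')
  case cond.condTru =>
    exact prv_natsem (.condTru ..) (prv_amp_intro (ih hs (prv_amp_elim h').1) (prv_amp_elim h').2)
  case cond.condFls =>
    exact prv_natsem (.condFls ..) (prv_amp_intro (ih hs (prv_amp_elim h').1) (prv_amp_elim h').2)
  case app.app =>
    exact prv_natsem (.app ..) (prv_amp_intro (ih hs (prv_amp_elim h').1) (prv_amp_elim h').2)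

theorem natsem_of_transsem {m v : Tm Γ .i} (hv : PDer H (prvA (value v)))
    (h : PDer H (prvA (transsem m v))) : PDer H (prvA (natsem m v)) := by
  refine prv_induction (a := .i) (u := v) (A := fun _ m v => transsem m v)
    (P := fun _ _ v _ => prvA (value v)) (C := fun _ m v _ => prvA (natsem m v))
    (fun Γ H m v u G hG h' hs ih => ?_) h hv
  cases hG.transsem with
  | refl => exact natsem_of_value h'
  | step => exact natsem_of_transone hs.amp.1.prv (ih (u := u) hs.amp.2 h')

end

section

variable {Γ Δ : Ctx} {H : Multiset (Fm Γ)}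

/-! ### Subject reduction -/

theorem bodyGoal_elim {I : Tm Γ .nt} {L : Tm Γ .lst} {T U : Tm Γ .i} {R : Tm Γ (.arr .i .i)}
    (hI : PDer H (.nat I)) (h : PDer H (seqF I L (bodyGoal T R U))) (N : Tm Γ .i) :
    PDer H (seqF I (cons (typeof N T) L) (atom (typeof (R.app N) U))) := by
  have h := seqF_oall_elim hI h N
  simp only [v0, Tm.lam_app, Sub.single_eq_cons, oimp_subst, typeof_subst, Tm.subst_var, Sub.cons,
    Tm.weaken_subst_cons, Tm.subst_id, atom_subst, Tm.subst_app] at h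
  exact seqF_oimp_elim hI h

theorem prv_bodyGoal_elim {T U N : Tm Γ .i} {R : Tm Γ (.arr .i .i)}
    (h : PDer H (prv (bodyGoal T R U))) (hN : PDer H (prvA (typeof N T))) :
    PDer H (prvA (typeof (R.app N) U)) := by
  refine prv_cut hN (prvFrom_elim h fun Δ σ H' _ I hI h => ?_)
  simpa using prvFrom_intro hI (bodyGoal_elim hI (by simpa using h) (N.subst σ))

theorem typeof_succ_inv {V T : Tm Γ .i} (h : PDer H (prvA (typeof (succ V) T))) :
    PDer H (prvA (typeof V num)) := by
  refine prv_atom_elim h fun Δ σ H' _ G hG h => ?_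
  rw [typeof_subst, succ_subst] at hG
  generalize hm : succ (V.subst σ) = m at hG
  generalize T.subst σ = t at hG
  replace hG := hG.typeof
  cases hG
  case succ =>
    obtain rfl := succ_inj.1 hm
    simpa using h
  all_goals exact (Tm.absurd_of_head_ne hm (by simp)).elim

theorem typeof_beta {T U V N : Tm Γ .i} {R : Tm Γ (.arr .i .i)}
    (h : PDer H (prvA (typeof (abs T R) (arrow U V)))) (hN : PDer H (prvA (typeof N U))) :
    PDer H (prvA (typeof (R.app N) V)) := by
  refine prv_atom_elim h fun Δ σ H' e G hG h => ?_
  have hN := e hN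
  simp only [prv_subst, atom_subst, typeof_subst, abs_subst, arrow_subst, Tm.subst_app] at hG hN ⊢
  replace hG := hG.typeof
  generalize hm : abs (T.subst σ) (R.subst σ) = m at hG
  generalize ht : arrow (U.subst σ) (V.subst σ) = t at hG
  cases hG
  case abs =>
    obtain ⟨rfl, rfl⟩ := abs_inj.1 hm
    obtain ⟨hU, hV⟩ := arrow_inj.1 ht
    rw [hU] at hN
    exact hV ▸ prv_bodyGoal_elim h hN
  all_goals exact (Tm.absurd_of_head_ne hm (by simp)).elim

theorem typeof_of_natsem {m v t : Tm Γ .i} (h : PDer H (prvA (natsem m v)))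
    (h' : PDer H (prvA (typeof m t))) : PDer H (prvA (typeof v t)) := by
  refine prv_induction₂ (A := fun _ m v => natsem m v) (P := fun _ m _ t => prvA (typeof m t))
    (C := fun _ _ v t => prvA (typeof v t)) (B := fun _ m _ t => typeof m t)
    (fun Γ H m v t G G' hG hG' hP h' hs ih => ?_) h h'
  replace hG := hG.natsem
  replace hG' := hG'.typeof
  generalize hm : m = m' at hG'
  cases hG <;> cases hG'
  all_goals first
    | (exfalso; refine Tm.absurd_of_head_ne hm ?_; simp; done)
    | obtain ⟨rfl, rfl, rfl⟩ := cond_inj.1 hm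
    | obtain ⟨rfl, rfl⟩ := app_inj.1 hm
    | obtain ⟨rfl, rfl⟩ := fix_inj.1 hm
    | obtain rfl := succ_inj.1 hm
    | obtain rfl := pred_inj.1 hm
    | skip
  case zero.zero | tru.tru | fls.fls | abs.abs => exact hP
  case succ.succ => exact prv_typeof (.succ _) (ih hs h')
  case predZero.pred => exact prv_typeof .zero prv_tt
  case predSucc.pred => exact typeof_succ_inv (ih hs h')
  case isZeroZero.isZero => exact prv_typeof .tru prv_tt
  case isZeroSucc.isZero => exact prv_typeof .fls prv_tt
  case condTru.cond => exact ih hs.amp.2 (prv_amp_elim (prv_amp_elim h').2).1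
  case condFls.cond => exact ih hs.amp.2 (prv_amp_elim (prv_amp_elim h').2).2
  case app.app =>
    obtain ⟨hM, hN⟩ := prv_amp_elim h'
    exact ih hs.amp.2 (typeof_beta (ih hs.amp.1 hM) hN)
  case fix.fix => exact ih hs (prv_bodyGoal_elim h' hP)

theorem typeof_of_transone {m n t : Tm Γ .i} (h : PDer H (prvA (transone m n)))
    (h' : PDer H (prvA (typeof m t))) : PDer H (prvA (typeof n t)) := by
  refine prv_induction₂ (A := fun _ m v => transone m v) (P := fun _ m _ t => prvA (typeof m t))
    (C := fun _ _ v t => prvA (typeof v t)) (B := fun _ m _ t => typeof m t)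
    (fun Γ H m v t G G' hG hG' hP h' hs ih => ?_) h h'
  replace hG := hG.transone
  replace hG' := hG'.typeof
  generalize hm : m = m' at hG'
  cases hG <;> cases hG'
  all_goals first
    | (exfalso; refine Tm.absurd_of_head_ne hm ?_; simp; done)
    | obtain ⟨rfl, rfl, rfl⟩ := cond_inj.1 hm
    | obtain ⟨rfl, rfl⟩ := app_inj.1 hm
    | obtain ⟨rfl, rfl⟩ := fix_inj.1 hm
    | obtain rfl := succ_inj.1 hm
    | obtain rfl := pred_inj.1 hm
    | obtain rfl := isZero_inj.1 hm
  case predZero.pred => exact prv_typeof .zero prv_tt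
  case predSucc.pred => exact typeof_succ_inv h'
  case isZeroZero.isZero => exact prv_typeof .tru prv_tt
  case isZeroSucc.isZero => exact prv_typeof .fls prv_tt
  case condTru.cond => exact (prv_amp_elim (prv_amp_elim h').2).1
  case condFls.cond => exact (prv_amp_elim (prv_amp_elim h').2).2
  case appAbs.app => exact typeof_beta (prv_amp_elim h').1 (prv_amp_elim h').2
  case fix.fix => exact prv_bodyGoal_elim h' hP
  case succ.succ => exact prv_typeof (.succ _) (ih hs h')
  case pred.pred => exact prv_typeof (.pred _) (ih hs h')
  case isZero.isZero => exact prv_typeof (.isZero _) (ih hs h')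
  case cond.cond =>
    obtain ⟨hM, hN⟩ := prv_amp_elim h'
    exact prv_typeof (.cond _ _ _ _) (prv_amp_intro (ih hs hM) hN)
  case app.app =>
    obtain ⟨hM, hN⟩ := prv_amp_elim h'
    exact prv_typeof (.app _ _ _ _) (prv_amp_intro (ih hs hM) hN)

theorem typeof_of_transsem {m n t : Tm Γ .i} (h : PDer H (prvA (transsem m n)))
    (h' : PDer H (prvA (typeof m t))) : PDer H (prvA (typeof n t)) := by
  refine prv_induction (A := fun _ m v => transsem m v) (P := fun _ m _ t => prvA (typeof m t))
    (C := fun _ _ v t => prvA (typeof v t)) (fun Γ H m v t G hG h' hs ih => ?_) h h'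
  cases hG.transsem with
  | refl => exact h'
  | step => exact ih hs.amp.2 (typeof_of_transone hs.amp.1.prv h')

/-! ### Unicity of typing -/

/-- A term of type `T`, which stands for a variable of type `T` in the typing contexts. -/
def inhabitant (T : Tm Γ .i) : Tm Γ .i := fix T (.lam v0)

@[simp]
theorem inhabitant_subst (σ : Sub Γ Δ) (T : Tm Γ .i) :
    (inhabitant T).subst σ = inhabitant (T.subst σ) := by
  simp [inhabitant]

theorem TypeofProg.of_inhabitant {T t : Tm Γ .i} {G : Tm Γ .prp}
    (h : TypeofProg (inhabitant T) t G) : t = T := by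
  generalize hm : inhabitant T = m at h
  rw [inhabitant] at hm
  cases h
  case fix => exact (fix_inj.1 hm).1.symm
  all_goals exact (Tm.absurd_of_head_ne hm (by simp)).elim

/-- The elements of `L` are typings of the terms `inhabitant T`. -/
noncomputable def typingCtxF (L : Tm Γ .lst) : Fm Γ :=
  .all .atm (.imp (elementF v0 L.weaken)
    (.ex .i (elementF v1 (cons (typeof (inhabitant v0) v0) nil))))

@[simp]
theorem typingCtxF_subst (σ : Sub Γ Δ) (L : Tm Γ .lst) :
    (typingCtxF L).subst σ = typingCtxF (L.subst σ) := by
  simp [typingCtxF]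

theorem typingCtxF_nil : PDer H (typingCtxF nil) :=
  .all_imp_intro fun Δ σ H' _ X h => Der.not_element_nil (X := X) (by simpa using h)

theorem typingCtxF_cons {L : Tm Γ .lst} (h : PDer H (typingCtxF L)) (T : Tm Γ .i) :
    PDer H (typingCtxF (cons (typeof (inhabitant T) T) L)) := by
  refine .all_imp_intro fun Δ σ H' e X hX => Der.element_elim hX (fun Θ τ K _ M hM => ?_)
    (fun Θ τ K e' Y M hM hX => ?_)
  · simp only [Tm.weaken_subst_cons, cons_subst, typeof_subst, inhabitant_subst, v0, Tm.subst_var,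
      Sub.cons, cons_inj, Fm.subst, Atom.subst, v1, Sub.lift, nil_subst, Tm.weaken_subst_lift]
      at hM ⊢
    refine .ex_intro ((T.subst σ).subst τ) ?_
    simp only [Fm.subst, Atom.subst, Tm.weaken_subst_cons, Tm.subst_id, cons_subst, typeof_subst,
      inhabitant_subst, Tm.subst_var, Sub.cons, hM.1, nil_subst]
    exact .element_head _ _
  · have h := e' (e h)
    simp only [typingCtxF_subst, Tm.weaken_subst_cons, cons_subst, typeof_subst, inhabitant_subst,
      cons_inj, v0, Tm.subst_var, Sub.cons, Fm.subst, Atom.subst, v1, Sub.lift, nil_subst,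
      Tm.weaken_subst_lift] at h hM hX ⊢
    rw [← hM.2] at hX
    simpa using (h.all_elim _).imp_elim (by simpa using hX)

theorem typingCtxF_elim {L : Tm Γ .lst} {m t : Tm Γ .i} {C : Fm Γ} (hL : PDer H (typingCtxF L))
    (h : PDer H (elementF (typeof m t) L))
    (k : ∀ (Δ : Ctx) (σ : Sub Γ Δ) (H' : Multiset (Fm Δ)), PExt σ H H' →
      m.subst σ = inhabitant (t.subst σ) → PDer H' (C.subst σ)) : PDer H C := by
  have h := (Der.all_elim hL _).imp_elim (by simpa using h)
  refine h.ex_elim fun Δ σ H' e T hT => ?_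
  simp only [Fm.subst, Atom.subst, v1, Tm.subst_var, Sub.lift, Sub.cons, v0, cons_subst,
    typeof_subst, inhabitant_subst, nil_subst, Tm.weaken_subst_cons] at hT
  refine Der.element_elim hT (fun Θ τ K e' L' h => ?_) (fun Θ τ K _ Y L' h hX => ?_)
  · simp only [cons_subst, typeof_subst, inhabitant_subst, nil_subst, cons_inj, typeof_inj] at h
    rw [Fm.subst_subst]
    refine k _ _ _ (e.trans e') ?_
    rw [← Tm.subst_subst, ← Tm.subst_subst, ← h.1.1, h.1.2]
  · simp only [cons_subst, typeof_subst, inhabitant_subst, nil_subst, cons_inj] at h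
    rw [← h.2] at hX
    exact .not_element_nil hX

/-- The two ways in which `typeof m t` has a derivation of height `I` from a typing context `L`:
it is an element of `L`, or it is derived by a typing clause. -/
def TypeofCases (H : Multiset (Fm Γ)) (I : Tm Γ .nt) (L : Tm Γ .lst) (m t : Tm Γ .i) : Prop :=
  m = inhabitant t ∨ ∃ (J : Tm Γ .nt) (G : Tm Γ .prp),
    I = s J ∧ PDer H (.nat J) ∧ TypeofProg m t G ∧ PDer H (seqF J L G)

theorem TypeofCases.ext {I : Tm Γ .nt} {L : Tm Γ .lst} {m t : Tm Γ .i}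
    (h : TypeofCases H I L m t) {σ : Sub Γ Δ} {H' : Multiset (Fm Δ)} (e : PExt σ H H') :
    TypeofCases H' (I.subst σ) (L.subst σ) (m.subst σ) (t.subst σ) := by
  obtain rfl | ⟨J, G, rfl, hJ, hG, h⟩ := h
  · exact .inl (inhabitant_subst σ t)
  · exact .inr ⟨_, _, s_subst σ J, e hJ, (typeof_subst σ m t ▸ hG.prog.subst σ).typeof, e h⟩

theorem typeof_seq_elim {I : Tm Γ .nt} {L : Tm Γ .lst} {m t : Tm Γ .i} {C : Fm Γ}
    (hI : PDer H (.nat I)) (hL : PDer H (typingCtxF L))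
    (h : PDer H (seqF I L (atom (typeof m t))))
    (k : ∀ (Δ : Ctx) (σ : Sub Γ Δ) (H' : Multiset (Fm Δ)), PExt σ H H' →
      TypeofCases H' (I.subst σ) (L.subst σ) (m.subst σ) (t.subst σ) → PDer H' (C.subst σ)) :
    PDer H C := by
  refine h.seq_elim fun Δ σ H' e h => ?_
  rw [atom_subst] at h
  rcases h.atom_inv with h | ⟨J, G, hJ, hP, h⟩
  · rw [typeof_subst] at h
    refine typingCtxF_elim (by simpa using e hL) h fun Θ τ K e' heq => ?_
    rw [Fm.subst_subst]
    exact k _ _ _ (e.trans e') (.inl (by rwa [← Tm.subst_subst, ← Tm.subst_subst]))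
  · have hI := e hI
    rw [Fm.subst, hJ] at hI
    exact k _ _ _ e (.inr ⟨J, G, hJ, hI.nat_pred, (typeof_subst σ m t ▸ hP).typeof, h⟩)

/-- Unicity of the types derived with height `I`. -/
noncomputable def unicityF (I : Tm Γ .nt) : Fm Γ :=
  .all .lst (.all .i (.all .i (.all .i (.imp
    (.and (typingCtxF v3) (.and (seqF I.weaken.weaken.weaken.weaken v3 (atom (typeof v2 v1)))
      (prvFrom v3 (atom (typeof v2 v0))))) (sameF v1 v0)))))

@[simp]
theorem unicityF_subst (σ : Sub Γ Δ) (I : Tm Γ .nt) :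
    (unicityF I).subst σ = unicityF (I.subst σ) := by
  simp [unicityF]

theorem unicityF_elim {I : Tm Γ .nt} (h : PDer H (unicityF I)) {L : Tm Γ .lst} {m t u : Tm Γ .i}
    (hL : PDer H (typingCtxF L)) (ht : PDer H (seqF I L (atom (typeof m t))))
    (hu : PDer H (prvFrom L (atom (typeof m u)))) : PDer H (sameF t u) := by
  have h := ((h.all_elim L).all_elim m).all_elim t
  simpa using (h.all_elim u).imp_elim (by simpa using .andR hL (.andR ht hu))

theorem TypeofProg.unique {I J : Tm Γ .nt} {L : Tm Γ .lst} {m t u : Tm Γ .i} {G G' : Tm Γ .prp}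
    (hI : PDer H (.nat I)) (hi : PDer H (unicityF I)) (hL : PDer H (typingCtxF L))
    (hG : TypeofProg m t G) (h : PDer H (seqF I L G)) (hJ : PDer H (.nat J))
    (hG' : TypeofProg m u G') (h' : PDer H (seqF J L G')) : PDer H (sameF t u) := by
  generalize hm : m = m' at hG'
  cases hG <;> cases hG'
  all_goals first
    | (exfalso; refine Tm.absurd_of_head_ne hm ?_; simp; done)
    | exact .same_intro _
    | skip
  case cond.cond =>
    obtain ⟨rfl, rfl, rfl⟩ := cond_inj.1 hm
    exact unicityF_elim hi hL (seqF_amp_elim hI (seqF_amp_elim hI h).2).1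
      (prvFrom_intro hJ (seqF_amp_elim hJ (seqF_amp_elim hJ h').2).1)
  case abs.abs =>
    obtain ⟨rfl, rfl⟩ := abs_inj.1 hm
    have hU := unicityF_elim hi (typingCtxF_cons hL _) (bodyGoal_elim hI h _)
      (prvFrom_intro hJ (bodyGoal_elim hJ h' _))
    simpa using hU.same_congr (arrow (Tm.weaken _) v0)
  case app.app =>
    obtain ⟨rfl, rfl⟩ := app_inj.1 hm
    exact Der.same_arrow_inv (unicityF_elim hi hL (seqF_amp_elim hI h).1
      (prvFrom_intro hJ (seqF_amp_elim hJ h').1))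
  case fix.fix =>
    obtain ⟨rfl, rfl⟩ := fix_inj.1 hm
    exact .same_intro _

theorem TypeofCases.unique {I J : Tm Γ .nt} {L : Tm Γ .lst} {m t u : Tm Γ .i}
    (hi : ∀ K : Tm Γ .nt, I = s K → PDer H (unicityF K)) (hL : PDer H (typingCtxF L))
    (h : TypeofCases H I L m t) (h' : TypeofCases H J L m u) : PDer H (sameF t u) := by
  obtain rfl | ⟨I', G, hI, hI', hG, h⟩ := h
  · obtain heq | ⟨_, _, _, _, hG', _⟩ := h'
    · rw [(fix_inj.1 heq).1]
      exact .same_intro _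
    · rw [hG'.of_inhabitant]
      exact .same_intro _
  · obtain rfl | ⟨J', G', _, hJ', hG', h'⟩ := h'
    · rw [hG.of_inhabitant]
      exact .same_intro _
    · exact hG.unique hI' (hi I' hI) hL h hJ' hG' h'

theorem unicityF_intro {I : Tm Γ .nt} (hI : PDer H (.nat I))
    (hi : ∀ (Δ : Ctx) (σ : Sub Γ Δ) (H' : Multiset (Fm Δ)), PExt σ H H' →
      ∀ K : Tm Δ .nt, I.subst σ = s K → PDer H' (unicityF K)) : PDer H (unicityF I) := by
  refine .all₂_intro fun Δ σ H' e L m => .all₂_imp_intro fun Θ τ K e' t u h => ?_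
  have hL := Der.and_left h
  have ht := (Der.and_right h).and_left
  have hu := (Der.and_right h).and_right
  have hI := e' (e hI)
  simp only [v3, typingCtxF_subst, Tm.subst_var, Sub.lift, Sub.cons, Tm.weaken_subst_cons, Fm.subst,
    Atom.subst, Tm.weaken_subst_lift, v2, v1, atom_subst, typeof_subst, Tm.weaken_var, v0,
    prvFrom_subst] at hL ht hu hI ⊢
  generalize L.subst τ = L, m.subst τ = m at *
  refine prvFrom_elim hu fun Δ₁ σ₁ H₁ e₁ J hJ hu => ?_
  have hL₁ := e₁ hL
  have ht₁ := e₁ ht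
  simp only [typingCtxF_subst, Fm.subst, Atom.subst, atom_subst, typeof_subst] at hL₁ ht₁ hu
  refine typeof_seq_elim (e₁ hI) hL₁ ht₁ fun Δ₂ σ₂ H₂ e₂ ct => ?_
  have hL₂ := e₂ hL₁
  have hu₂ := e₂ hu
  simp only [typingCtxF_subst, Fm.subst, Atom.subst, atom_subst, typeof_subst] at hL₂ hu₂
  refine typeof_seq_elim (e₂ hJ) hL₂ hu₂ fun Δ₃ σ₃ H₃ e₃ cu => ?_
  refine TypeofCases.unique (fun K hK => ?_) (by simpa using e₃ hL₂) (ct.ext e₃) cu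
  refine hi Δ₃ _ H₃ (e.trans (e'.trans (e₁.trans (e₂.trans e₃)))) K ?_
  simpa only [← Tm.subst_subst] using hK

theorem unicityF_of_nat {I : Tm Γ .nt} (h : PDer H (.nat I)) : PDer H (unicityF I) := by
  refine Der.nat_induction (fun I => unicityF I) (by intros; simp) (fun H => ?_)
    (fun H I hI hi => ?_) h
  · exact unicityF_intro .natRzero fun _ _ _ _ _ hK =>
      (Tm.absurd_of_head_ne hK (by simp)).elim
  · refine unicityF_intro (.natRsucc hI) fun Δ σ H' e K hK => ?_
    rw [s_subst, s_inj] at hK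
    simpa [hK] using e hi

theorem typeof_unique {m t u : Tm Γ .i} (h : PDer H (prvA (typeof m t)))
    (h' : PDer H (prvA (typeof m u))) : PDer H (sameF t u) := by
  refine prvFrom_elim h fun Δ σ H' e I hI h => ?_
  have h' := e h'
  simp only [nil_subst, atom_subst, typeof_subst, prv_subst, Fm.subst, Atom.subst] at h h' ⊢
  exact unicityF_elim (unicityF_of_nat hI) typingCtxF_nil h h'

end

end FOLDN

theorem mainTheorem6 :
    -- Determinacy of semantics
    (Derivable pcfDefinition
      (.all .i (.all .i (.all .i
        (.imp (prv (atom (natsem v2 v1)))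
          (.imp (prv (atom (natsem v2 v0)))
            (.atom (.same v1 v0))))))) ∧
     Derivable pcfDefinition
      (.all .i (.all .i (.all .i
        (.imp (prv (atom (transone v2 v1)))
          (.imp (prv (atom (transone v2 v0)))
            (.atom (.same v1 v0))))))) ∧
     Derivable pcfDefinition
      (.all .i (.all .i (.all .i
        (.imp (prv (atom (value v1)))
          (.imp (prv (atom (transsem v2 v1)))
            (.imp (prv (atom (value v0)))
              (.imp (prv (atom (transsem v2 v0)))
                (.atom (.same v1 v0)))))))))) ∧
    -- Equivalence of semantics
    (Derivable pcfDefinition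
      (.all .i (.all .i
        (.imp (prv (atom (natsem v1 v0)))
          (.and (prv (atom (value v0))) (prv (atom (transsem v1 v0))))))) ∧
     Derivable pcfDefinition
      (.all .i (.all .i
        (.imp (.and (prv (atom (value v0))) (prv (atom (transsem v1 v0))))
          (prv (atom (natsem v1 v0))))))) ∧
    -- Subject reduction
    (Derivable pcfDefinition
      (.all .i (.all .i
        (.imp (prv (atom (natsem v1 v0)))
          (.all .i (.imp (prv (atom (typeof v2 v0))) (prv (atom (typeof v1 v0)))))))) ∧
     Derivable pcfDefinition
      (.all .i (.all .i
        (.imp (prv (atom (transone v1 v0)))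
          (.all .i (.imp (prv (atom (typeof v2 v0))) (prv (atom (typeof v1 v0)))))))) ∧
     Derivable pcfDefinition
      (.all .i (.all .i
        (.imp (prv (atom (transsem v1 v0)))
          (.all .i (.imp (prv (atom (typeof v2 v0))) (prv (atom (typeof v1 v0))))))))) ∧
    -- Unicity of typing
    Derivable pcfDefinition
      (.all .i (.all .i (.all .i
        (.imp (prv (atom (typeof v2 v1)))
          (.imp (prv (atom (typeof v2 v0)))
            (.atom (.same v1 v0))))))) := by
  refine ⟨⟨?_, ?_, ?_⟩, ⟨?_, ?_⟩, ⟨?_, ?_, ?_⟩, ?_⟩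
  · exact .all₃_imp₂_intro fun _ _ _ _ m v u => by simpa using natsem_deterministic
  · exact .all₃_imp₂_intro fun _ _ _ _ m v u => by simpa using transone_deterministic
  · refine .all₃_imp₂_intro fun _ _ _ _ m v u hv hm => .imp₂_intro fun _ e hu hm' => ?_
    simpa using transsem_deterministic (by simpa using e hv) (by simpa using e hm)
      (by simpa using hu) (by simpa using hm')
  · refine .all₂_imp_intro fun _ _ H _ m v h => ?_
    have h : PDer H (prvA (natsem m v)) := by simpa using h
    simpa using Der.andR (value_of_natsem h) (transsem_of_natsem h)
  · refine .all₂_imp_intro fun _ _ _ _ m v h => ?_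
    simpa using natsem_of_transsem (by simpa using h.and_left) (by simpa using h.and_right)
  · exact .all₂_imp_all_imp_intro fun _ _ _ _ m n t => by simpa using typeof_of_natsem
  · exact .all₂_imp_all_imp_intro fun _ _ _ _ m n t => by simpa using typeof_of_transone
  · exact .all₂_imp_all_imp_intro fun _ _ _ _ m n t => by simpa using typeof_of_transsem
  · exact .all₃_imp₂_intro fun _ _ _ _ m t u => by simpa using typeof_unique
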